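/- Let $E$ be the $2\times2$ unit matrix, let $\mathbb D=\{Z\in \mathrm{Mat}_{2\times2}(\mathbb C): E-Z^\dagger Z>0\}$ be the matrix ball, $\overline{\mathbb D}$ its closure and $U(2)=\{Z: Z^\dagger Z=E\}$. Let $\lambda>3$ be an integer and let $\mu_\lambda$ be the measure on $\mathbb D$ given by $$d\mu_\lambda=c_\lambda\,\det(E-Z^\dagger Z)^{\lambda-4}\,|dZ|,\qquad c_\lambda=\pi^{-4}(\lambda-1)(\lambda-2)^2(\lambda-3),$$ where $|dZ|$ is Lebesgue measure. Let $\mathcal H$ be the Hilbert space of states $\psi$, represented in $L^2(\mathbb D,\mu_\lambda)$ by their coherent-state functions $\psi(Z)=\langle Z|\psi\rangle$, which are exactly the complex conjugates of the functions in the weighted Bergman space $L^2\mathcal O(\mathbb D,\mu_\lambda)$ of square-integrable holomorphic functions; the coherent state $|Z\rangle\in\mathcal H$, $Z\in\mathbb D$, is the vector that represents evaluation at $Z$. For $f\in C(\overline{\mathbb D})$ let $T_f$ be the Toeplitz operator on $\mathcal H$ that multiplies by $f$ and then projects $L^2(\mathbb D,\mu_\lambda)$ orthogonally onto $\mathcal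 H$. The coordinate annihilation operators are $a_{kl}=T_{z_{kl}}$, $k,l\in\{1,2\}$; equivalently, $a_{kl}|Z\rangle=z_{kl}|Z\rangle$ for all $Z\in\mathbb D$. Let $\mathcal M^{++}_{pol}$ be the unital C*-algebra of operators on $\mathcal H$ generated by $a_{11},a_{12},a_{21},a_{22}$, and let $\mathrm{Comm}\,\mathcal M^{++}_{pol}$ be its commutator ideal, the smallest closed two-sided ideal containing all commutators. Let $\mathbb M^{00}$ be the conformally compactified Minkowski space: the space, with the topology of the Grassmannian, of all two-dimensional subspaces of $\mathbb C^2\oplus\mathbb C^2$ that are isotropic for the Hermitian form $\mathrm{diag}(1,1,-1,-1)$. **Theorem** (a variant of the Coburn theorem). The set $U(2)$ is the Shilov boundary of $\mathbb D$ (the smallest closed subset of $\overline{\mathbb D}$ on which every function continuous on $\overline{\mathbb D}$ and holomorphic on $\mathbb D$ attains its maximum modulus), and $Z\mapsto\{(Z\zeta,\zeta):\zeta\in\mathbb C^2\}$ is a homeomorphism $U(2)\cong\mathbb M^{00}$. There is an exact sequence of C*-algebra homomorphisms $$0\longrightarrow \mathrm{Comm}\,\mathcal M^{++}_{pol}\xrightarrow{\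 \iota\ }\mathcal M^{++}_{pol}\xrightarrow{\ \pi_\lambda\ }C(\mathbb M^{00})\longrightarrow 0,$$ where $\iota$ is the inclusion. Moreover, for every $f\in C(\overline{\mathbb D})$ one has $T_f\in\mathcal M^{++}_{pol}$, and $\pi_\lambda(T_f)$ is the restriction $f|_{U(2)}$ under the identification $\mathbb M^{00}\cong U(2)$. In particular $\pi_\lambda(a_{kl})$ is the coordinate function $z_{kl}$, and the kernel of the symbol map $f\mapsto [T_f]\in\mathcal M^{++}_{pol}/\mathrm{Comm}\,\mathcal M^{++}_{pol}$ is the ideal of functions that vanish on $U(2)$. -/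

import Mathlib

open MeasureTheory Matrix
open scoped ENNReal ComplexConjugate ComplexOrder

noncomputable section

namespace QuantumMinkowski

/-! ## The matrix ball, its unitary boundary and the weighted measures -/

/-- The space `Mat_{2×2}(ℂ)` of points `Z = (z_{kl})`, as the normed space `ℂ⁴`
with its Lebesgue measure. -/
abbrev Mat2 : Type := Fin 2 → Fin 2 → ℂ

/-- The Hermitian matrix `E - Z† Z`. -/
def defect (Z : Mat2) : Matrix (Fin 2) (Fin 2) ℂ := 1 - (Matrix.of Z)ᴴ * Matrix.of Z

/-- The matrix ball `𝔻 = {Z : E - Z† Z > 0}`. -/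
def ball : Set Mat2 := {Z | (defect Z).PosDef}

/-- The unitary group `U(2) = {Z : Z† Z = E}` as a subset of `Mat_{2×2}(ℂ)`. -/
def U2 : Set Mat2 := {Z | (Matrix.of Z)ᴴ * Matrix.of Z = 1}

/-- The normalising constant `c_n = π⁻⁴ (n-1) (n-2)² (n-3)`. -/
def normConst (n : ℕ) : ℝ :=
  (Real.pi ^ 4)⁻¹ * ((n : ℝ) - 1) * ((n : ℝ) - 2) ^ 2 * ((n : ℝ) - 3)

/-- The measure `dμ_n = c_n det(E - Z† Z)^(n-4) |dZ|` on `𝔻`. It is only used for `n > 3`, so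
that the exponent `n - 4` is a genuine difference of natural numbers. -/
def weightedMeasure (n : ℕ) : Measure Mat2 :=
  (volume.restrict ball).withDensity
    fun Z => ENNReal.ofReal (normConst n * (defect Z).det.re ^ (n - 4))

theorem norm_entry_le_of_mem_ball {Z : Mat2} (hZ : Z ∈ ball) (k l : Fin 2) : ‖Z k l‖ ≤ 1 := by
  have h : 0 < (defect Z) l l := (show (defect Z).PosDef from hZ).diag_pos
  have h' := (Complex.pos_iff.1 h).1
  simp only [defect, Matrix.sub_apply, Matrix.one_apply_eq, Matrix.mul_apply,
    Matrix.conjTranspose_apply, Matrix.of_apply, Fin.sum_univ_two, Complex.sub_re,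
    Complex.one_re, Complex.add_re, Complex.star_def, ← Complex.normSq_eq_conj_mul_self,
    Complex.ofReal_re, Complex.normSq_eq_norm_sq] at h'
  have h0 := sq_nonneg ‖Z 0 l‖
  have h1 := sq_nonneg ‖Z 1 l‖
  have : ‖Z k l‖ ^ 2 ≤ 1 := by fin_cases k <;> simp only [Fin.zero_eta, Fin.mk_one] <;> linarith
  exact (sq_le_one_iff₀ (norm_nonneg _)).1 this

instance compactSpace_closure_ball : CompactSpace (closure ball) := by
  apply isCompact_iff_compactSpace.1
  refine Metric.isCompact_of_isClosed_isBounded isClosed_closure ?_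
  apply Bornology.IsBounded.closure
  refine (Metric.isBounded_closedBall (x := (0 : Mat2)) (r := 1)).subset fun Z hZ => ?_
  rw [mem_closedBall_zero_iff, pi_norm_le_iff_of_nonneg zero_le_one]
  intro k
  rw [pi_norm_le_iff_of_nonneg zero_le_one]
  exact fun l => norm_entry_le_of_mem_ball hZ k l

theorem U2_subset_closure_ball : U2 ⊆ closure ball := by
  intro Z hZ
  have hlim : Filter.Tendsto (fun t : ℝ => (t : ℂ) • Z) (nhdsWithin 1 (Set.Ioo 0 1)) (nhds Z) := by
    have : Continuous fun t : ℝ => (t : ℂ) • Z := by fun_prop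
    simpa using (this.tendsto 1).mono_left nhdsWithin_le_nhds
  have hne : (nhdsWithin (1 : ℝ) (Set.Ioo 0 1)).NeBot := by
    rw [← mem_closure_iff_nhdsWithin_neBot, closure_Ioo (by norm_num)]
    simp
  refine mem_closure_of_tendsto hlim ?_
  filter_upwards [self_mem_nhdsWithin] with t ht
  have hU : (Matrix.of Z)ᴴ * Matrix.of Z = 1 := hZ
  have : defect ((t : ℂ) • Z) = (1 - t ^ 2 : ℝ) • (1 : Matrix (Fin 2) (Fin 2) ℂ) := by
    have e : Matrix.of ((t : ℂ) • Z) = (t : ℂ) • Matrix.of Z := rfl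
    rw [defect, e, Matrix.conjTranspose_smul, Matrix.smul_mul, Matrix.mul_smul, hU, smul_smul]
    ext i j
    simp [Matrix.one_apply]
    split_ifs <;> simp [sq]
  change (defect _).PosDef
  rw [this]
  exact Matrix.PosDef.one.smul (by nlinarith [ht.1, ht.2])

/-! ## The Hilbert space of the quantum particle

The coherent state representation identifies a state `ψ` with the function `Z ↦ ⟨Z|ψ⟩`, which
is linear in `ψ` and antiholomorphic in `Z` (its complex conjugate `Z ↦ ⟨ψ|Z⟩` runs through the
weighted Bergman space `L²𝒪(𝔻, dμ_n)`). -/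

/-- The classes in `L²(𝔻, dμ_n)` of complex conjugates of holomorphic functions on `𝔻`. -/
def conjBergman (n : ℕ) : Submodule ℂ (Lp ℂ 2 (weightedMeasure n)) where
  carrier := {ψ | ∃ g : Mat2 → ℂ, DifferentiableOn ℂ g ball ∧
    ∀ᵐ Z ∂(weightedMeasure n), ψ Z = conj (g Z)}
  zero_mem' := ⟨0, differentiableOn_const 0, by
    filter_upwards [Lp.coeFn_zero ℂ 2 (weightedMeasure n)] with Z hZ
    rw [hZ]
    simp⟩
  add_mem' := by
    rintro ψ φ ⟨g, hg, hψ⟩ ⟨h, hh, hφ⟩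
    refine ⟨g + h, hg.add hh, ?_⟩
    filter_upwards [hψ, hφ, Lp.coeFn_add ψ φ] with Z h1 h2 h3
    rw [h3, Pi.add_apply, h1, h2, Pi.add_apply, map_add]
  smul_mem' := by
    rintro c ψ ⟨g, hg, hψ⟩
    refine ⟨conj c • g, hg.const_smul _, ?_⟩
    filter_upwards [hψ, Lp.coeFn_smul c ψ] with Z h1 h2
    rw [h2, Pi.smul_apply, h1, Pi.smul_apply, smul_eq_mul, smul_eq_mul, map_mul,
      Complex.conj_conj]

/-- The Hilbert space `ℋ` of states: the conjugate of the weighted Bergman space. (The Bergman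
space is closed in `L²`; taking the closure only makes completeness evident.) -/
def stateSpace (n : ℕ) : Submodule ℂ (Lp ℂ 2 (weightedMeasure n)) :=
  (conjBergman n).topologicalClosure

/-- The state space as a Hilbert space in its own right. -/
def State (n : ℕ) : Type := stateSpace n

instance (n : ℕ) : NormedAddCommGroup (State n) :=
  inferInstanceAs (NormedAddCommGroup (stateSpace n))

instance (n : ℕ) : InnerProductSpace ℂ (State n) :=
  inferInstanceAs (InnerProductSpace ℂ (stateSpace n))

instance (n : ℕ) : CompleteSpace (State n) :=
  (Submodule.isClosed_topologicalClosure (conjBergman n)).completeSpace_coe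

/-- The inclusion of `ℋ` in `L²(𝔻, dμ_n)`. -/
def incl (n : ℕ) : State n →ₗᵢ[ℂ] Lp ℂ 2 (weightedMeasure n) :=
  (stateSpace n).subtypeₗᵢ

/-- The orthogonal projection of `L²(𝔻, dμ_n)` onto `ℋ`. -/
def proj (n : ℕ) : Lp ℂ 2 (weightedMeasure n) →L[ℂ] State n :=
  haveI : CompleteSpace (stateSpace n) := inferInstanceAs (CompleteSpace (State n))
  (stateSpace n).orthogonalProjectionOnto

theorem inner_proj (n : ℕ) (ψ : State n) (φ : Lp ℂ 2 (weightedMeasure n)) :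
    inner ℂ ψ (proj n φ) = inner ℂ (incl n ψ) φ :=
  haveI : CompleteSpace (stateSpace n) := inferInstanceAs (CompleteSpace (State n))
  Submodule.inner_orthogonalProjectionOnto_eq_of_mem_left (K := stateSpace n) ψ φ

/-! ## Toeplitz and annihilation operators -/

/-- A continuous function on `closure 𝔻`, extended by zero to all matrices. -/
def extendZero (f : C(closure ball, ℂ)) : Mat2 → ℂ :=
  Function.extend Subtype.val f 0

theorem extendZero_apply (f : C(closure ball, ℂ)) (Z : closure ball) :
    extendZero f Z = f Z :=
  Subtype.val_injective.extend_apply _ _ _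

theorem memLp_extendZero (n : ℕ) (f : C(closure ball, ℂ)) :
    MemLp (extendZero f) ∞ (weightedMeasure n) := by
  refine memLp_top_of_bound (C := ‖f‖) ?_ (Filter.Eventually.of_forall fun Z => ?_)
  · exact ((MeasurableEmbedding.subtype_coe isClosed_closure.measurableSet).measurable_extend
      f.continuous.measurable measurable_zero).aestronglyMeasurable
  · by_cases hZ : Z ∈ closure ball
    · rw [extendZero_apply f ⟨Z, hZ⟩]
      exact f.norm_coe_le_norm _
    · rw [extendZero, Function.extend_apply' _ _ _ (by simpa using hZ)]
      simp

/-- The operator `M_f` of multiplication by `f ∈ C(closure 𝔻)` on `L²(𝔻, dμ_n)`. -/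
def mulOp (n : ℕ) (f : C(closure ball, ℂ)) :
    Lp ℂ 2 (weightedMeasure n) →L[ℂ] Lp ℂ 2 (weightedMeasure n) :=
  LinearMap.mkContinuous
    { toFun := fun ψ => (memLp_extendZero n f).toLp (extendZero f) • ψ
      map_add' := fun ψ φ => Lp.add_smul _ ψ φ
      map_smul' := fun c ψ => (Lp.smul_comm c _ ψ).symm }
    ‖(memLp_extendZero n f).toLp (extendZero f)‖
    fun ψ => Lp.norm_smul_le _ ψ

theorem mulOp_ae (n : ℕ) (f : C(closure ball, ℂ)) (ψ : Lp ℂ 2 (weightedMeasure n)) :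
    ∀ᵐ Z ∂(weightedMeasure n), mulOp n f ψ Z = extendZero f Z * ψ Z := by
  have h : mulOp n f ψ = (memLp_extendZero n f).toLp (extendZero f) • ψ := rfl
  rw [h]
  filter_upwards [Lp.coeFn_lpSMul (r := 2) ((memLp_extendZero n f).toLp (extendZero f)) ψ,
    (memLp_extendZero n f).coeFn_toLp] with Z h1 h2
  rw [h1, Pi.smul_apply', h2, smul_eq_mul]

/-- The Toeplitz operator with symbol `f`: multiplication by `f` followed by the orthogonal
projection of `L²(𝔻, dμ_n)` onto `ℋ`. -/
def toeplitz (n : ℕ) (f : C(closure ball, ℂ)) : State n →L[ℂ] State n :=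
  proj n ∘L mulOp n f ∘L (incl n).toContinuousLinearMap

/-- The coordinate function `Z ↦ z_{kl}` on `closure 𝔻`. -/
def coord (k l : Fin 2) : C(closure ball, ℂ) where
  toFun Z := (Z : Mat2) k l
  continuous_toFun := (continuous_apply_apply k l).comp continuous_subtype_val

/-- The coordinate annihilation operator `a_{kl}`, the operator whose adjoint maps the function
`⟨Z|ψ⟩` to `conj z_{kl} ⟨Z|ψ⟩`, that is, the operator with `a_{kl} |Z⟩ = z_{kl} |Z⟩`; see
`star_annihilation_ae` and `annihilation_coherent`. -/
def annihilation (n : ℕ) (k l : Fin 2) : State n →L[ℂ] State n :=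
  toeplitz n (coord k l)

/-- `v` is the coherent state `|Z⟩`: `⟨v|ψ⟩` is the value at `Z` of the antiholomorphic
function representing `ψ`. -/
def IsCoherent (n : ℕ) (Z : Mat2) (v : State n) : Prop :=
  ∀ (ψ : State n) (g : Mat2 → ℂ), DifferentiableOn ℂ g ball →
    (∀ᵐ W ∂(weightedMeasure n), incl n ψ W = conj (g W)) →
    inner ℂ v ψ = conj (g Z)

/-- The complex conjugate of the coordinate function. -/
def conjCoord (k l : Fin 2) : C(closure ball, ℂ) where
  toFun Z := conj ((Z : Mat2) k l)
  continuous_toFun := Complex.continuous_conj.comp (coord k l).continuous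

theorem ae_mem_closure_ball (n : ℕ) : ∀ᵐ Z ∂(weightedMeasure n), Z ∈ closure ball := by
  refine (withDensity_absolutelyContinuous _ _).ae_le ?_
  exact ae_mono (Measure.restrict_mono subset_closure le_rfl)
    (ae_restrict_mem isClosed_closure.measurableSet)

theorem mulOp_conjCoord_mem (n : ℕ) (k l : Fin 2) {ψ : Lp ℂ 2 (weightedMeasure n)}
    (hψ : ψ ∈ stateSpace n) : mulOp n (conjCoord k l) ψ ∈ stateSpace n := by
  refine (map_mem_closure (mulOp n (conjCoord k l)).continuous hψ ?_ :)
  rintro φ ⟨g, hg, hφ⟩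
  refine ⟨fun Z => Z k l * g Z, ?_, ?_⟩
  · exact DifferentiableOn.mul (by fun_prop) hg
  · filter_upwards [mulOp_ae n (conjCoord k l) φ, hφ, ae_mem_closure_ball n] with Z h1 h2 h3
    rw [h1, h2, extendZero_apply _ ⟨Z, h3⟩, map_mul]
    rfl

theorem inner_mulOp_coord (n : ℕ) (k l : Fin 2) (ψ φ : Lp ℂ 2 (weightedMeasure n)) :
    inner ℂ ψ (mulOp n (coord k l) φ) = inner ℂ (mulOp n (conjCoord k l) ψ) φ := by
  rw [L2.inner_def, L2.inner_def]
  apply integral_congr_ae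
  filter_upwards [mulOp_ae n (coord k l) φ, mulOp_ae n (conjCoord k l) ψ, ae_mem_closure_ball n]
    with Z h1 h2 h3
  rw [h1, h2, extendZero_apply _ ⟨Z, h3⟩, extendZero_apply _ ⟨Z, h3⟩]
  simp [coord, conjCoord]
  ring

theorem incl_star_annihilation (n : ℕ) (k l : Fin 2) (ψ : State n) :
    incl n (star (annihilation n k l) ψ) = mulOp n (conjCoord k l) (incl n ψ) := by
  let χ : State n := ⟨_, mulOp_conjCoord_mem n k l (show incl n ψ ∈ stateSpace n from ψ.2)⟩
  have : star (annihilation n k l) ψ = χ := by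
    refine ext_inner_right ℂ fun φ => ?_
    rw [ContinuousLinearMap.star_eq_adjoint, ContinuousLinearMap.adjoint_inner_left]
    change inner ℂ ψ (proj n (mulOp n (coord k l) (incl n φ))) = _
    rw [inner_proj, inner_mulOp_coord]
    rfl
  rw [this]
  rfl

/-- The adjoint of `a_{kl}` is multiplication by `conj z_{kl}`. -/
theorem star_annihilation_ae (n : ℕ) (k l : Fin 2) (ψ : State n) :
    ∀ᵐ Z ∂(weightedMeasure n),
      incl n (star (annihilation n k l) ψ) Z = conj (Z k l) * incl n ψ Z := by
  rw [incl_star_annihilation]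
  filter_upwards [mulOp_ae n (conjCoord k l) (incl n ψ), ae_mem_closure_ball n] with Z h1 h2
  rw [h1, extendZero_apply _ ⟨Z, h2⟩]
  rfl

/-- The defining property `a_{kl} |Z⟩ = z_{kl} |Z⟩` of the annihilation operators. -/
theorem annihilation_coherent (n : ℕ) (k l : Fin 2) {Z : Mat2} {v : State n}
    (hv : IsCoherent n Z v) : annihilation n k l v = Z k l • v := by
  refine ext_inner_right ℂ fun ψ => ?_
  have hclosed : IsClosed {φ : Lp ℂ 2 (weightedMeasure n) |
      inner ℂ (incl n (annihilation n k l v)) φ = inner ℂ (incl n (Z k l • v)) φ} :=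
    isClosed_eq (by fun_prop) (by fun_prop)
  refine hclosed.closure_subset_iff.2 ?_ ψ.2
  rintro φ ⟨g, hg, hφ⟩
  let χ : State n := ⟨φ, subset_closure ⟨g, hg, hφ⟩⟩
  have h1 : inner ℂ v (star (annihilation n k l) χ) = conj (Z k l * g Z) := by
    refine hv _ (fun W => W k l * g W) (DifferentiableOn.mul (by fun_prop) hg) ?_
    filter_upwards [star_annihilation_ae n k l χ, hφ] with W h2 h3
    rw [h2, map_mul, ← h3]
    rfl
  have h2 : inner ℂ v χ = conj (g Z) := hv χ g hg hφ
  rw [ContinuousLinearMap.star_eq_adjoint, ContinuousLinearMap.adjoint_inner_right] at h1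
  change inner ℂ (annihilation n k l v) χ = inner ℂ (Z k l • v) χ
  rw [h1, inner_smul_left, h2, map_mul]

/-! ## The algebra of the quantum phase space and its commutator ideal -/

/-- `ℳ_pol`, the C*-algebra generated by the coordinate annihilation operators. -/
def phaseAlgebra (n : ℕ) : StarSubalgebra ℂ (State n →L[ℂ] State n) :=
  (StarAlgebra.adjoin ℂ
    (Set.range fun p : Fin 2 × Fin 2 => annihilation n p.1 p.2)).topologicalClosure

/-- The commutator ideal of a C*-algebra: the smallest closed two-sided ideal that contains all
commutators. -/
def commutatorIdeal (A : Type*) [Ring A] [StarRing A] [Algebra ℂ A] [TopologicalSpace A]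
    [ContinuousStar A] : NonUnitalStarSubalgebra ℂ A where
  carrier := {x | ∀ I : TwoSidedIdeal A, IsClosed (I : Set A) →
    (∀ a b : A, a * b - b * a ∈ I) → x ∈ I}
  zero_mem' := fun I _ _ => I.zero_mem
  add_mem' := fun hx hy I hI hc => I.add_mem (hx I hI hc) (hy I hI hc)
  mul_mem' := fun {x y} hx _ I hI hc => I.mul_mem_right x y (hx I hI hc)
  smul_mem' := fun c x hx I hI hc => by
    rw [Algebra.smul_def]
    exact I.mul_mem_left _ _ (hx I hI hc)
  star_mem' := fun {x} hx I hI hc => by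
    let J : TwoSidedIdeal A := TwoSidedIdeal.mk' {y | star y ∈ I}
      (by simp [I.zero_mem])
      (fun {x y} hx hy => by
        rw [Set.mem_ofPred_eq, star_add]
        exact I.add_mem hx hy)
      (fun {x} hx => by
        rw [Set.mem_ofPred_eq, star_neg]
        exact I.neg_mem hx)
      (fun {x y} hy => by
        rw [Set.mem_ofPred_eq, star_mul]
        exact I.mul_mem_right _ _ hy)
      (fun {x y} hx => by
        rw [Set.mem_ofPred_eq, star_mul]
        exact I.mul_mem_left _ _ hx)
    have hJ : (J : Set A) = star ⁻¹' (I : Set A) := TwoSidedIdeal.coe_mk' _ _ _ _ _ _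
    have key : x ∈ (J : Set A) := by
      refine hx J (hJ ▸ hI.preimage continuous_star) fun a b => ?_
      change _ ∈ (J : Set A)
      rw [hJ, Set.mem_preimage, star_sub, star_mul, star_mul]
      exact hc _ _
    rw [hJ] at key
    exact key

/-! ## Compactified Minkowski space -/

/-- Twistor space `ℂ⁴ = ℂ² ⊕ ℂ²`. -/
abbrev Twistor : Type := EuclideanSpace ℂ (Fin 2 ⊕ Fin 2)

/-- The twistor form of signature `(+ + - -)`, in its diagonal representation. -/
def twistorForm (u v : Twistor) : ℂ :=
  ∑ i, conj (u (Sum.inl i)) * v (Sum.inl i) - ∑ i, conj (u (Sum.inr i)) * v (Sum.inr i)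

/-- The conformally compactified Minkowski space `𝕄⁰⁰`: the two-dimensional subspaces of twistor
space that are isotropic for the twistor form. -/
def Minkowski : Type :=
  {w : Submodule ℂ Twistor // Module.finrank ℂ w = 2 ∧ ∀ u ∈ w, ∀ v ∈ w, twistorForm u v = 0}

/-- The topology of the Grassmannian: a subspace is identified with the orthogonal projection
onto it. -/
instance : TopologicalSpace Minkowski :=
  TopologicalSpace.induced
    (fun w : Minkowski => (w.1.starProjection : Twistor →L[ℂ] Twistor)) inferInstance

/-- The linear map `ζ ↦ (Zζ, ζ)` from `ℂ²` to twistor space. -/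
def graphMap (Z : Mat2) : (Fin 2 → ℂ) →ₗ[ℂ] Twistor where
  toFun ζ := WithLp.toLp 2 (Sum.elim (Matrix.of Z *ᵥ ζ) ζ)
  map_add' ζ ξ := by
    ext i
    cases i <;> simp only [Matrix.mulVec_add] <;> rfl
  map_smul' c ζ := by
    ext i
    cases i <;> simp only [Matrix.mulVec_smul] <;> rfl

/-- The point `{(Zζ, ζ) : ζ ∈ ℂ²}` of `𝕄⁰⁰` with matrix coordinate `Z ∈ U(2)`. -/
def minkowskiPoint (Z : U2) : Minkowski :=
  ⟨LinearMap.range (graphMap Z), by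
    constructor
    · rw [LinearMap.finrank_range_of_inj]
      · simp
      · intro ζ ξ h
        ext i
        simpa [graphMap] using congrArg (fun u : Twistor => u (Sum.inr i)) h
    · rintro _ ⟨ζ, rfl⟩ _ ⟨ξ, rfl⟩
      have hZ : (Matrix.of Z.1)ᴴ * Matrix.of Z.1 = 1 := Z.2
      have h : star (Matrix.of Z.1 *ᵥ ζ) ⬝ᵥ (Matrix.of Z.1 *ᵥ ξ) = star ζ ⬝ᵥ ξ := by
        rw [Matrix.star_mulVec, ← Matrix.dotProduct_mulVec, Matrix.mulVec_mulVec, hZ,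
          Matrix.one_mulVec]
      exact sub_eq_zero.2 h⟩

/-! ## The Shilov boundary -/

/-- `K` is the Shilov boundary of `𝔻`: the smallest closed subset of `closure 𝔻` on which every
function continuous on `closure 𝔻` and holomorphic on `𝔻` attains its maximum modulus. -/
def IsShilovBoundary (K : Set Mat2) : Prop :=
  IsLeast {S : Set Mat2 | IsClosed S ∧ S ⊆ closure ball ∧
    ∀ f : Mat2 → ℂ, ContinuousOn f (closure ball) → DifferentiableOn ℂ f ball →
      ∀ Z ∈ closure ball, ∃ W ∈ S, ‖f Z‖ ≤ ‖f W‖} K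

end QuantumMinkowski

end

/-! The proof has two halves: a symbol homomorphism on the algebra, and the identification of its
kernel with the commutator ideal.

The symbol. For `u` in `U(2)` the entire function `exp (tr u†Z - 2)` peaks at `u`: its squared
modulus is `exp (-gap)`, where `gap` equals `‖Z - u‖² + tr (E - Z†Z)` in the Hilbert–Schmidt norm
(`gap_eq`). The states given by the conjugates of its powers concentrate at `u`, so along them every
`T_f` has the approximate eigenvalue `f u`, and its adjoint the conjugate
(`mulOp_peakState_isLittleO`). The operators whose joint approximate eigenvalues depend continuously
on `u` form a C*-algebra, which contains the generators and hence the whole algebra. Reading off the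
eigenvalue is a *-homomorphism to `C(U(2))` that sends `T_f` to the restriction of `f`. It is onto
by Tietze, and it kills commutators because its target is commutative.

The kernel. Let `I` be a closed ideal containing all commutators. Multiplication by a conjugate
coordinate preserves the state space, so `f ↦ T_f` is multiplicative modulo `I`, by
Stone–Weierstrass. Every polynomial in the generators and their adjoints is thus a Toeplitz operator
modulo `I`, and the kernel is reached once `T_f` is in `I` for all `f` vanishing on `U(2)`. Such an
`f` is a uniform limit of multiples of the deficit `τ = tr (E - Z†Z)`, so only `T_τ` is at issue.

The analytic core is the estimate `‖T_τ ψ‖² ≤ C ⟨ψ, S ψ⟩` with `S` the sum of the self-commutators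
of the `a_{kl}` (`exists_norm_toeplitz_deficitSymbol_le`). The right-hand form is the sum of the
squared distances of `z_{kl} ψ` from `ℋ` (`inner_selfCommutator`). Around `Z` one uses the affine
chart `W ↦ Z + A W B`, with `A = √(E - ZZ†)` and `B = √(E - Z†Z)`, on a fixed small polydisc. There
the mean value property makes the conjugate of a linear coordinate orthogonal to holomorphic
functions. Hence the local squared distance, summed over the coordinates, is at least a constant
times `tr A² · tr B² · |f Z|² = τ² |f Z|²`. Integrating over `Z` is harmless, since weights and
Jacobians at points of one chart are comparable (`lintegral_displaced_le`). With `t` a positive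
multiple of `S` of norm at most one, the estimate forces `T_τ (1 - t)^N → 0`, while `1 - (1 - t)^N`
is in `I`; so `T_τ` is in `I`.

For the Shilov boundary, each point of the ball is the centre of an analytic disc with boundary in
`U(2)`, so the maximum principle applies, and the peak functions show that no point of `U(2)` can be
dropped. Isotropic planes are exactly the graphs of unitary matrices, and compactness of `U(2)`
gives the homeomorphism. -/

noncomputable section

namespace QuantumMinkowski

/-! ## Square roots of `2 × 2` matrices -/

/-- Complex `2 × 2` matrices as a matrix algebra. -/
abbrev M2 : Type := Matrix (Fin 2) (Fin 2) ℂ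

/-- The positive square root of a positive definite `2 × 2` matrix. -/
def root (P : M2) : M2 :=
  (((√(P.trace.re + 2 * √P.det.re))⁻¹ : ℝ) : ℂ) • (P + ((√P.det.re : ℝ) : ℂ) • 1)

theorem root_isHermitian {P : M2} (hP : P.IsHermitian) : (root P).IsHermitian := by
  have h : Pᴴ = P := hP
  simp [root, Matrix.IsHermitian, h]

theorem ofReal_re_trace {P : M2} (hP : P.IsHermitian) : ((P.trace.re : ℝ) : ℂ) = P.trace := by
  apply Complex.conj_eq_iff_re.1
  rw [← Complex.star_def, ← Matrix.trace_conjTranspose, hP]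

theorem ofReal_re_det {P : M2} (hP : P.IsHermitian) : ((P.det.re : ℝ) : ℂ) = P.det := by
  apply Complex.conj_eq_iff_re.1
  rw [← Complex.star_def, ← Matrix.det_conjTranspose, hP]

theorem cayley_hamilton_two (P : M2) : P * P = P.trace • P - P.det • 1 := by
  ext i j
  fin_cases i <;> fin_cases j <;>
    simp [Matrix.mul_apply, Matrix.trace, Matrix.det_fin_two] <;> ring

/-- With `s = √det P`, Cayley–Hamilton turns `(P + s)²` into `(tr P + 2s) P`, which explains the
normalisation in `root`. The closed formula makes measurability and intertwining relations
immediate. -/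
theorem root_mul_root {P : M2} (hP : P.IsHermitian) (hd : 0 < P.det.re)
    (ht : 0 < P.trace.re) : root P * root P = P := by
  have hs : ((√P.det.re : ℝ) : ℂ) * ((√P.det.re : ℝ) : ℂ) = P.det := by
    rw [← Complex.ofReal_mul, Real.mul_self_sqrt hd.le, ofReal_re_det hP]
  have hτ0 : 0 < P.trace.re + 2 * √P.det.re := by positivity
  have hτ : ((√(P.trace.re + 2 * √P.det.re) : ℝ) : ℂ) * ((√(P.trace.re + 2 * √P.det.re) : ℝ) : ℂ)
      = P.trace + 2 * ((√P.det.re : ℝ) : ℂ) := by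
    rw [← Complex.ofReal_mul, Real.mul_self_sqrt hτ0.le]
    push_cast
    rw [ofReal_re_trace hP]
  have hne : ((√(P.trace.re + 2 * √P.det.re) : ℝ) : ℂ) ≠ 0 :=
    Complex.ofReal_ne_zero.2 (Real.sqrt_pos.2 hτ0).ne'
  rw [root, Matrix.smul_mul, Matrix.mul_smul, smul_smul, Complex.ofReal_inv, ← mul_inv, hτ]
  have e : (P + ((√P.det.re : ℝ) : ℂ) • (1 : M2)) * (P + ((√P.det.re : ℝ) : ℂ) • 1)
      = (P.trace + 2 * ((√P.det.re : ℝ) : ℂ)) • P := by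
    rw [Matrix.add_mul, Matrix.mul_add, Matrix.mul_add, cayley_hamilton_two P]
    simp only [Matrix.smul_mul, Matrix.mul_smul, Matrix.one_mul, Matrix.mul_one, smul_smul, hs]
    module
  rw [e, smul_smul, inv_mul_cancel₀, one_smul]
  rw [← hτ]
  exact mul_ne_zero hne hne

/-! ## Defects of contractions -/

/-- The strict contractions among the `2 × 2` matrices. -/
def StrictContraction (Z : M2) : Prop := (1 - Zᴴ * Z).PosDef

theorem mem_ball_iff {Z : Mat2} : Z ∈ ball ↔ StrictContraction (Matrix.of Z) := Iff.rfl

theorem isHermitian_one_sub (Z : M2) : (1 - Zᴴ * Z).IsHermitian := by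
  simp [Matrix.IsHermitian]

theorem det_one_sub_conjTranspose (Z : M2) : (1 - Zᴴᴴ * Zᴴ).det = (1 - Zᴴ * Z).det := by
  rw [Matrix.conjTranspose_conjTranspose, Matrix.det_one_sub_mul_comm]

theorem trace_one_sub_conjTranspose (Z : M2) : (1 - Zᴴᴴ * Zᴴ).trace = (1 - Zᴴ * Z).trace := by
  rw [Matrix.conjTranspose_conjTranspose, Matrix.trace_sub, Matrix.trace_sub,
    Matrix.trace_mul_comm]

/-- The square root of `1 - Z† Z`. -/
def rdef (Z : M2) : M2 := root (1 - Zᴴ * Z)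

theorem rdef_isHermitian (Z : M2) : (rdef Z).IsHermitian := root_isHermitian (isHermitian_one_sub Z)

/-- The defects of `Z` and `Z†` have the same trace and determinant, so both roots are the same
affine polynomial, evaluated at `1 - Z†Z` and at `1 - ZZ†`; `Z†` intertwines these. -/
theorem conjTranspose_mul_rdef (Z : M2) : Zᴴ * rdef Zᴴ = rdef Z * Zᴴ := by
  rw [rdef, rdef, root, root, det_one_sub_conjTranspose, trace_one_sub_conjTranspose,
    Matrix.conjTranspose_conjTranspose]
  simp only [Matrix.mul_smul, Matrix.smul_mul, Matrix.mul_add, Matrix.add_mul, Matrix.mul_sub,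
    Matrix.sub_mul, Matrix.mul_one, Matrix.one_mul, Matrix.mul_assoc]

theorem mul_rdef (Z : M2) : Z * rdef Z = rdef Zᴴ * Z := by
  simpa using conjTranspose_mul_rdef Zᴴ

variable {Z : M2}

theorem StrictContraction.det_pos (hZ : StrictContraction Z) : 0 < (1 - Zᴴ * Z).det.re :=
  (Complex.pos_iff.1 (Matrix.PosDef.det_pos hZ)).1

theorem StrictContraction.trace_pos (hZ : StrictContraction Z) : 0 < (1 - Zᴴ * Z).trace.re :=
  (Complex.pos_iff.1 (Matrix.PosDef.trace_pos hZ)).1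

theorem StrictContraction.rdef_mul_rdef (hZ : StrictContraction Z) :
    rdef Z * rdef Z = 1 - Zᴴ * Z :=
  root_mul_root (isHermitian_one_sub Z) hZ.det_pos hZ.trace_pos

theorem StrictContraction.rdef_conjTranspose_mul (hZ : StrictContraction Z) :
    rdef Zᴴ * rdef Zᴴ = 1 - Z * Zᴴ := by
  have h := root_mul_root (isHermitian_one_sub Zᴴ) (by
    rw [det_one_sub_conjTranspose]
    exact hZ.det_pos) (by
    rw [trace_one_sub_conjTranspose]
    exact hZ.trace_pos)
  rw [rdef]
  rwa [Matrix.conjTranspose_conjTranspose] at h ⊢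

theorem StrictContraction.isUnit_rdef (hZ : StrictContraction Z) : IsUnit (rdef Z) := by
  have h : IsUnit (1 - Zᴴ * Z) := Matrix.PosDef.isUnit hZ
  rw [← hZ.rdef_mul_rdef] at h
  exact isUnit_of_mul_isUnit_left h

theorem StrictContraction.isUnit_rdef_conjTranspose (hZ : StrictContraction Z) :
    IsUnit (rdef Zᴴ) := by
  have h : IsUnit (1 - Zᴴ * Z) := Matrix.PosDef.isUnit hZ
  rw [Matrix.isUnit_iff_isUnit_det, ← det_one_sub_conjTranspose, Matrix.conjTranspose_conjTranspose,
    ← hZ.rdef_conjTranspose_mul, ← Matrix.isUnit_iff_isUnit_det] at h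
  exact isUnit_of_mul_isUnit_left h

theorem StrictContraction.conjTranspose (hZ : StrictContraction Z) : StrictContraction Zᴴ := by
  rw [StrictContraction, Matrix.conjTranspose_conjTranspose, ← hZ.rdef_conjTranspose_mul]
  have h := Matrix.PosDef.one.conjTranspose_mul_mul_same (B := rdef Zᴴ)
    (Matrix.mulVec_injective_of_isUnit hZ.isUnit_rdef_conjTranspose)
  rwa [Matrix.mul_one, rdef_isHermitian] at h

open scoped Matrix.Norms.L2Operator MatrixOrder

theorem StrictContraction.norm_le_one (hZ : StrictContraction Z) : ‖Z‖ ≤ 1 := by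
  have h : Zᴴ * Z ≤ 1 := by
    rw [Matrix.le_iff]
    exact Matrix.PosDef.posSemidef hZ
  have h2 : ‖Zᴴ * Z‖ ≤ 1 := (CStarAlgebra.norm_le_one_iff_of_nonneg _ (star_mul_self_nonneg Z)).2 h
  have h3 : ‖Zᴴ * Z‖ = ‖Z‖ * ‖Z‖ := CStarRing.norm_star_mul_self
  nlinarith [norm_nonneg Z]

theorem StrictContraction.norm_rdef_le (hZ : StrictContraction Z) : ‖rdef Z‖ ≤ 1 := by
  have h : rdef Z * rdef Z ≤ 1 := by
    rw [hZ.rdef_mul_rdef]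
    exact sub_le_self _ (star_mul_self_nonneg Z)
  have e : star (rdef Z) = rdef Z := rdef_isHermitian Z
  have h1 : (0 : M2) ≤ rdef Z * rdef Z := by
    have := star_mul_self_nonneg (rdef Z)
    rwa [e] at this
  have h2 := (CStarAlgebra.norm_le_one_iff_of_nonneg _ h1).2 h
  have h3 : ‖star (rdef Z) * rdef Z‖ = ‖rdef Z‖ * ‖rdef Z‖ := CStarRing.norm_star_mul_self
  rw [e] at h3
  nlinarith [norm_nonneg (rdef Z)]

/-- The middle factor in `1 - Z'† Z' = B S B` for `Z' = Z + A W B`. -/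
def midFactor (Z W : M2) : M2 :=
  1 - (Zᴴ * W + Wᴴ * Z + Wᴴ * (rdef Zᴴ * rdef Zᴴ) * W)

/-- The displacement of `Z` by `W`, measured in the geometry of the ball. -/
def displace (Z W : M2) : M2 := Z + rdef Zᴴ * W * rdef Z

theorem displace_conjTranspose (Z W : M2) : (displace Z W)ᴴ = displace Zᴴ Wᴴ := by
  have h1 : (rdef Zᴴ)ᴴ = rdef Zᴴ := rdef_isHermitian _
  have h2 : (rdef Z)ᴴ = rdef Z := rdef_isHermitian _
  simp [displace, h1, h2, Matrix.mul_assoc]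

/-- The intertwining relations pull a factor `rdef Z` out of both sides of every cross term. Hence
whether the displaced point stays in the ball depends only on the middle factor, uniformly in `Z`.
-/
theorem StrictContraction.one_sub_displace (hZ : StrictContraction Z) (W : M2) :
    1 - (displace Z W)ᴴ * displace Z W = rdef Z * midFactor Z W * rdef Z := by
  have h1 : (rdef Zᴴ)ᴴ = rdef Zᴴ := rdef_isHermitian _
  have h2 : (rdef Z)ᴴ = rdef Z := rdef_isHermitian _
  have e : (1 : M2) = rdef Z * rdef Z + Zᴴ * Z := by rw [hZ.rdef_mul_rdef]; abel
  have e1 : Zᴴ * (rdef Zᴴ * W * rdef Z) = rdef Z * (Zᴴ * W) * rdef Z := by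
    rw [← Matrix.mul_assoc, ← Matrix.mul_assoc, conjTranspose_mul_rdef, Matrix.mul_assoc (rdef Z)]
  have e2 : rdef Z * (Wᴴ * rdef Zᴴ) * Z = rdef Z * (Wᴴ * Z) * rdef Z := by
    rw [Matrix.mul_assoc, Matrix.mul_assoc, ← mul_rdef]
    simp only [Matrix.mul_assoc]
  rw [displace, Matrix.conjTranspose_add, Matrix.conjTranspose_mul, Matrix.conjTranspose_mul, h1, h2,
    Matrix.add_mul, Matrix.mul_add, Matrix.mul_add, e1, e2, midFactor, Matrix.mul_sub,
    Matrix.sub_mul, Matrix.mul_one]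
  nth_rewrite 1 [e]
  noncomm_ring

theorem midFactor_isHermitian (Z W : M2) : (midFactor Z W).IsHermitian := by
  have h1 : (rdef Zᴴ)ᴴ = rdef Zᴴ := rdef_isHermitian _
  simp [midFactor, Matrix.IsHermitian, h1, Matrix.mul_assoc]
  abel

/-- All matrices besides `W` have norm at most one, so the deviation is at most `1/8 + 1/8 + 1/64`.
-/
theorem StrictContraction.norm_one_sub_midFactor (hZ : StrictContraction Z) {W : M2}
    (hW : ‖W‖ ≤ 1 / 8) : ‖1 - midFactor Z W‖ ≤ 1 / 2 := by
  rw [midFactor, sub_sub_cancel]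
  have hZ1 := hZ.norm_le_one
  have hZ2 : ‖Zᴴ‖ ≤ 1 := hZ.conjTranspose.norm_le_one
  have hA := hZ.conjTranspose.norm_rdef_le
  have hW' : ‖Wᴴ‖ = ‖W‖ := norm_star W
  have h0 := norm_nonneg W
  have h1 : ‖Zᴴ * W‖ ≤ 1 * (1 / 8) := norm_mul_le_of_le hZ2 hW
  have h2 : ‖Wᴴ * Z‖ ≤ (1 / 8) * 1 := norm_mul_le_of_le (hW'.trans_le hW) hZ1
  have h3 : ‖Wᴴ * (rdef Zᴴ * rdef Zᴴ) * W‖ ≤ (1 / 8) * (1 * 1) * (1 / 8) :=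
    norm_mul_le_of_le (norm_mul_le_of_le (hW'.trans_le hW) (norm_mul_le_of_le hA hA)) hW
  have h4 := norm_add₃_le (a := Zᴴ * W) (b := Wᴴ * Z) (c := Wᴴ * (rdef Zᴴ * rdef Zᴴ) * W)
  linarith

theorem posDef_of_norm_one_sub_le {S : M2} (hS : S.IsHermitian) (h : ‖1 - S‖ ≤ 1 / 2) :
    S.PosDef := by
  have hsa : IsSelfAdjoint (1 - S) := (IsSelfAdjoint.one M2).sub hS
  have h1 : 1 - S ≤ algebraMap ℝ M2 ‖1 - S‖ := hsa.le_algebraMap_norm_self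
  have h2 : algebraMap ℝ M2 ‖1 - S‖ ≤ algebraMap ℝ M2 (1 / 2) := algebraMap_le_algebraMap.2 h
  have h3 : (S - (1 / 2 : ℝ) • (1 : M2)).PosSemidef := by
    rw [← Matrix.nonneg_iff_posSemidef]
    have h4 := sub_nonneg.2 (h1.trans h2)
    rw [Algebra.algebraMap_eq_smul_one] at h4
    convert h4 using 1
    module
  have h5 : ((1 / 2 : ℝ) • (1 : M2)).PosDef := Matrix.PosDef.one.smul (by norm_num)
  simpa using h5.add_posSemidef h3

theorem norm_inv_le_two {S : M2} (hS : S.PosDef) (h : ‖1 - S‖ ≤ 1 / 2) : ‖S⁻¹‖ ≤ 2 := by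
  have e : S⁻¹ = 1 + (1 - S) * S⁻¹ := by
    rw [Matrix.sub_mul, Matrix.one_mul,
      Matrix.mul_nonsing_inv _ ((Matrix.isUnit_iff_isUnit_det _).1 hS.isUnit)]
    abel
  have h1 : ‖S⁻¹‖ ≤ 1 + 1 / 2 * ‖S⁻¹‖ := by
    calc ‖S⁻¹‖ = ‖1 + (1 - S) * S⁻¹‖ := by rw [← e]
      _ ≤ ‖(1 : M2)‖ + ‖(1 - S) * S⁻¹‖ := norm_add_le _ _
      _ ≤ 1 + 1 / 2 * ‖S⁻¹‖ :=
        add_le_add norm_one.le (norm_mul_le_of_le h le_rfl)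
  linarith

theorem StrictContraction.displace (hZ : StrictContraction Z) {W : M2} (hW : ‖W‖ ≤ 1 / 8) :
    StrictContraction (displace Z W) := by
  rw [StrictContraction, hZ.one_sub_displace]
  have h := (posDef_of_norm_one_sub_le (midFactor_isHermitian Z W)
    (hZ.norm_one_sub_midFactor hW)).conjTranspose_mul_mul_same (B := rdef Z)
    (Matrix.mulVec_injective_of_isUnit hZ.isUnit_rdef)
  rwa [rdef_isHermitian] at h

/-- For `Y = B B'⁻¹`, the factorisation `B'² = B S B` gives `Y Y† = S⁻¹`, so `‖Y‖² ≤ 2`. The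
geometries at `Z` and at a displaced point are thus comparable with a constant independent of `Z`.
-/
theorem StrictContraction.rdef_eq_mul_rdef_displace (hZ : StrictContraction Z) {W : M2}
    (hW : ‖W‖ ≤ 1 / 8) :
    ∃ Y : M2, ‖Y‖ ≤ 2 ∧ rdef Z = Y * rdef (QuantumMinkowski.displace Z W) := by
  set Z' := QuantumMinkowski.displace Z W with hZ'
  have hd : StrictContraction Z' := hZ.displace hW
  have hS := hZ.norm_one_sub_midFactor hW
  have hSp := posDef_of_norm_one_sub_le (midFactor_isHermitian Z W) hS
  have hu := (Matrix.isUnit_iff_isUnit_det _).1 hZ.isUnit_rdef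
  have hu' := (Matrix.isUnit_iff_isUnit_det _).1 hd.isUnit_rdef
  have h2 : (rdef Z)ᴴ = rdef Z := rdef_isHermitian _
  have h2' : (rdef Z')ᴴ = rdef Z' := rdef_isHermitian _
  refine ⟨rdef Z * (rdef Z')⁻¹, ?_, ?_⟩
  · have e : (rdef Z * (rdef Z')⁻¹) * (rdef Z * (rdef Z')⁻¹)ᴴ = (midFactor Z W)⁻¹ := by
      rw [Matrix.conjTranspose_mul, Matrix.conjTranspose_nonsing_inv, h2, h2', Matrix.mul_assoc,
        ← Matrix.mul_assoc _ _ (rdef Z), ← Matrix.mul_inv_rev, hd.rdef_mul_rdef, hZ',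
        hZ.one_sub_displace, Matrix.mul_inv_rev, Matrix.mul_inv_rev]
      rw [Matrix.mul_assoc, Matrix.mul_assoc, Matrix.nonsing_inv_mul _ hu, Matrix.mul_one,
        Matrix.mul_nonsing_inv_cancel_left _ _ hu]
    have h3 : ‖(rdef Z * (rdef Z')⁻¹) * (rdef Z * (rdef Z')⁻¹)ᴴ‖ = _ :=
      CStarRing.norm_self_mul_star
    rw [e] at h3
    nlinarith [norm_nonneg (rdef Z * (rdef Z')⁻¹), norm_inv_le_two hSp hS]
  · rw [Matrix.nonsing_inv_mul_cancel_right _ _ hu']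

/-- The reverse comparison: for `Y = B' B⁻¹` one has `Y†Y = S`, of norm at most `3/2`. -/
theorem StrictContraction.rdef_displace_eq_mul_rdef (hZ : StrictContraction Z) {W : M2}
    (hW : ‖W‖ ≤ 1 / 8) :
    ∃ Y : M2, ‖Y‖ ≤ 2 ∧ rdef (QuantumMinkowski.displace Z W) = Y * rdef Z := by
  set Z' := QuantumMinkowski.displace Z W with hZ'
  have hd : StrictContraction Z' := hZ.displace hW
  have hS := hZ.norm_one_sub_midFactor hW
  have hu := (Matrix.isUnit_iff_isUnit_det _).1 hZ.isUnit_rdef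
  have h2 : (rdef Z)ᴴ = rdef Z := rdef_isHermitian _
  have h2' : (rdef Z')ᴴ = rdef Z' := rdef_isHermitian _
  refine ⟨rdef Z' * (rdef Z)⁻¹, ?_, ?_⟩
  · have e : (rdef Z' * (rdef Z)⁻¹)ᴴ * (rdef Z' * (rdef Z)⁻¹) = midFactor Z W := by
      rw [Matrix.conjTranspose_mul, Matrix.conjTranspose_nonsing_inv, h2, h2', Matrix.mul_assoc,
        ← Matrix.mul_assoc _ _ (rdef Z)⁻¹, hd.rdef_mul_rdef, hZ',
        hZ.one_sub_displace]
      rw [Matrix.mul_nonsing_inv_cancel_right _ _ hu, Matrix.nonsing_inv_mul_cancel_left _ _ hu]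
    have h3 : ‖(rdef Z' * (rdef Z)⁻¹)ᴴ * (rdef Z' * (rdef Z)⁻¹)‖ = _ :=
      CStarRing.norm_star_mul_self
    rw [e] at h3
    have h4 : ‖midFactor Z W‖ ≤ 3 / 2 := by
      have := norm_sub_le (1 : M2) (1 - midFactor Z W)
      rw [sub_sub_cancel, norm_one] at this
      linarith
    nlinarith [norm_nonneg (rdef Z' * (rdef Z)⁻¹)]
  · rw [Matrix.nonsing_inv_mul_cancel_right _ _ hu]

theorem norm_entry_le (S : M2) (i j : Fin 2) : ‖S i j‖ ≤ ‖S‖ := by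
  have h := Matrix.l2_opNorm_mulVec S (EuclideanSpace.single j (1 : ℂ))
  rw [EuclideanSpace.single, PiLp.norm_single, norm_one, mul_one] at h
  refine le_trans ?_ h
  have := PiLp.norm_apply_le ((EuclideanSpace.equiv (Fin 2) ℂ).symm
    (S *ᵥ (EuclideanSpace.single j (1 : ℂ)).ofLp)) i
  simpa using this

theorem norm_det_le (S : M2) : ‖S.det‖ ≤ 2 * ‖S‖ ^ 2 := by
  rw [Matrix.det_fin_two]
  have h := norm_sub_le (S 0 0 * S 1 1) (S 0 1 * S 1 0)
  rw [norm_mul, norm_mul] at h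
  have h1 := mul_le_mul (norm_entry_le S 0 0) (norm_entry_le S 1 1) (norm_nonneg _) (norm_nonneg _)
  have h2 := mul_le_mul (norm_entry_le S 0 1) (norm_entry_le S 1 0) (norm_nonneg _) (norm_nonneg _)
  nlinarith

theorem norm_le_sum_entry (S : M2) : ‖S‖ ≤ ∑ i, ∑ j, ‖S i j‖ := by
  have hs : ∀ (i j : Fin 2) (c : ℂ), ‖(Matrix.single i j c : M2)‖ ≤ ‖c‖ := by
    intro i j c
    have h := Matrix.l2_opNorm_conjTranspose_mul_self (Matrix.single i j c : M2)
    rw [Matrix.conjTranspose_single, Matrix.single_mul_single_same, ← Matrix.diagonal_single,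
      Matrix.l2_opNorm_diagonal, Pi.norm_single, norm_mul, norm_star] at h
    exact le_of_abs_le (abs_le_of_sq_le_sq (by nlinarith) (norm_nonneg c))
  conv_lhs => rw [Matrix.matrix_eq_sum_single S]
  refine (norm_sum_le _ _).trans (Finset.sum_le_sum fun i _ => ?_)
  exact (norm_sum_le _ _).trans (Finset.sum_le_sum fun j _ => hs i j _)

/-- The defects differ by `|det Y|²`, and `‖Y‖ ≤ 2` bounds `|det Y|` by `8`. -/
theorem StrictContraction.det_le_det_displace (hZ : StrictContraction Z) {W : M2}
    (hW : ‖W‖ ≤ 1 / 8) :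
    (1 - Zᴴ * Z).det.re ≤
      64 * (1 - (QuantumMinkowski.displace Z W)ᴴ * QuantumMinkowski.displace Z W).det.re := by
  obtain ⟨Y, hY, e⟩ := hZ.rdef_eq_mul_rdef_displace hW
  set Z' := QuantumMinkowski.displace Z W with hZ'
  have hd : StrictContraction Z' := hZ.displace hW
  have h1 : (1 - Zᴴ * Z).det = Y.det ^ 2 * (1 - Z'ᴴ * Z').det := by
    rw [← hZ.rdef_mul_rdef, ← hd.rdef_mul_rdef, Matrix.det_mul, Matrix.det_mul, e, Matrix.det_mul]
    ring
  rw [h1, ← ofReal_re_det (isHermitian_one_sub Z'), Complex.re_mul_ofReal, Complex.ofReal_re]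
  refine mul_le_mul_of_nonneg_right ?_ hd.det_pos.le
  refine (Complex.re_le_norm _).trans ?_
  rw [norm_pow]
  have h2 : ‖Y.det‖ ≤ 8 := (norm_det_le Y).trans (by nlinarith [norm_nonneg Y])
  nlinarith [norm_nonneg Y.det]

/-! ## A change of variables adapted to the ball -/

/-- The linear map `W ↦ A W B`. -/
def sandwich (A B : M2) : Mat2 →ₗ[ℂ] Mat2 where
  toFun W := Matrix.of.symm (A * Matrix.of W * B)
  map_add' V W := by
    rw [← Matrix.of_add_of, Matrix.mul_add, Matrix.add_mul]
    rfl
  map_smul' c W := by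
    rw [← Matrix.smul_of, Matrix.mul_smul, Matrix.smul_mul]
    rfl

theorem of_sandwich (A B : M2) (W : Mat2) :
    Matrix.of (sandwich A B W) = A * Matrix.of W * B := rfl

theorem sandwich_comp (A B X Y : M2) (W : Mat2) :
    sandwich A B (sandwich X Y W) = sandwich (A * X) (Y * B) W := by
  apply Matrix.of.injective
  simp only [of_sandwich, Matrix.mul_assoc]

theorem sandwich_one (W : Mat2) : sandwich 1 1 W = W := by
  apply Matrix.of.injective
  simp only [of_sandwich, Matrix.one_mul, Matrix.mul_one]

section

open scoped Matrix.Norms.L2Operator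

theorem norm_of_le (W : Mat2) : ‖Matrix.of W‖ ≤ 4 * ‖W‖ := by
  refine (norm_le_sum_entry _).trans ?_
  have h : ∀ i j, ‖Matrix.of W i j‖ ≤ ‖W‖ := fun i j =>
    (norm_le_pi_norm (W i) j).trans (norm_le_pi_norm W i)
  simp only [Fin.sum_univ_two]
  linarith [h 0 0, h 0 1, h 1 0, h 1 1]

theorem norm_le_norm_of (W : Mat2) : ‖W‖ ≤ ‖Matrix.of W‖ := by
  refine (pi_norm_le_iff_of_nonneg (norm_nonneg _)).2 fun i => ?_
  exact (pi_norm_le_iff_of_nonneg (norm_nonneg _)).2 fun j => norm_entry_le (Matrix.of W) i j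

theorem norm_sandwich_le {A B : M2} {a b : ℝ} (hA : ‖A‖ ≤ a) (hB : ‖B‖ ≤ b) (W : Mat2) :
    ‖sandwich A B W‖ ≤ 4 * a * b * ‖W‖ := by
  refine (norm_le_norm_of _).trans ?_
  rw [of_sandwich]
  refine (norm_mul_le_of_le (norm_mul_le_of_le hA (norm_of_le W)) hB).trans_eq ?_
  ring

end

/-- The linear part of the displacement from `Z`. -/
def linearPart (Z : Mat2) : Mat2 →ₗ[ℂ] Mat2 :=
  sandwich (rdef (Matrix.of Z)ᴴ) (rdef (Matrix.of Z))

section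

open scoped Matrix.Norms.L2Operator

/-- Charts are taken over balls of the sup norm, which are polydiscs; the factor `4` between sup
norm and operator norm turns the radius `1/8` into `1/32`. -/
theorem norm_of_le_eighth {W : Mat2} (hW : ‖W‖ ≤ 1 / 32) : ‖Matrix.of W‖ ≤ 1 / 8 :=
  (norm_of_le W).trans (by linarith)

end

theorem add_linearPart_mem_ball {Z W : Mat2} (hZ : Z ∈ ball) (hW : ‖W‖ ≤ 1 / 32) :
    Z + linearPart Z W ∈ ball :=
  StrictContraction.displace (mem_ball_iff.1 hZ) (norm_of_le_eighth hW)

section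

open scoped Matrix.Norms.L2Operator

/-- Inserting the comparison matrices on both sides gives `V' = X† V Y` with `‖X‖, ‖Y‖ ≤ 2`; the
factor `16` is `4 · 2 · 2`, the `4` coming from the change of norms. The left factor is handled by
applying the comparison to `Z†` and taking adjoints. -/
theorem linearPart_eq_linearPart_displaced {Z W : Mat2} (hZ : Z ∈ ball) (hW : ‖W‖ ≤ 1 / 32)
    (V : Mat2) : ∃ V', ‖V'‖ ≤ 16 * ‖V‖ ∧ linearPart Z V = linearPart (Z + linearPart Z W) V' := by
  have hZ' : StrictContraction (Matrix.of Z) := hZ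
  obtain ⟨Y, hY, e⟩ := hZ'.rdef_eq_mul_rdef_displace (norm_of_le_eighth hW)
  obtain ⟨X, hX, e'⟩ := hZ'.conjTranspose.rdef_eq_mul_rdef_displace (W := (Matrix.of W)ᴴ)
    ((norm_star (Matrix.of W)).trans_le (norm_of_le_eighth hW))
  rw [← displace_conjTranspose] at e'
  have e2 : rdef (Matrix.of Z)ᴴ = rdef (displace (Matrix.of Z) (Matrix.of W))ᴴ * Xᴴ := by
    rw [← Matrix.conjTranspose_inj, Matrix.conjTranspose_mul, Matrix.conjTranspose_conjTranspose,
      rdef_isHermitian, rdef_isHermitian, e']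
  refine ⟨sandwich Xᴴ Y V, ?_, ?_⟩
  · exact (norm_sandwich_le ((norm_star X).trans_le hX) hY V).trans_eq (by ring)
  · change sandwich _ _ V = sandwich (rdef (displace (Matrix.of Z) (Matrix.of W))ᴴ)
      (rdef (displace (Matrix.of Z) (Matrix.of W))) _
    rw [sandwich_comp, ← e, ← e2]

theorem linearPart_displaced_eq_linearPart {Z W : Mat2} (hZ : Z ∈ ball) (hW : ‖W‖ ≤ 1 / 32)
    (V : Mat2) : ∃ V', ‖V'‖ ≤ 16 * ‖V‖ ∧ linearPart (Z + linearPart Z W) V = linearPart Z V' := by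
  have hZ' : StrictContraction (Matrix.of Z) := hZ
  obtain ⟨Y, hY, e⟩ := hZ'.rdef_displace_eq_mul_rdef (norm_of_le_eighth hW)
  obtain ⟨X, hX, e'⟩ := hZ'.conjTranspose.rdef_displace_eq_mul_rdef (W := (Matrix.of W)ᴴ)
    ((norm_star (Matrix.of W)).trans_le (norm_of_le_eighth hW))
  rw [← displace_conjTranspose] at e'
  have e2 : rdef (displace (Matrix.of Z) (Matrix.of W))ᴴ = rdef (Matrix.of Z)ᴴ * Xᴴ := by
    rw [← Matrix.conjTranspose_inj, Matrix.conjTranspose_mul, Matrix.conjTranspose_conjTranspose,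
      rdef_isHermitian, rdef_isHermitian, e']
  refine ⟨sandwich Xᴴ Y V, ?_, ?_⟩
  · exact (norm_sandwich_le ((norm_star X).trans_le hX) hY V).trans_eq (by ring)
  · change sandwich (rdef (displace (Matrix.of Z) (Matrix.of W))ᴴ)
      (rdef (displace (Matrix.of Z) (Matrix.of W))) V = sandwich _ _ _
    rw [sandwich_comp, ← e, ← e2]

end

/-- The inverse of `linearPart Z` for `Z` in the ball. -/
def linearPartInv (Z : Mat2) : Mat2 →ₗ[ℂ] Mat2 :=
  sandwich (rdef (Matrix.of Z)ᴴ)⁻¹ (rdef (Matrix.of Z))⁻¹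

theorem linearPart_linearPartInv {Z : Mat2} (hZ : Z ∈ ball) (V : Mat2) :
    linearPart Z (linearPartInv Z V) = V := by
  have hZ' : StrictContraction (Matrix.of Z) := hZ
  rw [linearPart, linearPartInv, sandwich_comp,
    Matrix.mul_nonsing_inv _ ((Matrix.isUnit_iff_isUnit_det _).1 hZ'.isUnit_rdef_conjTranspose),
    Matrix.nonsing_inv_mul _ ((Matrix.isUnit_iff_isUnit_det _).1 hZ'.isUnit_rdef), sandwich_one]

theorem linearPartInv_linearPart {Z : Mat2} (hZ : Z ∈ ball) (V : Mat2) :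
    linearPartInv Z (linearPart Z V) = V := by
  have hZ' : StrictContraction (Matrix.of Z) := hZ
  rw [linearPart, linearPartInv, sandwich_comp,
    Matrix.nonsing_inv_mul _ ((Matrix.isUnit_iff_isUnit_det _).1 hZ'.isUnit_rdef_conjTranspose),
    Matrix.mul_nonsing_inv _ ((Matrix.isUnit_iff_isUnit_det _).1 hZ'.isUnit_rdef), sandwich_one]

/-! ### Jacobians of the affine charts and comparison of volumes. -/

instance isAddHaarMeasure_volume_mat2 : (volume : Measure Mat2).IsAddHaarMeasure := by
  rw [volume_pi]
  exact @Measure.pi.isAddHaarMeasure (Fin 2) (fun _ => Fin 2 → ℂ) _ _ (fun _ => volume)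
    (fun _ => inferInstance) (fun _ => inferInstance) (fun _ => inferInstance)
    (fun _ => inferInstance) (fun _ => inferInstance)

/-- The Jacobian of the displacement from `Z`. -/
def jac (Z : Mat2) : ℝ := |LinearMap.det ((linearPart Z).restrictScalars ℝ)|

theorem jac_nonneg (Z : Mat2) : 0 ≤ jac Z := abs_nonneg _

theorem jac_pos {Z : Mat2} (hZ : Z ∈ ball) : 0 < jac Z := by
  have h : (linearPartInv Z).restrictScalars ℝ ∘ₗ (linearPart Z).restrictScalars ℝ
      = LinearMap.id := by
    refine LinearMap.ext fun V => ?_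
    exact linearPartInv_linearPart hZ V
  have h2 := congrArg LinearMap.det h
  rw [LinearMap.det_comp, LinearMap.det_id] at h2
  exact abs_pos.2 (right_ne_zero_of_mul_eq_one h2)

theorem volume_image_linearPart (Z : Mat2) (s : Set Mat2) :
    volume (linearPart Z '' s) = ENNReal.ofReal (jac Z) * volume s :=
  Measure.addHaar_image_linearMap volume ((linearPart Z).restrictScalars ℝ) s

/-- The image of the unit ball under one linear part lies in the image of the ball of radius `16`
under the other; comparing volumes in real dimension `8` gives the constant. -/
theorem jac_displaced_le {Z W : Mat2} (hZ : Z ∈ ball) (hW : ‖W‖ ≤ 1 / 32) :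
    jac (Z + linearPart Z W) ≤ 16 ^ 8 * jac Z := by
  have h1 : linearPart (Z + linearPart Z W) '' Metric.closedBall 0 1 ⊆
      linearPart Z '' Metric.closedBall 0 16 := by
    rintro _ ⟨V, hV, rfl⟩
    obtain ⟨V', hV', e⟩ := linearPart_displaced_eq_linearPart hZ hW V
    refine ⟨V', ?_, e.symm⟩
    rw [mem_closedBall_zero_iff] at hV ⊢
    linarith
  have h2 := measure_mono (μ := volume) h1
  rw [volume_image_linearPart, volume_image_linearPart,
    Measure.addHaar_closedBall (volume : Measure Mat2) 0 (zero_le_one),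
    Measure.addHaar_closedBall (volume : Measure Mat2) 0 (by norm_num : (0 : ℝ) ≤ 16),
    ← mul_assoc, ← mul_assoc, ENNReal.mul_le_mul_iff_left
      (Metric.measure_ball_pos volume 0 one_pos).ne' measure_ball_lt_top.ne,
    ← ENNReal.ofReal_mul (jac_nonneg _), ← ENNReal.ofReal_mul (jac_nonneg _),
    ENNReal.ofReal_le_ofReal_iff (by have := (jac_pos hZ).le; positivity)] at h2
  have h3 : Module.finrank ℝ (Fin 2 → Fin 2 → ℂ) = 8 := by
    simp [Module.finrank_pi_fintype, Complex.finrank_real_complex]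
  rw [h3] at h2
  linarith

theorem lintegral_comp_linearPart {Z : Mat2} (hZ : Z ∈ ball) {f : Mat2 → ℝ≥0∞}
    (hf : Measurable f) :
    ∫⁻ W, f (linearPart Z W) = ENNReal.ofReal (jac Z)⁻¹ * ∫⁻ V, f V := by
  have hd : LinearMap.det ((linearPart Z).restrictScalars ℝ) ≠ 0 := abs_pos.1 (jac_pos hZ)
  have h := Measure.map_linearMap_addHaar_eq_smul_addHaar (volume : Measure Mat2) hd
  have hm : Measurable ((linearPart Z).restrictScalars ℝ) :=
    ((linearPart Z).restrictScalars ℝ).continuous_of_finiteDimensional.measurable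
  have h2 := lintegral_map (μ := volume) hf hm
  rw [h, lintegral_smul_measure, abs_inv] at h2
  exact h2.symm

/-- The unnormalised weight `det(E - Z† Z)^k`. -/
def weight (k : ℕ) (Z : Mat2) : ℝ≥0∞ := ENNReal.ofReal ((defect Z).det.re ^ k)

theorem weight_le_displaced (k : ℕ) {Z W : Mat2} (hZ : Z ∈ ball) (hW : ‖W‖ ≤ 1 / 32) :
    weight k Z ≤ 64 ^ k * weight k (Z + linearPart Z W) := by
  have hZ' : StrictContraction (Matrix.of Z) := hZ
  have h := hZ'.det_le_det_displace (norm_of_le_eighth hW)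
  have e : (64 : ℝ≥0∞) ^ k = ENNReal.ofReal (64 ^ k) := by
    rw [ENNReal.ofReal_pow (by norm_num)]
    simp
  rw [weight, weight, e, ← ENNReal.ofReal_mul (by positivity), ← mul_pow]
  exact ENNReal.ofReal_le_ofReal (pow_le_pow_left₀ hZ'.det_pos.le h k)

/-! ### Measurability of the chart data and openness of the ball. -/

theorem continuous_defect_apply (i j : Fin 2) : Continuous fun Z : Mat2 => defect Z i j := by
  simp only [defect, Matrix.sub_apply, Matrix.mul_apply, Matrix.conjTranspose_apply,
    Matrix.of_apply, Fin.sum_univ_two]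
  fun_prop

theorem continuous_defect_det : Continuous fun Z : Mat2 => (defect Z).det.re := by
  have := continuous_defect_apply
  simp only [Matrix.det_fin_two]
  fun_prop

theorem measurable_weight (k : ℕ) : Measurable (weight k) :=
  ((continuous_defect_det.pow k).measurable).ennreal_ofReal

theorem measurable_root {X : Type*} [MeasurableSpace X] {P : X → M2}
    (hP : ∀ i j, Measurable fun x => P x i j) (i j : Fin 2) :
    Measurable fun x => root (P x) i j := by
  simp only [root, Matrix.smul_apply, Matrix.add_apply, smul_eq_mul, Matrix.det_fin_two,
    Matrix.trace, Matrix.diag, Fin.sum_univ_two]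
  fun_prop

theorem measurable_inv {X : Type*} [MeasurableSpace X] {P : X → M2}
    (hP : ∀ i j, Measurable fun x => P x i j) (i j : Fin 2) :
    Measurable fun x => (P x)⁻¹ i j := by
  simp only [Matrix.inv_def, Ring.inverse_eq_inv', Matrix.smul_apply, smul_eq_mul,
    Matrix.det_fin_two, Matrix.adjugate_fin_two]
  fin_cases i <;> fin_cases j <;> simp <;> fun_prop

theorem measurable_rdef (i j : Fin 2) :
    Measurable fun Z : Mat2 => rdef (Matrix.of Z) i j :=
  measurable_root (fun i j => (continuous_defect_apply i j).measurable) i j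

theorem measurable_rdef_conjTranspose (i j : Fin 2) :
    Measurable fun Z : Mat2 => rdef (Matrix.of Z)ᴴ i j := by
  refine measurable_root (fun i j => ?_) i j
  simp only [Matrix.sub_apply, Matrix.mul_apply, Matrix.conjTranspose_apply,
    Matrix.of_apply, Fin.sum_univ_two]
  fun_prop

theorem measurable_sandwich {X : Type*} [MeasurableSpace X] {A B : X → M2} {W : X → Mat2}
    (hA : ∀ i j, Measurable fun x => A x i j) (hB : ∀ i j, Measurable fun x => B x i j)
    (hW : Measurable W) : Measurable fun x => sandwich (A x) (B x) (W x) := by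
  refine measurable_pi_iff.2 fun i => measurable_pi_iff.2 fun j => ?_
  have h : ∀ x, sandwich (A x) (B x) (W x) i j = (A x * Matrix.of (W x) * B x) i j := fun x => rfl
  simp only [h, Matrix.mul_apply, Fin.sum_univ_two, Matrix.of_apply]
  have hW' : ∀ i j, Measurable fun x => W x i j := fun i j =>
    (measurable_pi_apply j).comp ((measurable_pi_apply i).comp hW)
  fun_prop

/-- Joint measurability in both points is what Tonelli needs in the averaging estimate. -/
theorem measurable_linearPartInv_sub :
    Measurable fun p : Mat2 × Mat2 => linearPartInv p.1 (p.2 - p.1) :=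
  measurable_sandwich (measurable_inv fun i j => (measurable_rdef_conjTranspose i j).comp measurable_fst)
    (measurable_inv fun i j => (measurable_rdef i j).comp measurable_fst)
    (measurable_snd.sub measurable_fst)

/-- Positive trace and determinant suffice for the explicit root `R` to satisfy `R² = P` with `R`
Hermitian and invertible, so `P = R†R` is positive definite. Two strict inequalities make the ball
visibly open. -/
theorem posDef_iff_det_trace {P : M2} :
    P.PosDef ↔ P.IsHermitian ∧ 0 < P.det.re ∧ 0 < P.trace.re := by
  refine ⟨fun h => ⟨h.isHermitian, (Complex.pos_iff.1 h.det_pos).1,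
    (Complex.pos_iff.1 h.trace_pos).1⟩, fun ⟨h1, h2, h3⟩ => ?_⟩
  have e := root_mul_root h1 h2 h3
  have hu : IsUnit (root P) := by
    rw [Matrix.isUnit_iff_isUnit_det]
    refine isUnit_of_mul_isUnit_left (y := (root P).det) ?_
    rw [← Matrix.det_mul, e, isUnit_iff_ne_zero]
    intro h0
    simp [h0] at h2
  have h := Matrix.PosDef.one.conjTranspose_mul_mul_same (B := root P)
    (Matrix.mulVec_injective_of_isUnit hu)
  rwa [Matrix.mul_one, root_isHermitian h1, e] at h

theorem isOpen_ball : IsOpen ball := by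
  have h : ball = {Z : Mat2 | 0 < (defect Z).det.re} ∩ {Z : Mat2 | 0 < (defect Z).trace.re} := by
    ext Z
    exact posDef_iff_det_trace.trans (and_iff_right (isHermitian_one_sub _))
  have ht : Continuous fun Z : Mat2 => (defect Z).trace.re := by
    have := continuous_defect_apply
    simp only [Matrix.trace, Matrix.diag]
    fun_prop
  rw [h]
  exact (isOpen_lt continuous_const continuous_defect_det).inter (isOpen_lt continuous_const ht)

theorem measurable_linearPart_apply (W : Mat2) : Measurable fun Z => linearPart Z W :=
  measurable_sandwich measurable_rdef_conjTranspose measurable_rdef measurable_const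

theorem measurable_jac : Measurable jac := by
  let b := Module.finBasis ℝ Mat2
  have h : ∀ Z, jac Z =
      |(LinearMap.toMatrix b b ((linearPart Z).restrictScalars ℝ)).det| := fun Z => by
    rw [LinearMap.det_toMatrix]
    rfl
  have h2 : ∀ i j, Measurable fun Z =>
      LinearMap.toMatrix b b ((linearPart Z).restrictScalars ℝ) i j := by
    intro i j
    simp only [LinearMap.toMatrix_apply]
    exact ((b.coord i).continuous_of_finiteDimensional.measurable).comp
      (measurable_linearPart_apply (b j))
  have h3 : Measurable fun Z => (LinearMap.toMatrix b b ((linearPart Z).restrictScalars ℝ)).det := by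
    simp only [Matrix.det_apply]
    refine Finset.measurable_fun_sum _ fun σ _ => Measurable.const_smul ?_ _
    exact Finset.measurable_fun_prod _ fun i _ => h2 _ _
  rw [funext h]
  exact h3.abs

/-- The pairs `(Z, Z')` for which `Z'` is a small displacement of `Z`. -/
def nearby : Set (Mat2 × Mat2) :=
  {p | linearPartInv p.1 (p.2 - p.1) ∈ Metric.closedBall (0 : Mat2) (1 / 32)}

theorem measurableSet_nearby : MeasurableSet nearby :=
  measurable_linearPartInv_sub Metric.isClosed_closedBall.measurableSet

theorem exists_eq_displaced {Z Z' : Mat2} (hZ : Z ∈ ball) (h : (Z, Z') ∈ nearby) :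
    ∃ W : Mat2, ‖W‖ ≤ 1 / 32 ∧ Z' = Z + linearPart Z W := by
  refine ⟨linearPartInv Z (Z' - Z), mem_closedBall_zero_iff.1 h, ?_⟩
  rw [linearPart_linearPartInv hZ]
  abel

theorem add_linearPart_mem_nearby {Z : Mat2} (hZ : Z ∈ ball) (W : Mat2) :
    (Z, linearPart Z W + Z) ∈ nearby ↔ W ∈ Metric.closedBall (0 : Mat2) (1 / 32) := by
  change linearPartInv Z (linearPart Z W + Z - Z) ∈ Metric.closedBall (0 : Mat2) (1 / 32) ↔ _
  rw [add_sub_cancel_right, linearPartInv_linearPart hZ]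

/-- The density of the image of Lebesgue measure under `linearPart Z`. -/
def invJac (Z : Mat2) : ℝ≥0∞ := ENNReal.ofReal (jac Z)⁻¹

theorem measurable_invJac : Measurable invJac := measurable_jac.inv.ennreal_ofReal

theorem invJac_mul_jac {Z : Mat2} (hZ : Z ∈ ball) : invJac Z * ENNReal.ofReal (jac Z) = 1 := by
  rw [invJac, ← ENNReal.ofReal_mul (inv_nonneg.2 (jac_nonneg _)), inv_mul_cancel₀ (jac_pos hZ).ne',
    ENNReal.ofReal_one]

theorem invJac_le_displaced {Z W : Mat2} (hZ : Z ∈ ball) (hW : ‖W‖ ≤ 1 / 32) :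
    invJac Z ≤ ENNReal.ofReal (16 ^ 8) * invJac (Z + linearPart Z W) := by
  have h1 := jac_displaced_le hZ hW
  have h2 := jac_pos hZ
  have h3 := jac_pos (add_linearPart_mem_ball hZ hW)
  rw [invJac, invJac, ← ENNReal.ofReal_mul (by positivity)]
  refine ENNReal.ofReal_le_ofReal ?_
  rw [inv_le_iff_one_le_mul₀ h2, mul_assoc, mul_comm _ (jac Z), ← mul_assoc, ← div_eq_mul_inv,
    one_le_div h3]
  exact h1

/-- The indicator function of `nearby`. -/
def nearbyKernel (Z Z' : Mat2) : ℝ≥0∞ := nearby.indicator 1 (Z, Z')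

theorem measurable_nearbyKernel : Measurable fun p : Mat2 × Mat2 => nearbyKernel p.1 p.2 :=
  measurable_one.indicator measurableSet_nearby

theorem nearbyKernel_of_mem {Z Z' : Mat2} (h : (Z, Z') ∈ nearby) : nearbyKernel Z Z' = 1 :=
  Set.indicator_of_mem h _

theorem nearbyKernel_of_notMem {Z Z' : Mat2} (h : (Z, Z') ∉ nearby) : nearbyKernel Z Z' = 0 :=
  Set.indicator_of_notMem h _

/-- Substituting `Z' = Z + linearPart Z W` rewrites the average over a chart as an integral against
a kernel in two variables, ready for exchanging the order of integration. -/
theorem lintegral_displaced_eq {Z : Mat2} (hZ : Z ∈ ball) {G : Mat2 → ℝ≥0∞} (hG : Measurable G) :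
    ∫⁻ W in Metric.closedBall 0 (1 / 32), G (Z + linearPart Z W) =
      invJac Z * ∫⁻ Z', nearbyKernel Z Z' * G Z' := by
  have hf : Measurable fun Z' => nearbyKernel Z Z' * G Z' :=
    (measurable_nearbyKernel.of_uncurry_left (x := Z)).mul hG
  have h1 := lintegral_comp_linearPart hZ (f := fun V => nearbyKernel Z (V + Z) * G (V + Z))
    (hf.comp (measurable_add_const Z))
  rw [lintegral_add_right_eq_self (fun Z' => nearbyKernel Z Z' * G Z') Z] at h1
  rw [invJac, ← h1, ← lintegral_indicator Metric.isClosed_closedBall.measurableSet]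
  refine lintegral_congr fun W => ?_
  by_cases hW : W ∈ Metric.closedBall (0 : Mat2) (1 / 32)
  · rw [Set.indicator_of_mem hW, nearbyKernel_of_mem ((add_linearPart_mem_nearby hZ W).2 hW),
      one_mul, add_comm]
  · rw [Set.indicator_of_notMem hW,
      nearbyKernel_of_notMem (mt (add_linearPart_mem_nearby hZ W).1 hW), zero_mul]

/-- The points that are close to `Z'`, measured in the geometry of the ball at `Z'`. -/
def neighbours (Z' : Mat2) : Set Mat2 :=
  (fun Z => Z - Z') ⁻¹' (linearPart Z' '' Metric.closedBall 0 (1 / 2))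

theorem measurableSet_image_closedBall (Z : Mat2) (r : ℝ) :
    MeasurableSet (linearPart Z '' Metric.closedBall 0 r) :=
  ((isCompact_closedBall (0 : Mat2) r).image
    (linearPart Z).continuous_of_finiteDimensional).measurableSet

theorem measurableSet_neighbours (Z' : Mat2) : MeasurableSet (neighbours Z') :=
  (measurableSet_image_closedBall Z' _).preimage (measurable_sub_const Z')

theorem volume_neighbours (Z' : Mat2) : volume (neighbours Z') =
    ENNReal.ofReal (jac Z') * volume (Metric.closedBall (0 : Mat2) (1 / 2)) := by
  rw [← volume_image_linearPart]
  exact (measurePreserving_sub_right volume Z').measure_preimage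
    (measurableSet_image_closedBall Z' _).nullMeasurableSet

/-- The relation of being a small displacement is symmetric up to enlarging the radius from `1/32`
to `16/32 = 1/2`. -/
theorem mem_neighbours_displaced {Z W : Mat2} (hZ : Z ∈ ball) (hW : ‖W‖ ≤ 1 / 32) :
    Z ∈ neighbours (Z + linearPart Z W) := by
  obtain ⟨V, hV, e⟩ := linearPart_eq_linearPart_displaced hZ hW W
  refine ⟨-V, ?_, ?_⟩
  · rw [mem_closedBall_zero_iff, norm_neg]
    linarith
  · rw [map_neg, ← e]
    exact (sub_add_cancel_left Z _).symm

/-- The norm of the averaging operator. -/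
def averagingConst (k : ℕ) : ℝ≥0∞ :=
  64 ^ k * ENNReal.ofReal (16 ^ 8) * volume (Metric.closedBall (0 : Mat2) (1 / 2))

theorem averagingConst_ne_top (k : ℕ) : averagingConst k ≠ ∞ :=
  ENNReal.mul_ne_top (ENNReal.mul_ne_top (ENNReal.pow_ne_top (by simp)) ENNReal.ofReal_ne_top)
    measure_closedBall_lt_top.ne

/-- A Schur-type bound. For fixed `Z'` the contributing `Z` lie in `neighbours Z'`, where weight and
inverse Jacobian are comparable to their values at `Z'`; the volume of that set is a constant times
`jac Z'`, which cancels the inverse Jacobian. -/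
theorem lintegral_nearbyKernel_le (k : ℕ) (Z' : Mat2) :
    ∫⁻ Z in ball, weight k Z * invJac Z * nearbyKernel Z Z' ≤
      averagingConst k * ball.indicator (weight k) Z' := by
  have hmD : MeasurableSet ball := isOpen_ball.measurableSet
  by_cases hZ' : Z' ∈ ball
  · rw [Set.indicator_of_mem hZ']
    calc ∫⁻ Z in ball, weight k Z * invJac Z * nearbyKernel Z Z'
        ≤ ∫⁻ Z in ball, (64 ^ k * weight k Z') * (ENNReal.ofReal (16 ^ 8) * invJac Z')
            * (neighbours Z').indicator 1 Z := by
          refine setLIntegral_mono' hmD fun Z hZ => ?_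
          by_cases hp : (Z, Z') ∈ nearby
          · obtain ⟨W, hW, rfl⟩ := exists_eq_displaced hZ hp
            rw [Set.indicator_of_mem (mem_neighbours_displaced hZ hW), nearbyKernel_of_mem hp]
            exact mul_le_mul' (mul_le_mul' (weight_le_displaced k hZ hW)
              (invJac_le_displaced hZ hW)) le_rfl
          · rw [nearbyKernel_of_notMem hp, mul_zero]
            exact zero_le
      _ ≤ ∫⁻ Z, (64 ^ k * weight k Z') * (ENNReal.ofReal (16 ^ 8) * invJac Z')
            * (neighbours Z').indicator 1 Z := setLIntegral_le_lintegral _ _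
      _ = (64 ^ k * weight k Z') * (ENNReal.ofReal (16 ^ 8) * invJac Z')
            * volume (neighbours Z') := by
          rw [lintegral_const_mul _ (measurable_one.indicator (measurableSet_neighbours Z')),
            lintegral_indicator_one (measurableSet_neighbours Z')]
      _ = averagingConst k * weight k Z' * (invJac Z' * ENNReal.ofReal (jac Z')) := by
          rw [volume_neighbours, averagingConst]
          ac_rfl
      _ = averagingConst k * weight k Z' := by rw [invJac_mul_jac hZ', mul_one]
  · rw [Set.indicator_of_notMem hZ', mul_zero]
    -- Charts centred in the ball stay in the ball, so the kernel vanishes when `Z'` lies outside.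
    refine (setLIntegral_congr_fun hmD fun Z hZ => ?_).trans_le (lintegral_zero).le
    have hp : (Z, Z') ∉ nearby := by
      intro hp
      obtain ⟨W, hW, e⟩ := exists_eq_displaced hZ hp
      exact hZ' (e ▸ add_linearPart_mem_ball hZ hW)
    rw [nearbyKernel_of_notMem hp, mul_zero]

/-- Averaging over small displacements is bounded on weighted integrals over the ball. -/
theorem lintegral_displaced_le (k : ℕ) {G : Mat2 → ℝ≥0∞} (hG : Measurable G) :
    ∫⁻ Z in ball, weight k Z * ∫⁻ W in Metric.closedBall 0 (1 / 32), G (Z + linearPart Z W) ≤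
      averagingConst k * ∫⁻ Z in ball, weight k Z * G Z := by
  have hmD : MeasurableSet ball := isOpen_ball.measurableSet
  have hwκ : Measurable fun Z => weight k Z * invJac Z :=
    (measurable_weight k).mul measurable_invJac
  have hK := measurable_nearbyKernel
  have hK1 : ∀ Z, Measurable fun Z' => nearbyKernel Z Z' := fun Z => hK.of_uncurry_left
  have hK2 : ∀ Z', Measurable fun Z => nearbyKernel Z Z' := fun Z' => hK.of_uncurry_right
  calc ∫⁻ Z in ball, weight k Z * ∫⁻ W in Metric.closedBall 0 (1 / 32), G (Z + linearPart Z W)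
      = ∫⁻ Z in ball, ∫⁻ Z', weight k Z * invJac Z * nearbyKernel Z Z' * G Z' := by
        refine setLIntegral_congr_fun hmD fun Z hZ => ?_
        have hm : Measurable fun Z' => nearbyKernel Z Z' * G Z' := (hK1 Z).mul hG
        rw [lintegral_displaced_eq hZ hG, ← mul_assoc, ← lintegral_const_mul _ hm]
        simp only [mul_assoc]
    _ = ∫⁻ Z', ∫⁻ Z in ball, weight k Z * invJac Z * nearbyKernel Z Z' * G Z' := by
        refine lintegral_lintegral_swap ?_
        exact (((hwκ.comp measurable_fst).mul hK).mul (hG.comp measurable_snd)).aemeasurable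
    _ ≤ ∫⁻ Z', averagingConst k * ball.indicator (weight k) Z' * G Z' := by
        refine lintegral_mono fun Z' => ?_
        have hm : Measurable fun Z => weight k Z * invJac Z * nearbyKernel Z Z' := hwκ.mul (hK2 Z')
        rw [lintegral_mul_const _ hm]
        exact mul_le_mul_left (lintegral_nearbyKernel_le k Z') _
    _ = averagingConst k * ∫⁻ Z in ball, weight k Z * G Z := by
        have hm : Measurable (ball.indicator fun Z => weight k Z * G Z) :=
          ((measurable_weight k).mul hG).indicator hmD
        rw [← lintegral_indicator hmD, ← lintegral_const_mul _ hm]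
        refine lintegral_congr fun Z => ?_
        by_cases hZ : Z ∈ ball
        · rw [Set.indicator_of_mem hZ, Set.indicator_of_mem hZ, mul_assoc]
        · rw [Set.indicator_of_notMem hZ, Set.indicator_of_notMem hZ]
          simp

/-! ## Mean values over polydiscs -/

theorem measurePreserving_smul_of_norm_eq_one {ε : Fin 2 → Fin 2 → ℂ} (hε : ∀ i j, ‖ε i j‖ = 1) :
    MeasurePreserving (fun W : Mat2 => fun i j => ε i j * W i j) := by
  have h1 : ∀ c : ℂ, ‖c‖ = 1 → MeasurePreserving (fun z : ℂ => c * z) := fun c hc =>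
    (rotation ⟨c, mem_sphere_zero_iff_norm.2 hc⟩).measurePreserving
  exact volume_preserving_pi fun i => volume_preserving_pi fun j => h1 _ (hε i j)

/-- A ball of the sup norm is a polydisc, hence invariant under independent rotations of the
coordinates. This serves the mean value property, with equal phases, and the sign changes in
`normSq_mul_moment_le`. -/
theorem setIntegral_closedBall_smul {ε : Fin 2 → Fin 2 → ℂ} (hε : ∀ i j, ‖ε i j‖ = 1) (r : ℝ)
    (f : Mat2 → ℂ) :
    ∫ W in Metric.closedBall (0 : Mat2) r, f (fun i j => ε i j * W i j) =
      ∫ W in Metric.closedBall (0 : Mat2) r, f W := by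
  have hnorm : ∀ W : Mat2, ‖(fun i j => ε i j * W i j : Mat2)‖ = ‖W‖ := by
    intro W
    simp only [Pi.norm_def, Pi.nnnorm_def, nnnorm_mul]
    have : ∀ i j, ‖ε i j‖₊ = 1 := fun i j => NNReal.eq (hε i j)
    simp [this]
  let e : Mat2 ≃ᵐ Mat2 :=
    { toFun := fun W i j => ε i j * W i j
      invFun := fun W i j => (ε i j)⁻¹ * W i j
      left_inv := fun W => by
        ext i j
        have : ε i j ≠ 0 := norm_ne_zero_iff.1 (by rw [hε]; exact one_ne_zero)
        field_simp
      right_inv := fun W => by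
        ext i j
        have : ε i j ≠ 0 := norm_ne_zero_iff.1 (by rw [hε]; exact one_ne_zero)
        field_simp
      measurable_toFun := by
        change Measurable fun W : Mat2 => fun i j => ε i j * W i j
        fun_prop
      measurable_invFun := by
        change Measurable fun W : Mat2 => fun i j => (ε i j)⁻¹ * W i j
        fun_prop }
  have hp : MeasurePreserving e := measurePreserving_smul_of_norm_eq_one hε
  have h := hp.setIntegral_preimage_emb e.measurableEmbedding f (Metric.closedBall 0 r)
  have hpre : e ⁻¹' Metric.closedBall 0 r = Metric.closedBall 0 r := by
    ext W
    rw [Set.mem_preimage, mem_closedBall_zero_iff, mem_closedBall_zero_iff]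
    change ‖(fun i j => ε i j * W i j : Mat2)‖ ≤ r ↔ _
    rw [hnorm W]
  rw [hpre] at h
  exact h

theorem circleAverage_comp_smul {g : Mat2 → ℂ} {O : Set Mat2} {r : ℝ}
    (hB : Metric.closedBall (0 : Mat2) r ⊆ O) (hg : DifferentiableOn ℂ g O) {W : Mat2}
    (hW : ‖W‖ ≤ r) : Real.circleAverage (fun c : ℂ => g (c • W)) 0 1 = g 0 := by
  have hmap : ∀ c : ℂ, ‖c‖ ≤ 1 → c • W ∈ O := by
    intro c hc
    refine hB (mem_closedBall_zero_iff.2 ?_)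
    rw [norm_smul]
    exact (mul_le_of_le_one_left (norm_nonneg W) hc).trans hW
  have hd : DifferentiableOn ℂ (fun c : ℂ => g (c • W)) (Metric.closedBall 0 1) := by
    refine hg.comp (by fun_prop) fun c hc => hmap c (mem_closedBall_zero_iff.1 hc)
  have h := DiffContOnCl.circleAverage (f := fun c : ℂ => g (c • W)) (c := 0) (R := 1) (by
    rw [abs_one]
    refine DifferentiableOn.diffContOnCl ?_
    rwa [closure_ball _ one_ne_zero])
  rw [h, zero_smul]

/-- Rotating `W` by a common phase does not change the integral; averaging over the phase and
exchanging integrals replaces `g` by its mean over the disc `c ↦ g (c • W)`, which is `g 0`. -/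
theorem integral_circleInvariant_mul {g φ : Mat2 → ℂ} {O : Set Mat2} {r : ℝ}
    (hB : Metric.closedBall (0 : Mat2) r ⊆ O) (hg : DifferentiableOn ℂ g O) (hφ : Continuous φ)
    (hinv : ∀ (c : ℂ) (W : Mat2), ‖c‖ = 1 → φ (c • W) = φ W) :
    ∫ W in Metric.closedBall (0 : Mat2) r, φ W * g W =
      g 0 * ∫ W in Metric.closedBall (0 : Mat2) r, φ W := by
  set B := Metric.closedBall (0 : Mat2) r with hBdef
  have hBm : MeasurableSet B := Metric.isClosed_closedBall.measurableSet
  have h1 : ∀ θ : ℝ, ∫ W in B, φ W * g W = ∫ W in B, φ W * g (circleMap 0 1 θ • W) := by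
    intro θ
    have hc : ‖circleMap 0 1 θ‖ = 1 := by simp
    rw [← setIntegral_closedBall_smul (ε := fun _ _ => circleMap 0 1 θ) (fun _ _ => hc) r]
    refine setIntegral_congr_fun hBm fun W _ => ?_
    change φ (circleMap 0 1 θ • W) * g (circleMap 0 1 θ • W) = _
    rw [hinv _ _ hc]
  have h2 : ∫ _ in Set.Ioc 0 (2 * Real.pi), ∫ W in B, φ W * g W =
      ∫ θ in Set.Ioc 0 (2 * Real.pi), ∫ W in B, φ W * g (circleMap 0 1 θ • W) :=
    setIntegral_congr_fun measurableSet_Ioc fun θ _ => h1 θ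
  have hint : IntegrableOn (fun p : ℝ × Mat2 => φ p.2 * g (circleMap 0 1 p.1 • p.2))
      (Set.Icc 0 (2 * Real.pi) ×ˢ B) (volume.prod volume) := by
    refine ContinuousOn.integrableOn_compact (isCompact_Icc.prod (isCompact_closedBall _ _)) ?_
    refine ContinuousOn.mul (by fun_prop) (hg.continuousOn.comp (by fun_prop) ?_)
    rintro ⟨θ, W⟩ ⟨_, hW⟩
    refine hB ?_
    rw [hBdef, mem_closedBall_zero_iff] at hW ⊢
    simpa [norm_smul] using hW
  have h3 : ∫ θ in Set.Ioc 0 (2 * Real.pi), ∫ W in B, φ W * g (circleMap 0 1 θ • W) =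
      ∫ W in B, ∫ θ in Set.Ioc 0 (2 * Real.pi), φ W * g (circleMap 0 1 θ • W) := by
    refine integral_integral_swap ?_
    rw [Measure.prod_restrict]
    exact hint.mono_set (Set.prod_mono Set.Ioc_subset_Icc_self le_rfl)
  have h4 : ∀ W ∈ B, ∫ θ in Set.Ioc 0 (2 * Real.pi), φ W * g (circleMap 0 1 θ • W) =
      (2 * Real.pi : ℝ) * (g 0 * φ W) := by
    intro W hW
    have h := circleAverage_comp_smul hB hg (mem_closedBall_zero_iff.1 hW)
    rw [Real.circleAverage_def, intervalIntegral.integral_of_le Real.two_pi_pos.le] at h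
    rw [integral_const_mul, ← h]
    rw [Complex.real_smul]
    have : ((2 * Real.pi : ℝ) : ℂ) ≠ 0 := Complex.ofReal_ne_zero.2 Real.two_pi_pos.ne'
    push_cast at this ⊢
    field_simp
  rw [h3, setIntegral_congr_fun hBm h4, integral_const_mul, integral_const_mul, setIntegral_const]
    at h2
  have h5 : ((2 * Real.pi : ℝ) : ℂ) ≠ 0 := Complex.ofReal_ne_zero.2 Real.two_pi_pos.ne'
  simp only [Real.volume_real_Ioc, sub_zero, max_eq_left Real.two_pi_pos.le,
    Complex.real_smul] at h2
  exact mul_left_cancel₀ h5 h2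

theorem differentiable_linearPart (Z : Mat2) : Differentiable ℂ (linearPart Z) :=
  (LinearMap.toContinuousLinearMap (linearPart Z)).differentiable

theorem continuous_linearPart (Z : Mat2) : Continuous (linearPart Z) :=
  (differentiable_linearPart Z).continuous

/-- A lower bound for the distance of `conj z_{kl} f` from the holomorphic functions. -/
theorem normSq_mul_integral_le {f h : Mat2 → ℂ} (hf : DifferentiableOn ℂ f ball)
    (hh : DifferentiableOn ℂ h ball) {Z : Mat2} (hZ : Z ∈ ball) (k l : Fin 2) :
    ‖f Z‖ ^ 2 * ∫ W in Metric.closedBall (0 : Mat2) (1 / 32), ‖linearPart Z W k l‖ ^ 2 ≤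
      ∫ W in Metric.closedBall (0 : Mat2) (1 / 32),
        ‖conj ((Z + linearPart Z W) k l) * f (Z + linearPart Z W) - h (Z + linearPart Z W)‖ ^ 2 := by
  set B := Metric.closedBall (0 : Mat2) (1 / 32) with hBdef
  have hBc : IsCompact B := isCompact_closedBall _ _
  have hBm : MeasurableSet B := Metric.isClosed_closedBall.measurableSet
  have hLd := differentiable_linearPart Z
  have hLc := continuous_linearPart Z
  set O : Set Mat2 := (fun W => Z + linearPart Z W) ⁻¹' ball
  have hBO : B ⊆ O := fun W hW => add_linearPart_mem_ball hZ (mem_closedBall_zero_iff.1 hW)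
  set g : Mat2 → ℂ := fun W => f (Z + linearPart Z W)
  set η : Mat2 → ℂ := fun W => h (Z + linearPart Z W)
  set s : Mat2 → ℂ := fun W => linearPart Z W k l
  have hsd : Differentiable ℂ s := by
    have h1 : Differentiable ℂ fun W : Mat2 => W k l := by fun_prop
    exact h1.comp hLd
  have hsc : Continuous s := hsd.continuous
  have hg : DifferentiableOn ℂ g O := hf.comp (by fun_prop) fun W hW => hW
  have hη : DifferentiableOn ℂ η O := hh.comp (by fun_prop) fun W hW => hW
  have hgc : ContinuousOn g B := hg.continuousOn.mono hBO
  have hηc : ContinuousOn η B := hη.continuousOn.mono hBO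
  have hs0 : s 0 = 0 := by simp [s]
  have hg0 : g 0 = f Z := by simp [g]
  have hsm : ∀ (c : ℂ) (W : Mat2), s (c • W) = c * s W := fun c W => by
    simp [s]
  set G : Mat2 → ℂ := fun W => conj (Z k l + s W) * g W - η W with hG
  have hGc : ContinuousOn G B := by
    refine ContinuousOn.sub (ContinuousOn.mul ?_ hgc) hηc
    exact (Complex.continuous_conj.comp (continuous_const.add hsc)).continuousOn
  -- The product is holomorphic and vanishes at the centre, so its mean is zero: the conjugate of
  -- `s` is orthogonal to `g`.
  have i1 : ∫ W in B, g W * s W = 0 := by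
    have := integral_circleInvariant_mul (φ := fun _ => 1) hBO (hg.mul hsd.differentiableOn)
      continuous_const fun _ _ _ => rfl
    simpa only [Pi.mul_apply, one_mul, hs0, mul_zero, zero_mul] using this
  have i2 : ∫ W in B, η W * s W = 0 := by
    have := integral_circleInvariant_mul (φ := fun _ => 1) hBO (hη.mul hsd.differentiableOn)
      continuous_const fun _ _ _ => rfl
    simpa only [Pi.mul_apply, one_mul, hs0, mul_zero, zero_mul] using this
  have i3 : ∫ W in B, ((‖s W‖ ^ 2 : ℝ) : ℂ) * g W = f Z * ((∫ W in B, ‖s W‖ ^ 2 : ℝ) : ℂ) := by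
    rw [← hg0, ← integral_complex_ofReal]
    refine integral_circleInvariant_mul hBO hg (by fun_prop) fun c W hc => ?_
    rw [hsm, norm_mul, hc, one_mul]
  have j1 : IntegrableOn (fun W => g W * s W) B :=
    (hgc.mul hsc.continuousOn).integrableOn_compact hBc
  have j2 : IntegrableOn (fun W => η W * s W) B :=
    (hηc.mul hsc.continuousOn).integrableOn_compact hBc
  have j3 : IntegrableOn (fun W => ((‖s W‖ ^ 2 : ℝ) : ℂ) * g W) B := by
    refine ContinuousOn.integrableOn_compact hBc (ContinuousOn.mul ?_ hgc)
    fun_prop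
  -- Only the term with `conj (s W) * s W` survives, so `G` has the component `f Z * conj s` along
  -- `conj s`.
  have i4 : ∫ W in B, G W * s W = f Z * ((∫ W in B, ‖s W‖ ^ 2 : ℝ) : ℂ) := by
    have e : ∀ W, G W * s W =
        conj (Z k l) * (g W * s W) + ((‖s W‖ ^ 2 : ℝ) : ℂ) * g W - η W * s W := by
      intro W
      have : ((‖s W‖ ^ 2 : ℝ) : ℂ) = conj (s W) * s W := by
        rw [← Complex.normSq_eq_norm_sq, Complex.normSq_eq_conj_mul_self]
      rw [this]
      simp only [hG, map_add]
      ring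
    simp only [e]
    have j8 : IntegrableOn (fun W => conj (Z k l) * (g W * s W) + ((‖s W‖ ^ 2 : ℝ) : ℂ) * g W) B :=
      (j1.const_mul _).add j3
    rw [integral_sub j8 j2, integral_add (j1.const_mul _) j3,
      integral_const_mul, i1, i2, i3]
    ring
  have j4 : IntegrableOn (fun W => ‖G W‖ ^ 2) B := (hGc.norm.pow 2).integrableOn_compact hBc
  have j5 : IntegrableOn (fun W => ‖s W‖ ^ 2) B :=
    (hsc.continuousOn.norm.pow 2).integrableOn_compact hBc
  have j6 : IntegrableOn (fun W => G W * s W) B :=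
    (hGc.mul hsc.continuousOn).integrableOn_compact hBc
  -- Bessel's inequality, obtained by integrating the square of `G` minus its component along `conj
  -- s`.
  have e : ∀ W, ‖G W - f Z * conj (s W)‖ ^ 2 =
      ‖G W‖ ^ 2 - 2 * (conj (f Z) * (G W * s W)).re + ‖f Z‖ ^ 2 * ‖s W‖ ^ 2 := by
    intro W
    rw [← Complex.normSq_eq_norm_sq, Complex.normSq_sub, Complex.normSq_eq_norm_sq,
      Complex.normSq_eq_norm_sq, norm_mul, RCLike.norm_conj, mul_pow]
    have : G W * conj (f Z * conj (s W)) = conj (f Z) * (G W * s W) := by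
      rw [map_mul, Complex.conj_conj]
      ring
    rw [this]
    ring
  have h0 : 0 ≤ ∫ W in B, ‖G W - f Z * conj (s W)‖ ^ 2 := integral_nonneg fun W => by positivity
  have j7 : IntegrableOn (fun W => (conj (f Z) * (G W * s W)).re) B := (j6.const_mul _).re
  have i5 : ∫ W in B, (conj (f Z) * (G W * s W)).re =
      ‖f Z‖ ^ 2 * ∫ W in B, ‖s W‖ ^ 2 := by
    have h1 : ∫ W in B, (conj (f Z) * (G W * s W)).re = (∫ W in B, conj (f Z) * (G W * s W)).re :=
      integral_re (j6.const_mul _)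
    rw [h1, integral_const_mul, i4, ← mul_assoc, ← Complex.normSq_eq_conj_mul_self,
      ← Complex.ofReal_mul, Complex.ofReal_re, Complex.normSq_eq_norm_sq]
  simp only [e] at h0
  have j8 : IntegrableOn (fun W => ‖G W‖ ^ 2 - 2 * (conj (f Z) * (G W * s W)).re) B :=
    j4.sub (j7.const_mul 2)
  rw [integral_add j8 (j5.const_mul _), integral_sub j4 (j7.const_mul 2),
    integral_const_mul, integral_const_mul, i5] at h0
  change ‖f Z‖ ^ 2 * (∫ W in B, ‖s W‖ ^ 2) ≤ ∫ W in B, ‖G W‖ ^ 2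
  linarith

/-- The second moment of a coordinate over the polydisc. -/
def moment (i j : Fin 2) : ℝ := ∫ W in Metric.closedBall (0 : Mat2) (1 / 32), ‖W i j‖ ^ 2

theorem moment_pos (i j : Fin 2) : 0 < moment i j := by
  have hc : Continuous fun W : Mat2 => ‖W i j‖ ^ 2 := by fun_prop
  rw [moment, setIntegral_pos_iff_support_of_nonneg_ae
    (Filter.Eventually.of_forall fun W => by positivity)
    (hc.continuousOn.integrableOn_compact (isCompact_closedBall _ _))]
  have ho : IsOpen ({W : Mat2 | W i j ≠ 0} ∩ Metric.ball 0 (1 / 32)) :=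
    (isOpen_ne_fun (by fun_prop) continuous_const).inter Metric.isOpen_ball
  have hne : ({W : Mat2 | W i j ≠ 0} ∩ Metric.ball 0 (1 / 32)).Nonempty := by
    refine ⟨fun _ _ => 1 / 64, by simp, ?_⟩
    rw [mem_ball_zero_iff, pi_norm_lt_iff (by norm_num)]
    intro i
    rw [pi_norm_lt_iff (by norm_num)]
    intro j
    norm_num
  refine (ho.measure_pos volume hne).trans_le (measure_mono ?_)
  rintro W ⟨h1, h2⟩
  refine ⟨?_, Metric.ball_subset_closedBall h2⟩
  exact pow_ne_zero 2 (norm_ne_zero_iff.2 h1)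

/-- Changing the sign of all coordinates except `W i j` preserves the integral, and the sum of the
form and its reflection is `2 c_{ij} W_{ij}`; then `‖a + b‖² ≤ 2 (‖a‖² + ‖b‖²)`. -/
theorem normSq_mul_moment_le (c : Fin 2 → Fin 2 → ℂ) (i j : Fin 2) :
    ‖c i j‖ ^ 2 * moment i j ≤
      ∫ W in Metric.closedBall (0 : Mat2) (1 / 32), ‖∑ p, ∑ q, c p q * W p q‖ ^ 2 := by
  set B := Metric.closedBall (0 : Mat2) (1 / 32) with hBdef
  have hBc : IsCompact B := isCompact_closedBall _ _
  let ε : Fin 2 → Fin 2 → ℂ := fun p q => if p = i ∧ q = j then 1 else -1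
  have hε : ∀ p q, ‖ε p q‖ = 1 := by
    intro p q
    simp only [ε]
    split_ifs <;> simp
  let F : Mat2 → ℂ := fun W => ∑ p, ∑ q, c p q * W p q
  have hF : Continuous F := by fun_prop
  let F' : Mat2 → ℂ := fun W => F (fun p q => ε p q * W p q)
  have hF' : Continuous F' := hF.comp (by fun_prop)
  have h1 : ∫ W in B, ‖F' W‖ ^ 2 = ∫ W in B, ‖F W‖ ^ 2 := by
    have := setIntegral_closedBall_smul hε (1 / 32) fun W => ((‖F W‖ ^ 2 : ℝ) : ℂ)
    rw [integral_complex_ofReal, integral_complex_ofReal] at this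
    exact_mod_cast this
  have h2 : ∀ W, F W + F' W = 2 * (c i j * W i j) := by
    intro W
    simp only [F, F', Fin.sum_univ_two, ε]
    fin_cases i <;> fin_cases j <;> simp <;> ring
  have h3 : ∀ W : Mat2, ‖c i j‖ ^ 2 * ‖W i j‖ ^ 2 ≤ (1 / 2) * (‖F W‖ ^ 2 + ‖F' W‖ ^ 2) := by
    intro W
    have h := norm_add_le (F W) (F' W)
    rw [h2, norm_mul, norm_mul, Complex.norm_ofNat] at h
    have h0 : 0 ≤ ‖c i j‖ * ‖W i j‖ := by positivity
    nlinarith [sq_nonneg (‖F W‖ - ‖F' W‖), norm_nonneg (F W), norm_nonneg (F' W)]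
  have j1 : IntegrableOn (fun W => ‖F W‖ ^ 2) B :=
    (hF.norm.pow 2).continuousOn.integrableOn_compact hBc
  have j2 : IntegrableOn (fun W => ‖F' W‖ ^ 2) B :=
    (hF'.norm.pow 2).continuousOn.integrableOn_compact hBc
  have j3 : IntegrableOn (fun W : Mat2 => ‖c i j‖ ^ 2 * ‖W i j‖ ^ 2) B :=
    Continuous.continuousOn (by fun_prop) |>.integrableOn_compact hBc
  have h4 := integral_mono (μ := volume.restrict B) j3 ((j1.add j2).const_mul (1 / 2)) h3
  rw [integral_const_mul, integral_const_mul] at h4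
  simp only [Pi.add_apply] at h4
  rw [integral_add j1 j2, h1] at h4
  calc ‖c i j‖ ^ 2 * moment i j ≤ _ := h4
    _ = _ := by ring

/-- The function `2 - tr Z† Z`, which vanishes on `U(2)` and is positive elsewhere. -/
def deficit (Z : Mat2) : ℝ := (defect Z).trace.re

theorem trace_eq_sum_normSq {P A : M2} (hA : A.IsHermitian) (h : A * A = P) :
    P.trace.re = ∑ i, ∑ j, ‖A i j‖ ^ 2 := by
  have h1 : ∀ i j, A j i = conj (A i j) := fun i j => (hA.apply j i).symm
  rw [← h]
  simp only [Matrix.trace, Matrix.diag, Matrix.mul_apply, Complex.re_sum]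
  refine Finset.sum_congr rfl fun i _ => Finset.sum_congr rfl fun j _ => ?_
  rw [h1 i j, Complex.mul_conj, Complex.ofReal_re, Complex.normSq_eq_norm_sq]

/-- The coefficient of `W i j` in entry `(k, l)` of `A W B` is `A k i * B j l`. The squares of all
these coefficients sum to `tr A² · tr B²`, and both traces equal the deficit. -/
theorem exists_deficit_sq_le : ∃ c : ℝ, 0 < c ∧ ∀ Z ∈ ball, c * deficit Z ^ 2 ≤
    ∑ k, ∑ l, ∫ W in Metric.closedBall (0 : Mat2) (1 / 32), ‖linearPart Z W k l‖ ^ 2 := by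
  obtain ⟨m, hm, hm'⟩ : ∃ m : ℝ, 0 < m ∧ ∀ i j, m ≤ moment i j := by
    refine ⟨min (min (moment 0 0) (moment 0 1)) (min (moment 1 0) (moment 1 1)),
      lt_min (lt_min (moment_pos _ _) (moment_pos _ _))
        (lt_min (moment_pos _ _) (moment_pos _ _)), fun i j => ?_⟩
    fin_cases i <;> fin_cases j <;> simp
  -- Each of the four pairs `(i, j)` bounds the same integral from below; averaging the four bounds
  -- costs the factor `4`.
  refine ⟨m / 4, by positivity, fun Z hZ => ?_⟩
  have hZ' : StrictContraction (Matrix.of Z) := hZ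
  set A := rdef (Matrix.of Z)ᴴ
  set B := rdef (Matrix.of Z)
  have hB : deficit Z = ∑ i, ∑ j, ‖B i j‖ ^ 2 :=
    trace_eq_sum_normSq (rdef_isHermitian _) hZ'.rdef_mul_rdef
  have hA : deficit Z = ∑ i, ∑ j, ‖A i j‖ ^ 2 := by
    rw [← trace_eq_sum_normSq (rdef_isHermitian _) hZ'.rdef_conjTranspose_mul]
    change (1 - (Matrix.of Z)ᴴ * Matrix.of Z).trace.re = _
    rw [Matrix.trace_sub, Matrix.trace_sub, Matrix.trace_mul_comm]
  have h1 : ∀ k l i j, ‖A k i * B j l‖ ^ 2 * m ≤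
      ∫ W in Metric.closedBall (0 : Mat2) (1 / 32), ‖linearPart Z W k l‖ ^ 2 := by
    intro k l i j
    refine (mul_le_mul_of_nonneg_left (hm' i j) (by positivity)).trans ?_
    refine (normSq_mul_moment_le (fun i j => A k i * B j l) i j).trans_eq ?_
    congr 1 with W
    congr 2
    change _ = (A * Matrix.of W * B) k l
    simp only [Matrix.mul_apply, Matrix.of_apply, Fin.sum_univ_two]
    ring
  have h2 : ∀ k l, m / 4 * (∑ i, ∑ j, ‖A k i‖ ^ 2 * ‖B j l‖ ^ 2) ≤
      ∫ W in Metric.closedBall (0 : Mat2) (1 / 32), ‖linearPart Z W k l‖ ^ 2 := by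
    intro k l
    have h3 := h1 k l
    simp only [norm_mul, mul_pow] at h3
    simp only [Fin.sum_univ_two]
    linarith [h3 0 0, h3 0 1, h3 1 0, h3 1 1]
  refine le_trans (le_of_eq ?_) (Finset.sum_le_sum fun k _ => Finset.sum_le_sum fun l _ => h2 k l)
  rw [pow_two]
  nth_rewrite 1 [hA]
  rw [hB]
  simp only [Fin.sum_univ_two]
  ring

/-! ## Commutators control the distance from the unitary group -/

theorem continuous_deficit : Continuous deficit := by
  have := continuous_defect_apply
  unfold deficit
  simp only [Matrix.trace, Matrix.diag]
  fun_prop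

/-- The square of the distance of `conj z_{kl} f` from `h_{kl}`, summed over the coordinates. -/
def hankelDensity (f : Mat2 → ℂ) (h : Fin 2 → Fin 2 → Mat2 → ℂ) (Z : Mat2) : ℝ :=
  ∑ k, ∑ l, ‖conj (Z k l) * f Z - h k l Z‖ ^ 2

theorem continuousOn_hankelDensity {f : Mat2 → ℂ} {h : Fin 2 → Fin 2 → Mat2 → ℂ}
    (hf : DifferentiableOn ℂ f ball) (hh : ∀ k l, DifferentiableOn ℂ (h k l) ball) :
    ContinuousOn (hankelDensity f h) ball := by
  refine continuousOn_finsetSum _ fun k _ => continuousOn_finsetSum _ fun l _ => ?_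
  refine (ContinuousOn.sub (ContinuousOn.mul ?_ hf.continuousOn) (hh k l).continuousOn).norm.pow 2
  exact (Complex.continuous_conj.comp (continuous_apply_apply k l)).continuousOn

theorem exists_deficit_sq_mul_le : ∃ c : ℝ, 0 < c ∧ ∀ (f : Mat2 → ℂ)
    (h : Fin 2 → Fin 2 → Mat2 → ℂ), DifferentiableOn ℂ f ball →
    (∀ k l, DifferentiableOn ℂ (h k l) ball) → ∀ Z ∈ ball,
    c * (deficit Z ^ 2 * ‖f Z‖ ^ 2) ≤
      ∫ W in Metric.closedBall (0 : Mat2) (1 / 32), hankelDensity f h (Z + linearPart Z W) := by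
  obtain ⟨c, hc, hc'⟩ := exists_deficit_sq_le
  refine ⟨c, hc, fun f h hf hh Z hZ => ?_⟩
  have hmap : Set.MapsTo (fun W => Z + linearPart Z W) (Metric.closedBall 0 (1 / 32)) ball :=
    fun W hW => add_linearPart_mem_ball hZ (mem_closedBall_zero_iff.1 hW)
  have hLc := continuous_linearPart Z
  have hint : ∀ k l, IntegrableOn (fun W => ‖conj ((Z + linearPart Z W) k l) *
      f (Z + linearPart Z W) - h k l (Z + linearPart Z W)‖ ^ 2)
      (Metric.closedBall (0 : Mat2) (1 / 32)) := by
    intro k l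
    refine ContinuousOn.integrableOn_compact (isCompact_closedBall _ _) ?_
    have h1 : ContinuousOn (fun Z' : Mat2 => ‖conj (Z' k l) * f Z' - h k l Z'‖ ^ 2) ball := by
      refine (ContinuousOn.sub (ContinuousOn.mul ?_ hf.continuousOn)
        (hh k l).continuousOn).norm.pow 2
      exact (Complex.continuous_conj.comp (continuous_apply_apply k l)).continuousOn
    exact h1.comp (by fun_prop) hmap
  simp only [hankelDensity]
  rw [integral_finsetSum _ fun k _ => integrable_finsetSum _ fun l _ => hint k l]
  simp_rw [fun k => integral_finsetSum (μ := volume.restrict (Metric.closedBall (0 : Mat2) (1 / 32)))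
    Finset.univ fun l _ => hint k l]
  calc c * (deficit Z ^ 2 * ‖f Z‖ ^ 2) = ‖f Z‖ ^ 2 * (c * deficit Z ^ 2) := by ring
    _ ≤ ‖f Z‖ ^ 2 * _ := mul_le_mul_of_nonneg_left (hc' Z hZ) (by positivity)
    _ ≤ _ := by
      rw [Finset.mul_sum]
      refine Finset.sum_le_sum fun k _ => ?_
      rw [Finset.mul_sum]
      exact Finset.sum_le_sum fun l _ => normSq_mul_integral_le hf (hh k l) hZ k l

/-- The pointwise estimate in the chart at `Z`, integrated over `Z`; the chart averages on the right
are absorbed by `lintegral_displaced_le`. -/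
theorem exists_lintegral_deficit_le (k : ℕ) : ∃ C : ℝ≥0∞, C ≠ ∞ ∧ ∀ (f : Mat2 → ℂ)
    (h : Fin 2 → Fin 2 → Mat2 → ℂ), DifferentiableOn ℂ f ball →
    (∀ k l, DifferentiableOn ℂ (h k l) ball) →
    ∫⁻ Z in ball, weight k Z * ENNReal.ofReal (deficit Z ^ 2 * ‖f Z‖ ^ 2) ≤
      C * ∫⁻ Z in ball, weight k Z * ENNReal.ofReal (hankelDensity f h Z) := by
  obtain ⟨c, hc, hc'⟩ := exists_deficit_sq_mul_le
  refine ⟨ENNReal.ofReal c⁻¹ * averagingConst k,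
    ENNReal.mul_ne_top ENNReal.ofReal_ne_top (averagingConst_ne_top k), fun f h hf hh => ?_⟩
  have hmD : MeasurableSet ball := isOpen_ball.measurableSet
  have hcont := continuousOn_hankelDensity hf hh
  classical
  -- Holomorphy gives continuity on the ball only; extension by zero supplies the globally
  -- measurable function that the averaging estimate takes.
  let G : Mat2 → ℝ≥0∞ := ball.indicator fun Z => ENNReal.ofReal (hankelDensity f h Z)
  have hG : Measurable G := by
    have h1 := (ENNReal.continuous_ofReal.comp_continuousOn hcont).measurable_piecewise
      (continuousOn_const (c := (0 : ℝ≥0∞))) hmD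
    rwa [← Pi.zero_def, Set.piecewise_eq_indicator] at h1
  have h1 : ∀ Z ∈ ball, ENNReal.ofReal (deficit Z ^ 2 * ‖f Z‖ ^ 2) ≤ ENNReal.ofReal c⁻¹ *
      ∫⁻ W in Metric.closedBall 0 (1 / 32), G (Z + linearPart Z W) := by
    intro Z hZ
    have hmap : Set.MapsTo (fun W => Z + linearPart Z W) (Metric.closedBall 0 (1 / 32)) ball :=
      fun W hW => add_linearPart_mem_ball hZ (mem_closedBall_zero_iff.1 hW)
    have hLc := continuous_linearPart Z
    have h2 : ∫⁻ W in Metric.closedBall 0 (1 / 32), G (Z + linearPart Z W) =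
        ENNReal.ofReal (∫ W in Metric.closedBall (0 : Mat2) (1 / 32),
          hankelDensity f h (Z + linearPart Z W)) := by
      rw [ofReal_integral_eq_lintegral_ofReal]
      · refine setLIntegral_congr_fun Metric.isClosed_closedBall.measurableSet fun W hW => ?_
        exact Set.indicator_of_mem (hmap hW) _
      · exact (hcont.comp (by fun_prop) hmap).integrableOn_compact (isCompact_closedBall _ _)
      · exact Filter.Eventually.of_forall fun W =>
          Finset.sum_nonneg fun _ _ => Finset.sum_nonneg fun _ _ => by positivity
    rw [h2, ← ENNReal.ofReal_mul (by positivity)]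
    refine ENNReal.ofReal_le_ofReal ?_
    rw [inv_mul_eq_div, le_div_iff₀' hc]
    exact hc' f h hf hh Z hZ
  calc ∫⁻ Z in ball, weight k Z * ENNReal.ofReal (deficit Z ^ 2 * ‖f Z‖ ^ 2)
      ≤ ∫⁻ Z in ball, ENNReal.ofReal c⁻¹ *
          (weight k Z * ∫⁻ W in Metric.closedBall 0 (1 / 32), G (Z + linearPart Z W)) := by
        refine setLIntegral_mono' hmD fun Z hZ => ?_
        rw [mul_left_comm]
        exact mul_le_mul' le_rfl (h1 Z hZ)
    _ = ENNReal.ofReal c⁻¹ * ∫⁻ Z in ball,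
          (weight k Z * ∫⁻ W in Metric.closedBall 0 (1 / 32), G (Z + linearPart Z W)) :=
        lintegral_const_mul' _ _ ENNReal.ofReal_ne_top
    _ ≤ ENNReal.ofReal c⁻¹ * (averagingConst k * ∫⁻ Z in ball, weight k Z * G Z) :=
        mul_le_mul' le_rfl (lintegral_displaced_le k hG)
    _ = _ := by
        rw [mul_assoc]
        congr 2
        refine setLIntegral_congr_fun hmD fun Z hZ => ?_
        simp only [G, Set.indicator_of_mem hZ]

/-! ### From weighted integrals to estimates on the state space. -/

theorem lintegral_weightedMeasure (n : ℕ) (F : Mat2 → ℝ≥0∞) :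
    ∫⁻ Z, F Z ∂(weightedMeasure n) =
      ENNReal.ofReal (normConst n) * ∫⁻ Z in ball, weight (n - 4) Z * F Z := by
  have hm : Measurable fun Z => ENNReal.ofReal (normConst n * (defect Z).det.re ^ (n - 4)) :=
    (continuous_const.mul (continuous_defect_det.pow _)).measurable.ennreal_ofReal
  rw [weightedMeasure, lintegral_withDensity_eq_lintegral_mul_non_measurable _ hm
    (Filter.Eventually.of_forall fun _ => ENNReal.ofReal_lt_top),
    ← lintegral_const_mul' _ _ ENNReal.ofReal_ne_top]
  refine setLIntegral_congr_fun isOpen_ball.measurableSet fun Z hZ => ?_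
  have hZ' : StrictContraction (Matrix.of Z) := hZ
  have h : 0 ≤ (defect Z).det.re ^ (n - 4) := pow_nonneg hZ'.det_pos.le _
  change ENNReal.ofReal _ * F Z = _
  rw [ENNReal.ofReal_mul' h, mul_assoc, weight]

theorem normConst_pos {n : ℕ} (hn : 3 < n) : 0 < normConst n := by
  have h : (3 : ℝ) < n := by exact_mod_cast hn
  have h1 : (0 : ℝ) < n - 1 := by linarith
  have h2 : (0 : ℝ) < n - 2 := by linarith
  have h3 : (0 : ℝ) < n - 3 := by linarith
  rw [normConst]
  positivity

theorem ofReal_norm_sq_eq_lintegral {n : ℕ} (x : Lp ℂ 2 (weightedMeasure n)) :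
    ENNReal.ofReal (‖x‖ ^ 2) = ∫⁻ Z, ENNReal.ofReal (‖x Z‖ ^ 2) ∂(weightedMeasure n) := by
  rw [ENNReal.ofReal_pow (norm_nonneg _), ofReal_norm, Lp.enorm_def,
    eLpNorm_eq_lintegral_rpow_enorm_toReal (by norm_num) (by norm_num)]
  simp only [ENNReal.toReal_ofNat]
  rw [← ENNReal.rpow_natCast, ← ENNReal.rpow_mul]
  norm_num

theorem exists_lintegral_deficit_weightedMeasure_le (n : ℕ) : ∃ C : ℝ≥0∞, C ≠ ∞ ∧
    ∀ (f : Mat2 → ℂ) (h : Fin 2 → Fin 2 → Mat2 → ℂ), DifferentiableOn ℂ f ball →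
    (∀ k l, DifferentiableOn ℂ (h k l) ball) →
    ∫⁻ Z, ENNReal.ofReal (deficit Z ^ 2 * ‖f Z‖ ^ 2) ∂(weightedMeasure n) ≤
      C * ∫⁻ Z, ENNReal.ofReal (hankelDensity f h Z) ∂(weightedMeasure n) := by
  obtain ⟨C, hC, h⟩ := exists_lintegral_deficit_le (n - 4)
  refine ⟨C, hC, fun f g hf hg => ?_⟩
  rw [lintegral_weightedMeasure, lintegral_weightedMeasure, mul_left_comm]
  exact mul_le_mul' le_rfl (h f g hf hg)

/-- The function `2 - tr Z† Z` on the closure of the ball. -/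
def deficitSymbol : C(closure ball, ℂ) where
  toFun Z := (deficit (Z : Mat2) : ℂ)
  continuous_toFun :=
    Complex.continuous_ofReal.comp (continuous_deficit.comp continuous_subtype_val)

/-- States are conjugates of holomorphic functions, so `|z_{kl} ψ - φ_{kl}|` is the modulus of `conj
z_{kl} f - g_{kl}` with `f` and `g_{kl}` holomorphic, and the integral estimate becomes one of `L²`
norms. -/
theorem exists_norm_mulOp_deficitSymbol_le_of_mem (n : ℕ) : ∃ C : ℝ, 0 ≤ C ∧
    ∀ ψ ∈ conjBergman n, ∀ φ : Fin 2 → Fin 2 → Lp ℂ 2 (weightedMeasure n),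
    (∀ k l, φ k l ∈ conjBergman n) → ‖mulOp n deficitSymbol ψ‖ ^ 2 ≤
      C * ∑ k, ∑ l, ‖mulOp n (coord k l) ψ - φ k l‖ ^ 2 := by
  obtain ⟨C, hC, h⟩ := exists_lintegral_deficit_weightedMeasure_le n
  refine ⟨C.toReal, ENNReal.toReal_nonneg, ?_⟩
  rintro ψ ⟨f, hf, hψ⟩ φ hφ
  choose g hg hφ using hφ
  have h0 : ∀ k l, 0 ≤ ‖mulOp n (coord k l) ψ - φ k l‖ ^ 2 := fun k l => by positivity
  rw [← ENNReal.ofReal_le_ofReal_iff (mul_nonneg ENNReal.toReal_nonneg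
    (Finset.sum_nonneg fun k _ => Finset.sum_nonneg fun l _ => h0 k l)),
    ENNReal.ofReal_mul ENNReal.toReal_nonneg, ENNReal.ofReal_toReal hC,
    ENNReal.ofReal_sum_of_nonneg fun k _ => Finset.sum_nonneg fun l _ => h0 k l]
  simp_rw [fun k => ENNReal.ofReal_sum_of_nonneg (s := Finset.univ) fun l _ => h0 k l,
    ofReal_norm_sq_eq_lintegral]
  have hmeas : ∀ k l, AEMeasurable (fun Z => ENNReal.ofReal
      (‖(mulOp n (coord k l) ψ - φ k l : Lp ℂ 2 (weightedMeasure n)) Z‖ ^ 2))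
      (weightedMeasure n) := fun k l =>
    ((Lp.aestronglyMeasurable _).norm.aemeasurable.pow_const 2).ennreal_ofReal
  simp_rw [fun k => (lintegral_finsetSum' (μ := weightedMeasure n) Finset.univ
    fun l _ => hmeas k l).symm]
  rw [← lintegral_finsetSum' _ fun k _ => Finset.aemeasurable_fun_sum _ fun l _ => hmeas k l]
  refine le_trans (le_of_eq ?_) ((h f g hf hg).trans_eq (congrArg _ ?_))
  · refine lintegral_congr_ae ?_
    filter_upwards [mulOp_ae n deficitSymbol ψ, hψ, ae_mem_closure_ball n] with Z h1 h2 h3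
    rw [h1, h2, extendZero_apply _ ⟨Z, h3⟩, norm_mul, RCLike.norm_conj, mul_pow]
    change ENNReal.ofReal (‖(deficit Z : ℂ)‖ ^ 2 * _) = _
    rw [Complex.norm_real, Real.norm_eq_abs, sq_abs]
  · have hae : ∀ k l, ∀ᵐ Z ∂(weightedMeasure n),
        ‖conj (Z k l) * f Z - g k l Z‖ ^ 2 =
          ‖(mulOp n (coord k l) ψ - φ k l : Lp ℂ 2 (weightedMeasure n)) Z‖ ^ 2 := by
      intro k l
      filter_upwards [mulOp_ae n (coord k l) ψ, hψ, hφ k l, ae_mem_closure_ball n,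
        Lp.coeFn_sub (mulOp n (coord k l) ψ) (φ k l)] with Z h1 h2 h3 h4 h5
      rw [h5, Pi.sub_apply, h1, h2, h3, extendZero_apply _ ⟨Z, h4⟩, ← RCLike.norm_conj]
      simp [coord]
    refine lintegral_congr_ae ?_
    filter_upwards [ae_all_iff.2 fun k => ae_all_iff.2 fun l => hae k l] with Z hZ
    rw [hankelDensity, ENNReal.ofReal_sum_of_nonneg fun k _ =>
      Finset.sum_nonneg fun l _ => by positivity]
    refine Finset.sum_congr rfl fun k _ => ?_
    rw [ENNReal.ofReal_sum_of_nonneg fun l _ => by positivity]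
    exact Finset.sum_congr rfl fun l _ => by rw [hZ k l]

/-- Both sides are continuous in all vectors, so the estimate passes to the closure by which
`stateSpace` is defined; closedness of the Bergman space is not needed. -/
theorem norm_sq_le_sum_of_mem_closure {E : Type*} [NormedAddCommGroup E] [NormedSpace ℂ E]
    (A : E →L[ℂ] E) (T : Fin 2 → Fin 2 → E →L[ℂ] E) (S : Set E) (C : ℝ)
    (h : ∀ ψ ∈ S, ∀ φ : Fin 2 → Fin 2 → E, (∀ k l, φ k l ∈ S) →
      ‖A ψ‖ ^ 2 ≤ C * ∑ k, ∑ l, ‖T k l ψ - φ k l‖ ^ 2) {ψ : E} (hψ : ψ ∈ closure S)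
    {φ : Fin 2 → Fin 2 → E} (hφ : ∀ k l, φ k l ∈ closure S) :
    ‖A ψ‖ ^ 2 ≤ C * ∑ k, ∑ l, ‖T k l ψ - φ k l‖ ^ 2 := by
  have hp : (ψ, φ) ∈ closure (S ×ˢ Set.univ.pi fun _ : Fin 2 => Set.univ.pi fun _ : Fin 2 => S) := by
    rw [closure_prod_eq, closure_pi_set]
    simp_rw [closure_pi_set]
    exact ⟨hψ, fun k _ l _ => hφ k l⟩
  refine closure_minimal (t := {p : E × (Fin 2 → Fin 2 → E) | ‖A p.1‖ ^ 2 ≤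
      C * ∑ k, ∑ l, ‖T k l p.1 - p.2 k l‖ ^ 2}) ?_ ?_ hp
  · rintro ⟨ψ, φ⟩ ⟨hψ, hφ⟩
    exact h ψ hψ φ fun k l => hφ k trivial l trivial
  · exact isClosed_le (by fun_prop) (by fun_prop)

theorem exists_norm_mulOp_deficitSymbol_le (n : ℕ) : ∃ C : ℝ, 0 ≤ C ∧
    ∀ (ψ : State n) (φ : Fin 2 → Fin 2 → State n), ‖mulOp n deficitSymbol (incl n ψ)‖ ^ 2 ≤
      C * ∑ k, ∑ l, ‖mulOp n (coord k l) (incl n ψ) - incl n (φ k l)‖ ^ 2 := by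
  obtain ⟨C, hC, h⟩ := exists_norm_mulOp_deficitSymbol_le_of_mem n
  exact ⟨C, hC, fun ψ φ => norm_sq_le_sum_of_mem_closure (mulOp n deficitSymbol)
    (fun k l => mulOp n (coord k l)) (conjBergman n) C h ψ.2 fun k l => (φ k l).2⟩

theorem norm_sq_sub_incl_proj (n : ℕ) (x : Lp ℂ 2 (weightedMeasure n)) :
    ‖x - incl n (proj n x)‖ ^ 2 = ‖x‖ ^ 2 - ‖proj n x‖ ^ 2 := by
  have h1 : inner ℂ (incl n (proj n x)) x = ((‖proj n x‖ ^ 2 : ℝ) : ℂ) := by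
    rw [← inner_proj, inner_self_eq_norm_sq_to_K]
    norm_cast
  have h2 : inner ℂ x (incl n (proj n x)) = ((‖proj n x‖ ^ 2 : ℝ) : ℂ) := by
    rw [← inner_conj_symm, h1, Complex.conj_ofReal]
  rw [norm_sub_sq (𝕜 := ℂ), h2, LinearIsometry.norm_map]
  simp only [RCLike.re_to_complex, Complex.ofReal_re]
  ring

/-- The sum of the self-commutators of the coordinate annihilation operators. -/
def selfCommutator (n : ℕ) : State n →L[ℂ] State n :=
  ∑ k, ∑ l, (annihilation n k l * star (annihilation n k l) -
    star (annihilation n k l) * annihilation n k l)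

theorem norm_mulOp_conjCoord (n : ℕ) (k l : Fin 2) (ψ : Lp ℂ 2 (weightedMeasure n)) :
    ‖mulOp n (conjCoord k l) ψ‖ = ‖mulOp n (coord k l) ψ‖ := by
  have h := ofReal_norm_sq_eq_lintegral (mulOp n (conjCoord k l) ψ)
  have h2 : ∫⁻ Z, ENNReal.ofReal (‖mulOp n (conjCoord k l) ψ Z‖ ^ 2) ∂(weightedMeasure n) =
      ∫⁻ Z, ENNReal.ofReal (‖mulOp n (coord k l) ψ Z‖ ^ 2) ∂(weightedMeasure n) := by
    refine lintegral_congr_ae ?_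
    filter_upwards [mulOp_ae n (coord k l) ψ, mulOp_ae n (conjCoord k l) ψ,
      ae_mem_closure_ball n] with Z h1 h2 h3
    rw [h1, h2, extendZero_apply _ ⟨Z, h3⟩, extendZero_apply _ ⟨Z, h3⟩]
    simp [coord, conjCoord]
  rw [h2, ← ofReal_norm_sq_eq_lintegral,
    ENNReal.ofReal_eq_ofReal_iff (by positivity) (by positivity)] at h
  exact (pow_left_inj₀ (norm_nonneg _) (norm_nonneg _) two_ne_zero).1 h

/-- The form of one self-commutator is `‖a*ψ‖² - ‖aψ‖²`. The adjoint multiplies by `conj z` without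
projecting, so `‖a*ψ‖ = ‖zψ‖`, and Pythagoras leaves the squared distance of `zψ` from its
projection `aψ`. -/
theorem inner_selfCommutator (n : ℕ) (ψ : State n) :
    inner ℂ ψ (selfCommutator n ψ) = ((∑ k, ∑ l, ‖mulOp n (coord k l) (incl n ψ) -
      incl n (annihilation n k l ψ)‖ ^ 2 : ℝ) : ℂ) := by
  simp only [selfCommutator, _root_.sum_apply, inner_sum, Complex.ofReal_sum]
  refine Finset.sum_congr rfl fun k _ => Finset.sum_congr rfl fun l _ => ?_
  have h1 : annihilation n k l ψ = proj n (mulOp n (coord k l) (incl n ψ)) := rfl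
  rw [h1, norm_sq_sub_incl_proj, ← h1, ← norm_mulOp_conjCoord, ← incl_star_annihilation,
    LinearIsometry.norm_map, _root_.sub_apply, inner_sub_right,
    mul_apply_eq_comp, mul_apply_eq_comp]
  rw [ContinuousLinearMap.star_eq_adjoint, ContinuousLinearMap.adjoint_inner_right,
    ← ContinuousLinearMap.adjoint_inner_left, inner_self_eq_norm_sq_to_K,
    inner_self_eq_norm_sq_to_K]
  norm_cast

theorem norm_proj_le (n : ℕ) (x : Lp ℂ 2 (weightedMeasure n)) : ‖proj n x‖ ≤ ‖x‖ := by
  have h := norm_sq_sub_incl_proj n x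
  have h1 : 0 ≤ ‖x - incl n (proj n x)‖ ^ 2 := by positivity
  exact (pow_le_pow_iff_left₀ (norm_nonneg _) (norm_nonneg _) two_ne_zero).1 (by linarith)

theorem exists_norm_toeplitz_deficitSymbol_le (n : ℕ) : ∃ C : ℝ, 0 ≤ C ∧ ∀ ψ : State n,
    ‖toeplitz n deficitSymbol ψ‖ ^ 2 ≤ C * (inner ℂ ψ (selfCommutator n ψ)).re := by
  obtain ⟨C, hC, h⟩ := exists_norm_mulOp_deficitSymbol_le n
  refine ⟨C, hC, fun ψ => ?_⟩
  rw [inner_selfCommutator, Complex.ofReal_re]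
  refine le_trans ?_ (h ψ fun k l => annihilation n k l ψ)
  exact pow_le_pow_left₀ (norm_nonneg _) (norm_proj_le n _) 2

theorem inner_selfCommutator_nonneg (n : ℕ) (ψ : State n) :
    0 ≤ (inner ℂ ψ (selfCommutator n ψ)).re := by
  rw [inner_selfCommutator, Complex.ofReal_re]
  positivity

/-! ## Algebraic properties of Toeplitz operators -/

variable {n : ℕ}

theorem mulOp_eq_of_ae {f : C(closure ball, ℂ)} {ψ φ : Lp ℂ 2 (weightedMeasure n)}
    (h : ∀ᵐ Z ∂(weightedMeasure n), ∀ hZ : Z ∈ closure ball, φ Z = f ⟨Z, hZ⟩ * ψ Z) :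
    mulOp n f ψ = φ := by
  refine Lp.ext ?_
  filter_upwards [mulOp_ae n f ψ, ae_mem_closure_ball n, h] with Z h1 h2 h3
  rw [h1, extendZero_apply _ ⟨Z, h2⟩, h3 h2]

theorem mulOp_ae' (f : C(closure ball, ℂ)) (ψ : Lp ℂ 2 (weightedMeasure n)) :
    ∀ᵐ Z ∂(weightedMeasure n), ∀ hZ : Z ∈ closure ball, mulOp n f ψ Z = f ⟨Z, hZ⟩ * ψ Z := by
  filter_upwards [mulOp_ae n f ψ] with Z h1 hZ
  rw [h1, extendZero_apply _ ⟨Z, hZ⟩]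

theorem mulOp_add (f g : C(closure ball, ℂ)) : mulOp n (f + g) = mulOp n f + mulOp n g := by
  ext1 ψ
  refine mulOp_eq_of_ae ?_
  rw [_root_.add_apply]
  filter_upwards [mulOp_ae' f ψ, mulOp_ae' g ψ, Lp.coeFn_add (mulOp n f ψ) (mulOp n g ψ)]
    with Z h1 h2 h3 hZ
  rw [h3, Pi.add_apply, h1 hZ, h2 hZ, ContinuousMap.add_apply, add_mul]

theorem mulOp_smul (c : ℂ) (f : C(closure ball, ℂ)) : mulOp n (c • f) = c • mulOp n f := by
  ext1 ψ
  refine mulOp_eq_of_ae ?_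
  rw [_root_.smul_apply]
  filter_upwards [mulOp_ae' f ψ, Lp.coeFn_smul c (mulOp n f ψ)] with Z h1 h2 hZ
  rw [h2, Pi.smul_apply, h1 hZ, ContinuousMap.smul_apply, smul_eq_mul, smul_eq_mul, mul_assoc]

theorem mulOp_mul (f g : C(closure ball, ℂ)) (ψ : Lp ℂ 2 (weightedMeasure n)) :
    mulOp n (f * g) ψ = mulOp n f (mulOp n g ψ) := by
  refine mulOp_eq_of_ae ?_
  filter_upwards [mulOp_ae' f (mulOp n g ψ), mulOp_ae' g ψ] with Z h1 h2 hZ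
  rw [h1 hZ, h2 hZ, ContinuousMap.mul_apply, mul_assoc]

theorem mulOp_one (ψ : Lp ℂ 2 (weightedMeasure n)) : mulOp n 1 ψ = ψ :=
  mulOp_eq_of_ae (Filter.Eventually.of_forall fun Z hZ => by simp)

theorem norm_mulOp_le (f : C(closure ball, ℂ)) (ψ : Lp ℂ 2 (weightedMeasure n)) :
    ‖mulOp n f ψ‖ ≤ ‖f‖ * ‖ψ‖ := by
  refine Lp.norm_le_mul_norm_of_ae_le_mul ?_
  filter_upwards [mulOp_ae' f ψ, ae_mem_closure_ball n] with Z h1 hZ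
  rw [h1 hZ, norm_mul]
  exact mul_le_mul_of_nonneg_right (f.norm_coe_le_norm _) (norm_nonneg _)

theorem inner_mulOp (f : C(closure ball, ℂ)) (ψ φ : Lp ℂ 2 (weightedMeasure n)) :
    inner ℂ ψ (mulOp n f φ) = inner ℂ (mulOp n (star f) ψ) φ := by
  rw [L2.inner_def, L2.inner_def]
  apply integral_congr_ae
  filter_upwards [mulOp_ae' f φ, mulOp_ae' (star f) ψ, ae_mem_closure_ball n] with Z h1 h2 h3
  rw [h1 h3, h2 h3]
  simp
  ring

theorem proj_incl (ψ : State n) : proj n (incl n ψ) = ψ := by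
  refine ext_inner_left ℂ fun φ => ?_
  rw [inner_proj, LinearIsometry.inner_map_map]

theorem toeplitz_apply (f : C(closure ball, ℂ)) (ψ : State n) :
    toeplitz n f ψ = proj n (mulOp n f (incl n ψ)) := rfl

theorem toeplitz_add (f g : C(closure ball, ℂ)) :
    toeplitz n (f + g) = toeplitz n f + toeplitz n g := by
  ext1 ψ
  simp only [toeplitz_apply, mulOp_add, _root_.add_apply, map_add]

theorem toeplitz_smul (c : ℂ) (f : C(closure ball, ℂ)) :
    toeplitz n (c • f) = c • toeplitz n f := by
  ext1 ψ
  simp only [toeplitz_apply, mulOp_smul, _root_.smul_apply, map_smul]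

theorem toeplitz_one : toeplitz n 1 = 1 := by
  ext1 ψ
  rw [toeplitz_apply, mulOp_one, proj_incl]
  rfl

theorem norm_toeplitz_le (f : C(closure ball, ℂ)) : ‖toeplitz n f‖ ≤ ‖f‖ := by
  refine ContinuousLinearMap.opNorm_le_bound _ (norm_nonneg f) fun ψ => ?_
  exact (norm_proj_le n _).trans
    ((norm_mulOp_le f _).trans_eq (congrArg _ ((incl n).norm_map ψ)))

/-- The symbol calculus `f ↦ T_f` as a continuous linear map. -/
def toeplitzL (n : ℕ) : C(closure ball, ℂ) →L[ℂ] State n →L[ℂ] State n :=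
  LinearMap.mkContinuous
    { toFun := toeplitz n
      map_add' := toeplitz_add
      map_smul' := toeplitz_smul } 1 fun f => by
    rw [one_mul]
    exact norm_toeplitz_le f

theorem toeplitzL_apply (f : C(closure ball, ℂ)) : toeplitzL n f = toeplitz n f := rfl

theorem star_toeplitz (f : C(closure ball, ℂ)) : star (toeplitz n f) = toeplitz n (star f) := by
  ext1 ψ
  refine ext_inner_right ℂ fun φ => ?_
  rw [ContinuousLinearMap.star_eq_adjoint, ContinuousLinearMap.adjoint_inner_left, toeplitz_apply,
    inner_proj, inner_mulOp, ← inner_conj_symm, ← inner_proj, inner_conj_symm]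
  rfl

theorem star_coord (k l : Fin 2) : star (coord k l) = conjCoord k l := rfl

theorem toeplitz_coord (k l : Fin 2) : toeplitz n (coord k l) = annihilation n k l := rfl

theorem toeplitz_conjCoord (k l : Fin 2) :
    toeplitz n (conjCoord k l) = star (annihilation n k l) := by
  rw [← star_coord, ← star_toeplitz, toeplitz_coord]

/-- Multiplication by a conjugate coordinate maps states to states, so no projection intervenes
between the two factors. -/
theorem toeplitz_mul_conjCoord (f : C(closure ball, ℂ)) (k l : Fin 2) :
    toeplitz n (f * conjCoord k l) = toeplitz n f * star (annihilation n k l) := by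
  ext1 ψ
  rw [toeplitz_apply, mulOp_mul, ← incl_star_annihilation]
  rfl

theorem toeplitz_coord_mul (f : C(closure ball, ℂ)) (k l : Fin 2) :
    toeplitz n (coord k l * f) = annihilation n k l * toeplitz n f := by
  rw [← star_inj, star_mul, star_toeplitz, star_mul, star_coord, toeplitz_mul_conjCoord,
    star_toeplitz]

theorem eq_top_of_coord_mem (B : Subalgebra ℂ C(closure ball, ℂ))
    (hB : IsClosed (B : Set C(closure ball, ℂ))) (h : ∀ k l, coord k l ∈ B)
    (h' : ∀ k l, conjCoord k l ∈ B) (f : C(closure ball, ℂ)) : f ∈ B := by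
  let s : Set C(closure ball, ℂ) := Set.range fun p : Fin 2 × Fin 2 => coord p.1 p.2
  have h1 : (StarAlgebra.adjoin ℂ s).topologicalClosure = ⊤ := by
    refine ContinuousMap.starSubalgebra_topologicalClosure_eq_top_of_separatesPoints _ ?_
    intro Z W hZW
    have h2 : ∃ k l, (Z : Mat2) k l ≠ (W : Mat2) k l := by
      by_contra! h3
      exact hZW (Subtype.ext (funext fun k => funext fun l => h3 k l))
    obtain ⟨k, l, hkl⟩ := h2
    exact ⟨coord k l, ⟨coord k l, StarAlgebra.subset_adjoin ℂ s ⟨(k, l), rfl⟩, rfl⟩, hkl⟩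
  have h2 : (StarAlgebra.adjoin ℂ s : Set C(closure ball, ℂ)) ⊆ B := by
    have h3 : (StarAlgebra.adjoin ℂ s).toSubalgebra ≤ B := by
      rw [StarAlgebra.adjoin_toSubalgebra, Algebra.adjoin_le_iff]
      rintro x (⟨p, rfl⟩ | ⟨p, hp⟩)
      · exact h _ _
      · have : x = conjCoord p.1 p.2 := by
          rw [← star_coord, ← star_star x]
          exact congrArg star hp.symm
        rw [this]
        exact h' _ _
    exact h3
  have h3 : f ∈ (StarAlgebra.adjoin ℂ s).topologicalClosure := h1 ▸ trivial
  exact closure_minimal h2 hB h3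

theorem isClosed_phaseAlgebra (n : ℕ) :
    IsClosed (phaseAlgebra n : Set (State n →L[ℂ] State n)) :=
  StarSubalgebra.isClosed_topologicalClosure _

theorem annihilation_mem (n : ℕ) (k l : Fin 2) : annihilation n k l ∈ phaseAlgebra n :=
  StarSubalgebra.le_topologicalClosure _ (StarAlgebra.subset_adjoin ℂ _ ⟨(k, l), rfl⟩)

/-- The functions `f` for which `T_g` in the algebra always implies `T_{fg}` in the algebra form a
closed subalgebra. It contains the coordinates and their conjugates, hence everything by
Stone–Weierstrass; then take `g = 1`. -/
theorem toeplitz_mem (n : ℕ) (f : C(closure ball, ℂ)) : toeplitz n f ∈ phaseAlgebra n := by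
  let B : Subalgebra ℂ C(closure ball, ℂ) :=
    { carrier := {f | ∀ g, toeplitz n g ∈ phaseAlgebra n → toeplitz n (f * g) ∈ phaseAlgebra n}
      mul_mem' := fun {f₁ f₂} h₁ h₂ g hg => by
        rw [mul_assoc]
        exact h₁ _ (h₂ _ hg)
      add_mem' := fun {f₁ f₂} h₁ h₂ g hg => by
        rw [add_mul, toeplitz_add]
        exact add_mem (h₁ _ hg) (h₂ _ hg)
      algebraMap_mem' := fun c g hg => by
        rw [← Algebra.smul_def, toeplitz_smul]
        exact (phaseAlgebra n).smul_mem hg c }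
  have hB : IsClosed (B : Set C(closure ball, ℂ)) := by
    have h : (B : Set C(closure ball, ℂ)) = ⋂ g, ⋂ (_ : toeplitz n g ∈ phaseAlgebra n),
        (fun f => toeplitzL n (f * g)) ⁻¹' (phaseAlgebra n : Set (State n →L[ℂ] State n)) := by
      ext f
      simp only [Set.mem_iInter]
      rfl
    rw [h]
    exact isClosed_iInter fun g => isClosed_iInter fun _ =>
      (isClosed_phaseAlgebra n).preimage (by fun_prop)
  have h := eq_top_of_coord_mem B hB (fun k l g hg => by
    rw [toeplitz_coord_mul]
    exact mul_mem (annihilation_mem n k l) hg) (fun k l g hg => by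
    rw [mul_comm, toeplitz_mul_conjCoord]
    exact mul_mem hg (star_mem (annihilation_mem n k l))) f
  rw [← mul_one f]
  exact h 1 (by
    rw [toeplitz_one]
    exact one_mem _)

/-- The Toeplitz operator as an element of the algebra of the quantum phase space. -/
def phaseToeplitz (n : ℕ) (f : C(closure ball, ℂ)) : phaseAlgebra n :=
  ⟨toeplitz n f, toeplitz_mem n f⟩

theorem continuous_phaseToeplitz (n : ℕ) : Continuous (phaseToeplitz n) :=
  (toeplitzL n).continuous.subtype_mk _

theorem phaseToeplitz_add (f g : C(closure ball, ℂ)) :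
    phaseToeplitz n (f + g) = phaseToeplitz n f + phaseToeplitz n g :=
  Subtype.ext (toeplitz_add f g)

theorem phaseToeplitz_sub (f g : C(closure ball, ℂ)) :
    phaseToeplitz n (f - g) = phaseToeplitz n f - phaseToeplitz n g :=
  Subtype.ext ((toeplitzL n).map_sub f g)

theorem phaseToeplitz_smul (c : ℂ) (f : C(closure ball, ℂ)) :
    phaseToeplitz n (c • f) = c • phaseToeplitz n f :=
  Subtype.ext (toeplitz_smul c f)

theorem phaseToeplitz_one : phaseToeplitz n 1 = 1 := Subtype.ext toeplitz_one

/-- Modulo a closed ideal that contains all commutators, `f ↦ T_f` is multiplicative. -/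
theorem phaseToeplitz_mul_sub_mem {I : TwoSidedIdeal (phaseAlgebra n)}
    (hI : IsClosed (I : Set (phaseAlgebra n))) (hc : ∀ a b : phaseAlgebra n, a * b - b * a ∈ I)
    (f g : C(closure ball, ℂ)) :
    phaseToeplitz n f * phaseToeplitz n g - phaseToeplitz n (f * g) ∈ I := by
  let B : Subalgebra ℂ C(closure ball, ℂ) :=
    { carrier := {f | ∀ g, phaseToeplitz n f * phaseToeplitz n g - phaseToeplitz n (f * g) ∈ I}
      mul_mem' := fun {f₁ f₂} h₁ h₂ g => by
        have e : phaseToeplitz n (f₁ * f₂) * phaseToeplitz n g - phaseToeplitz n (f₁ * f₂ * g) =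
            phaseToeplitz n f₁ * (phaseToeplitz n f₂ * phaseToeplitz n g - phaseToeplitz n (f₂ * g))
            - (phaseToeplitz n f₁ * phaseToeplitz n f₂ - phaseToeplitz n (f₁ * f₂)) *
              phaseToeplitz n g
            + (phaseToeplitz n f₁ * phaseToeplitz n (f₂ * g) - phaseToeplitz n (f₁ * (f₂ * g))) := by
          rw [mul_assoc f₁]
          noncomm_ring
        change _ ∈ I
        rw [e]
        exact I.add_mem (I.sub_mem (I.mul_mem_left _ _ (h₂ g)) (I.mul_mem_right _ _ (h₁ f₂)))
          (h₁ _)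
      add_mem' := fun {f₁ f₂} h₁ h₂ g => by
        rw [add_mul, phaseToeplitz_add, phaseToeplitz_add, add_mul, add_sub_add_comm]
        exact I.add_mem (h₁ g) (h₂ g)
      algebraMap_mem' := fun c g => by
        rw [← Algebra.smul_def, phaseToeplitz_smul, Algebra.algebraMap_eq_smul_one,
          phaseToeplitz_smul, phaseToeplitz_one, smul_mul_assoc, one_mul, sub_self]
        exact I.zero_mem }
  have hB : IsClosed (B : Set C(closure ball, ℂ)) := by
    have h : (B : Set C(closure ball, ℂ)) = ⋂ g,
        (fun f => phaseToeplitz n f * phaseToeplitz n g - phaseToeplitz n (f * g)) ⁻¹'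
          (I : Set (phaseAlgebra n)) := by
      ext f
      simp only [Set.mem_iInter]
      rfl
    have hcont := continuous_phaseToeplitz n
    rw [h]
    exact isClosed_iInter fun g => hI.preimage (by fun_prop)
  refine eq_top_of_coord_mem B hB (fun k l g => ?_) (fun k l g => ?_) f g
  · have e : phaseToeplitz n (coord k l * g) = phaseToeplitz n (coord k l) * phaseToeplitz n g :=
      Subtype.ext (toeplitz_coord_mul g k l)
    rw [e, sub_self]
    exact I.zero_mem
  -- A conjugate coordinate factors out on the right, so the multiplicative defect is itself a
  -- commutator.
  · have e : phaseToeplitz n (conjCoord k l * g) =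
        phaseToeplitz n g * phaseToeplitz n (conjCoord k l) := by
      rw [mul_comm]
      refine Subtype.ext ((toeplitz_mul_conjCoord g k l).trans ?_)
      rw [← toeplitz_conjCoord]
      rfl
    rw [e]
    exact hc _ _

/-! ## Toeplitz operators whose symbol vanishes on the unitary group -/

variable {n : ℕ}

theorem deficit_nonneg {Z : Mat2} (hZ : Z ∈ closure ball) : 0 ≤ deficit Z := by
  refine closure_minimal (t := {Z | 0 ≤ deficit Z}) (fun W hW => ?_)
    (isClosed_le continuous_const continuous_deficit) hZ
  exact (StrictContraction.trace_pos (mem_ball_iff.1 hW)).le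

theorem defect_det_nonneg {Z : Mat2} (hZ : Z ∈ closure ball) : 0 ≤ (defect Z).det.re := by
  refine closure_minimal (t := {Z | 0 ≤ (defect Z).det.re}) (fun W hW => ?_)
    (isClosed_le continuous_const continuous_defect_det) hZ
  exact (StrictContraction.det_pos (mem_ball_iff.1 hW)).le

theorem mem_U2_iff {Z : Mat2} : Z ∈ U2 ↔ defect Z = 0 := by
  rw [defect, sub_eq_zero, eq_comm]
  rfl

/-- A Hermitian `2 × 2` matrix of trace zero has determinant `-(p² + |q|²)`, with `p` a diagonal and
`q` an off-diagonal entry; since the determinant is nonnegative on the closed ball, the defect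
vanishes. -/
theorem mem_U2_of_deficit_eq_zero {Z : Mat2} (hZ : Z ∈ closure ball) (h : deficit Z = 0) :
    Z ∈ U2 := by
  rw [mem_U2_iff]
  have hP : (defect Z).IsHermitian := isHermitian_one_sub (Matrix.of Z)
  have hd := defect_det_nonneg hZ
  set P := defect Z
  have h00 : (P 0 0).im = 0 := Complex.conj_eq_iff_im.1 (hP.apply 0 0)
  have h11 : (P 1 1).im = 0 := Complex.conj_eq_iff_im.1 (hP.apply 1 1)
  have h10 : P 1 0 = conj (P 0 1) := (hP.apply 1 0).symm
  have ht : (P 0 0).re + (P 1 1).re = 0 := by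
    have : P.trace.re = 0 := h
    simpa [Matrix.trace] using this
  rw [Matrix.det_fin_two, h10, Complex.mul_conj, Complex.sub_re, Complex.mul_re, h00, h11,
    Complex.ofReal_re] at hd
  have h1 : (P 1 1).re = -(P 0 0).re := by linarith
  rw [h1] at hd
  have h01 : Complex.normSq (P 0 1) = 0 :=
    le_antisymm (by nlinarith [sq_nonneg (P 0 0).re]) (Complex.normSq_nonneg _)
  have h2 : (P 0 0).re = 0 := by
    rw [h01] at hd
    nlinarith [sq_nonneg (P 0 0).re]
  have e01 : P 0 1 = 0 := Complex.normSq_eq_zero.1 h01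
  ext i j
  fin_cases i <;> fin_cases j
  · exact Complex.ext h2 h00
  · exact e01
  · change P 1 0 = 0
    rw [h10, e01, map_zero]
  · exact Complex.ext (by simp [h1, h2]) h11

/-- Bernoulli: `N x ≤ (1 + x)^N`, and `(1 + x)(1 - x) ≤ 1`. -/
theorem mul_pow_mul_one_sub_pow_le {x : ℝ} (h0 : 0 ≤ x) (h1 : x ≤ 1) (N : ℕ) :
    N * (x * (1 - x) ^ N) ≤ 1 := by
  have h2 : 1 + N * x ≤ (1 + x) ^ N := one_add_mul_le_pow (by linarith) N
  have h3 : 0 ≤ (1 - x) ^ N := pow_nonneg (by linarith) N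
  have h4 : (1 - x) ^ N * (1 + x) ^ N ≤ 1 := by
    rw [← mul_pow]
    exact pow_le_one₀ (by nlinarith) (by nlinarith)
  nlinarith [mul_le_mul_of_nonneg_left h2 h3]

theorem norm_mul_one_sub_pow_le {A : Type*} [CStarAlgebra A] [PartialOrder A] [StarOrderedRing A]
    {t : A} (ht : 0 ≤ t) (ht1 : ‖t‖ ≤ 1) (N : ℕ) : N * ‖t * (1 - t) ^ N‖ ≤ 1 := by
  rcases N.eq_zero_or_pos with rfl | hN
  · simp
  have hN' : (0 : ℝ) < N := by exact_mod_cast hN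
  have hsa : IsSelfAdjoint t := IsSelfAdjoint.of_nonneg ht
  have e : t * (1 - t) ^ N = cfc (fun x : ℝ => x * (1 - x) ^ N) t := by
    rw [cfc_mul (fun x : ℝ => x) (fun x => (1 - x) ^ N) t, cfc_pow (fun x : ℝ => 1 - x) N t,
      cfc_sub (fun _ : ℝ => 1) (fun x => x) t, cfc_const_one ℝ t, cfc_id' ℝ t]
  rw [mul_comm, ← le_div_iff₀ hN', e]
  refine norm_cfc_le (by positivity) fun x hx => ?_
  have h0 : 0 ≤ x := spectrum_nonneg_of_nonneg ht hx
  have h1 : x ≤ 1 := by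
    rcases subsingleton_or_nontrivial A with hA | hA
    · simp at hx
    exact (le_abs_self x).trans ((spectrum.norm_le_norm_of_mem hx).trans ht1)
  rw [Real.norm_of_nonneg (mul_nonneg h0 (pow_nonneg (by linarith) N)), le_div_iff₀ hN', mul_comm]
  exact mul_pow_mul_one_sub_pow_le h0 h1 N

/-- The sum of the self-commutators, as an element of the algebra of the quantum phase space. -/
def phaseSelfCommutator (n : ℕ) : phaseAlgebra n :=
  ∑ k, ∑ l, (phaseToeplitz n (coord k l) * phaseToeplitz n (conjCoord k l) -
    phaseToeplitz n (conjCoord k l) * phaseToeplitz n (coord k l))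

theorem coe_phaseSelfCommutator (n : ℕ) :
    (phaseSelfCommutator n : State n →L[ℂ] State n) = selfCommutator n := by
  rw [phaseSelfCommutator, selfCommutator]
  simp only [AddSubmonoidClass.coe_finsetSum]
  refine Finset.sum_congr rfl fun k _ => Finset.sum_congr rfl fun l _ => ?_
  rw [← toeplitz_conjCoord, ← toeplitz_coord]
  rfl

theorem selfCommutator_nonneg (n : ℕ) : 0 ≤ selfCommutator n := by
  rw [ContinuousLinearMap.nonneg_iff_isPositive, ContinuousLinearMap.isPositive_iff_complex]
  intro ψ
  have h := inner_selfCommutator_nonneg n ψ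
  rw [← inner_conj_symm, inner_selfCommutator, Complex.conj_ofReal]
  rw [inner_selfCommutator, Complex.ofReal_re] at h
  exact ⟨rfl, h⟩

theorem one_sub_one_sub_pow_mem {A : Type*} [Ring A] {I : TwoSidedIdeal A} {t : A} (ht : t ∈ I)
    (N : ℕ) : 1 - (1 - t) ^ N ∈ I := by
  rw [← mul_neg_geom_sum, sub_sub_cancel]
  exact I.mul_mem_right _ _ ht

/-- Applying the hypothesis to `(1 - T)^N ψ` bounds the squared norm by `C ⟨ψ, T (1 - T)^{2N} ψ⟩`,
and `T (1 - T)^{2N}` has norm at most `1/N` by functional calculus. -/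
theorem norm_mul_one_sub_pow_sq_le {H : Type*} [NormedAddCommGroup H] [InnerProductSpace ℂ H]
    [CompleteSpace H] {R T : H →L[ℂ] H} {C : ℝ} (hC : 0 ≤ C)
    (h : ∀ ψ, ‖R ψ‖ ^ 2 ≤ C * (inner ℂ ψ (T ψ)).re) (hT0 : 0 ≤ T) (hT1 : ‖T‖ ≤ 1) {N : ℕ}
    (hN : 0 < N) : ‖R * (1 - T) ^ N‖ ≤ √(C / N) := by
  have hN' : (0 : ℝ) < N := by exact_mod_cast hN
  have hsa : IsSelfAdjoint T := IsSelfAdjoint.of_nonneg hT0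
  have hself : star ((1 - T) ^ N) = (1 - T) ^ N := ((IsSelfAdjoint.one _).sub hsa).pow N
  have h1 : ‖T * (1 - T) ^ (N + N)‖ ≤ 1 / N := by
    have h2 := norm_mul_one_sub_pow_le hT0 hT1 (N + N)
    have h3 := norm_nonneg (T * (1 - T) ^ (N + N))
    rw [le_div_iff₀' hN']
    push_cast at h2
    nlinarith
  refine ContinuousLinearMap.opNorm_le_bound _ (Real.sqrt_nonneg _) fun ψ => ?_
  have h4 : inner ℂ (((1 - T) ^ N) ψ) (T (((1 - T) ^ N) ψ)) =
      inner ℂ ψ ((T * (1 - T) ^ (N + N)) ψ) := by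
    have e : T * (1 - T) ^ (N + N) = (1 - T) ^ N * (T * (1 - T) ^ N) := by
      have hcomm : Commute T ((1 - T) ^ N) :=
        ((Commute.one_right T).sub_right (Commute.refl T)).pow_right N
      rw [pow_add, ← mul_assoc, hcomm.eq, mul_assoc, hcomm.eq]
    rw [e, mul_apply_eq_comp, mul_apply_eq_comp]
    conv_lhs => rw [← hself, ContinuousLinearMap.star_eq_adjoint]
    rw [ContinuousLinearMap.adjoint_inner_left, ← ContinuousLinearMap.star_eq_adjoint, hself]
  have h6 : (inner ℂ (((1 - T) ^ N) ψ) (T (((1 - T) ^ N) ψ))).re ≤ 1 / N * ‖ψ‖ ^ 2 := by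
    rw [h4]
    refine (Complex.re_le_norm _).trans ((norm_inner_le_norm _ _).trans ?_)
    have := (T * (1 - T) ^ (N + N)).le_of_opNorm_le h1 ψ
    nlinarith [norm_nonneg ψ]
  rw [mul_apply_eq_comp, ← pow_le_pow_iff_left₀ (norm_nonneg _) (by positivity) two_ne_zero,
    mul_pow, Real.sq_sqrt (by positivity)]
  refine (h _).trans ((mul_le_mul_of_nonneg_left h6 hC).trans_eq ?_)
  ring

/-- The elements `1 - (1 - t)^N` of `I` act as an approximate right unit on `T_τ`, because `T_τ*T_τ`
is dominated by a multiple of `t`. -/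
theorem phaseToeplitz_deficitSymbol_mem {I : TwoSidedIdeal (phaseAlgebra n)}
    (hI : IsClosed (I : Set (phaseAlgebra n))) (hc : ∀ a b : phaseAlgebra n, a * b - b * a ∈ I) :
    phaseToeplitz n deficitSymbol ∈ I := by
  obtain ⟨C, hC, h⟩ := exists_norm_toeplitz_deficitSymbol_le n
  -- The added `1` keeps `M` positive even when the self-commutator sum vanishes.
  set M : ℝ := ‖selfCommutator n‖ + 1 with hM
  have hM0 : 0 < M := by positivity
  set t : phaseAlgebra n := ((M⁻¹ : ℝ) : ℂ) • phaseSelfCommutator n with ht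
  have htI : t ∈ I := by
    rw [ht, Algebra.smul_def]
    refine I.mul_mem_left _ _ ?_
    exact I.finsetSum_mem _ _ fun k _ => I.finsetSum_mem _ _ fun l _ => hc _ _
  set T : State n →L[ℂ] State n := (t : State n →L[ℂ] State n) with hT
  have hTe : T = ((M⁻¹ : ℝ) : ℂ) • selfCommutator n := by
    rw [hT, ht, ← coe_phaseSelfCommutator]
    rfl
  have hT0 : 0 ≤ T := by
    rw [hTe]
    refine smul_nonneg ?_ (selfCommutator_nonneg n)
    exact Complex.zero_le_real.2 (by positivity)
  have hT1 : ‖T‖ ≤ 1 := by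
    rw [hTe, norm_smul, Complex.norm_real, Real.norm_of_nonneg (by positivity),
      inv_mul_le_iff₀ hM0]
    linarith
  have hTI : ∀ ψ : State n, ‖toeplitz n deficitSymbol ψ‖ ^ 2 ≤
      C * M * (inner ℂ ψ (T ψ)).re := by
    intro ψ
    refine (h ψ).trans_eq ?_
    rw [hTe, _root_.smul_apply, inner_smul_right, Complex.re_ofReal_mul, mul_assoc,
      mul_inv_cancel_left₀ hM0.ne']
  have key : ∀ N : ℕ, 0 < N → ‖toeplitz n deficitSymbol * (1 - T) ^ N‖ ≤ √(C * M / N) :=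
    fun N hN => norm_mul_one_sub_pow_sq_le (by positivity) hTI hT0 hT1 hN
  have hlim : Filter.Tendsto (fun N : ℕ => phaseToeplitz n deficitSymbol * (1 - (1 - t) ^ N))
      Filter.atTop (nhds (phaseToeplitz n deficitSymbol)) := by
    rw [tendsto_iff_norm_sub_tendsto_zero]
    have h0 : Filter.Tendsto (fun N : ℕ => √(C * M / N)) Filter.atTop (nhds 0) := by
      have := (tendsto_const_div_atTop_nhds_zero_nat (C * M)).sqrt
      rwa [Real.sqrt_zero] at this
    refine squeeze_zero' (Filter.Eventually.of_forall fun N => norm_nonneg _) ?_ h0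
    filter_upwards [Filter.eventually_gt_atTop 0] with N hN
    have e : phaseToeplitz n deficitSymbol * (1 - (1 - t) ^ N) - phaseToeplitz n deficitSymbol =
        -(phaseToeplitz n deficitSymbol * (1 - t) ^ N) := by
      rw [mul_sub, mul_one]
      abel
    rw [e, norm_neg]
    exact key N hN
  exact hI.mem_of_tendsto hlim (Filter.Eventually.of_forall fun N =>
    I.mul_mem_left _ _ (one_sub_one_sub_pow_mem htI N))

/-- With `τ` the deficit, `f` is the uniform limit of `f τ / (τ + η)` as `η → 0`: the error `f η /
(τ + η)` is small near `U(2)` because `f` is, and small elsewhere because `τ` is bounded below. -/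
theorem phaseToeplitz_mem_of_vanish {I : TwoSidedIdeal (phaseAlgebra n)}
    (hI : IsClosed (I : Set (phaseAlgebra n))) (hc : ∀ a b : phaseAlgebra n, a * b - b * a ∈ I)
    {f : C(closure ball, ℂ)} (hf : ∀ Z : closure ball, (Z : Mat2) ∈ U2 → f Z = 0) :
    phaseToeplitz n f ∈ I := by
  have hmul : ∀ g : C(closure ball, ℂ), phaseToeplitz n (g * deficitSymbol) ∈ I := by
    intro g
    have h1 := phaseToeplitz_mul_sub_mem hI hc g deficitSymbol
    have h2 := I.sub_mem (I.mul_mem_left (phaseToeplitz n g) _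
      (phaseToeplitz_deficitSymbol_mem hI hc)) h1
    rwa [sub_sub_cancel] at h2
  have hd : ∀ Z : closure ball, 0 ≤ deficit Z := fun Z => deficit_nonneg Z.2
  have happ : ∀ ε > 0, ∃ g : C(closure ball, ℂ), ‖f - g * deficitSymbol‖ ≤ ε := by
    intro ε hε
    -- Compactness: on the set where `f` is not small the deficit attains a minimum, which is
    -- positive since `f` vanishes on the zero set of the deficit.
    obtain ⟨δ, hδ, hδ'⟩ : ∃ δ > 0, ∀ Z : closure ball, deficit Z < δ → ‖f Z‖ < ε := by
      by_contra! hcon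
      have hK : IsCompact {Z : closure ball | ε ≤ ‖f Z‖} :=
        (isClosed_le continuous_const f.continuous.norm).isCompact
      have hne : {Z : closure ball | ε ≤ ‖f Z‖}.Nonempty := by
        obtain ⟨Z, -, hZ⟩ := hcon 1 one_pos
        exact ⟨Z, hZ⟩
      obtain ⟨Z₀, hZ₀, hmin⟩ := hK.exists_isMinOn hne
        (f := fun Z : closure ball => deficit Z)
        (continuous_deficit.comp continuous_subtype_val).continuousOn
      rcases (hd Z₀).eq_or_lt with h0 | h0
      · have h1 := hf Z₀ (mem_U2_of_deficit_eq_zero Z₀.2 h0.symm)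
        have h2 : ε ≤ ‖f Z₀‖ := hZ₀
        rw [h1, norm_zero] at h2
        linarith
      · obtain ⟨Z, h1, h2⟩ := hcon _ h0
        exact absurd (hmin h2) (not_le.2 h1)
    obtain ⟨η, hη, hη'⟩ : ∃ η : ℝ, 0 < η ∧ η * ‖f‖ ≤ ε * δ := by
      refine ⟨ε * δ / (‖f‖ + 1), by positivity, ?_⟩
      rw [div_mul_eq_mul_div, div_le_iff₀ (by positivity)]
      nlinarith [norm_nonneg f, mul_pos hε hδ]
    have hpos : ∀ Z : closure ball, 0 < deficit Z + η := fun Z => by linarith [hd Z]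
    let g : C(closure ball, ℂ) :=
      { toFun := fun Z => f Z * (((deficit Z + η)⁻¹ : ℝ) : ℂ)
        continuous_toFun := f.continuous.mul (Complex.continuous_ofReal.comp
          (((continuous_deficit.comp continuous_subtype_val).add continuous_const).inv₀
            fun Z => (hpos Z).ne')) }
    refine ⟨g, (ContinuousMap.norm_le _ hε.le).2 fun Z => ?_⟩
    have e : (f - g * deficitSymbol) Z = f Z * ((η / (deficit Z + η) : ℝ) : ℂ) := by
      change f Z - f Z * (((deficit Z + η)⁻¹ : ℝ) : ℂ) * (deficit (Z : Mat2) : ℂ) = _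
      rw [mul_assoc, ← Complex.ofReal_mul, ← mul_one_sub, ← Complex.ofReal_one,
        ← Complex.ofReal_sub]
      congr 2
      field_simp [(hpos Z).ne']
      ring
    rw [e, norm_mul, Complex.norm_real, Real.norm_of_nonneg (div_nonneg hη.le (hpos Z).le)]
    rcases lt_or_ge (deficit Z) δ with h1 | h1
    · refine (mul_le_of_le_one_right (norm_nonneg _) ?_).trans (hδ' Z h1).le
      rw [div_le_one (hpos Z)]
      linarith [hd Z]
    · rw [mul_div_assoc', div_le_iff₀ (hpos Z)]
      have h2 := f.norm_coe_le_norm Z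
      nlinarith
  choose g hg using fun j : ℕ => happ (1 / ((j : ℝ) + 1)) (by positivity)
  have hlim : Filter.Tendsto (fun j => g j * deficitSymbol) Filter.atTop (nhds f) := by
    rw [tendsto_iff_norm_sub_tendsto_zero]
    refine squeeze_zero (fun j => norm_nonneg _) (fun j => ?_)
      tendsto_one_div_add_atTop_nhds_zero_nat
    rw [norm_sub_rev]
    exact hg j
  exact hI.mem_of_tendsto (((continuous_phaseToeplitz n).tendsto f).comp hlim)
    (Filter.Eventually.of_forall fun j => hmul (g j))

/-! ## Peak functions at the points of the unitary group -/

variable {n : ℕ}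

/-- The pairing `tr u† Z`. -/
def pairing (u Z : Mat2) : ℂ := ∑ k, ∑ l, conj (u k l) * Z k l

theorem differentiable_pairing (u : Mat2) : Differentiable ℂ (pairing u) := by
  unfold pairing
  fun_prop

/-- A nonnegative function on the closed ball that vanishes only at `u`. -/
def gap (u Z : Mat2) : ℝ := 2 * (2 - (pairing u Z).re)

theorem continuous_gap (u : Mat2) : Continuous (gap u) := by
  have := (differentiable_pairing u).continuous
  unfold gap
  fun_prop

theorem deficit_eq (Z : Mat2) : deficit Z = 2 - ∑ k, ∑ l, ‖Z k l‖ ^ 2 := by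
  have h : ∀ i j, (conj (Z i j) * Z i j).re = ‖Z i j‖ ^ 2 := fun i j => by
    rw [← Complex.normSq_eq_conj_mul_self, Complex.ofReal_re, Complex.normSq_eq_norm_sq]
  simp only [deficit, defect, Matrix.trace, Matrix.diag, Fin.sum_univ_two, Matrix.sub_apply,
    Matrix.one_apply_eq, Matrix.mul_apply, Matrix.conjTranspose_apply, Matrix.of_apply,
    Complex.star_def, Complex.add_re, Complex.sub_re, Complex.one_re, h]
  ring

/-- Expand `‖Z - u‖²` and use `‖u‖² = 2` in the Hilbert–Schmidt norm. Both summands are nonnegative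
on the closed ball, so `u` is the unique zero there. -/
theorem gap_eq {u : Mat2} (hu : u ∈ U2) (Z : Mat2) :
    gap u Z = (∑ k, ∑ l, ‖Z k l - u k l‖ ^ 2) + deficit Z := by
  have h0 : deficit u = 0 := by
    rw [deficit, mem_U2_iff.1 hu, Matrix.trace_zero, Complex.zero_re]
  have h1 := deficit_eq u
  have h : ∀ i j, ‖Z i j - u i j‖ ^ 2 =
      ‖Z i j‖ ^ 2 + ‖u i j‖ ^ 2 - 2 * (conj (u i j) * Z i j).re := fun i j => by
    rw [← Complex.normSq_eq_norm_sq, Complex.normSq_sub, Complex.normSq_eq_norm_sq,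
      Complex.normSq_eq_norm_sq, mul_comm (Z i j)]
  rw [deficit_eq]
  simp only [gap, pairing, h, Fin.sum_univ_two, Complex.add_re] at h1 ⊢
  linarith

theorem gap_self {u : Mat2} (hu : u ∈ U2) : gap u u = 0 := by
  have h0 : deficit u = 0 := by
    rw [deficit, mem_U2_iff.1 hu, Matrix.trace_zero, Complex.zero_re]
  rw [gap_eq hu, h0]
  simp

theorem gap_nonneg {u Z : Mat2} (hu : u ∈ U2) (hZ : Z ∈ closure ball) : 0 ≤ gap u Z := by
  rw [gap_eq hu]
  exact add_nonneg (Finset.sum_nonneg fun k _ => Finset.sum_nonneg fun l _ => by positivity)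
    (deficit_nonneg hZ)

theorem eq_of_gap_le_zero {u Z : Mat2} (hu : u ∈ U2) (hZ : Z ∈ closure ball)
    (h : gap u Z ≤ 0) : Z = u := by
  rw [gap_eq hu] at h
  have h1 := deficit_nonneg hZ
  simp only [Fin.sum_univ_two] at h
  have h2 : ∀ k l, ‖Z k l - u k l‖ ^ 2 = 0 := by
    intro k l
    refine le_antisymm ?_ (by positivity)
    have := fun k l => sq_nonneg ‖Z k l - u k l‖
    fin_cases k <;> fin_cases l <;> simp only [Fin.zero_eta, Fin.mk_one] <;>
      linarith [this 0 0, this 0 1, this 1 0, this 1 1]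
  funext k l
  exact sub_eq_zero.1 (norm_eq_zero.1 (pow_eq_zero_iff two_ne_zero |>.1 (h2 k l)))

/-- The powers of a peak function at `u`. -/
def peak (u : Mat2) (j : ℕ) (Z : Mat2) : ℂ := Complex.exp (j * (pairing u Z - 2))

theorem differentiable_peak (u : Mat2) (j : ℕ) : Differentiable ℂ (peak u j) := by
  have := differentiable_pairing u
  unfold peak
  fun_prop

theorem norm_peak_sq (u : Mat2) (j : ℕ) (Z : Mat2) :
    ‖peak u j Z‖ ^ 2 = Real.exp (-(j * gap u Z)) := by
  rw [peak, Complex.norm_exp, ← Real.exp_nat_mul]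
  congr 1
  simp [gap]
  ring

instance isFiniteMeasure_weightedMeasure (n : ℕ) : IsFiniteMeasure (weightedMeasure n) := by
  have hb : Bornology.IsBounded (closure ball) := (isCompact_iff_compactSpace.2
    compactSpace_closure_ball).isBounded
  refine ⟨?_⟩
  rw [← setLIntegral_one, Measure.restrict_univ, lintegral_weightedMeasure]
  refine ENNReal.mul_lt_top ENNReal.ofReal_lt_top ?_
  simp only [mul_one]
  refine (lintegral_mono_set subset_closure).trans_lt ?_
  have hc : IsCompact (closure ball) := isCompact_iff_compactSpace.2 compactSpace_closure_ball
  obtain ⟨C, hC⟩ := hc.exists_bound_of_continuousOn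
    (continuous_defect_det.pow (n - 4)).continuousOn
  refine (setLIntegral_mono measurable_const fun Z hZ =>
    ENNReal.ofReal_le_ofReal ((le_abs_self _).trans (hC Z hZ))).trans_lt ?_
  rw [setLIntegral_const]
  exact ENNReal.mul_lt_top ENNReal.ofReal_lt_top hc.measure_lt_top

theorem weightedMeasure_pos (hn : 3 < n) {O : Set Mat2} (hO : IsOpen O) (hne : (O ∩ ball).Nonempty) :
    0 < weightedMeasure n O := by
  rw [← setLIntegral_one, ← lintegral_indicator hO.measurableSet, lintegral_weightedMeasure]
  refine ENNReal.mul_pos (ENNReal.ofReal_pos.2 (normConst_pos hn)).ne' ?_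
  have hm : Measurable fun Z => weight (n - 4) Z * O.indicator 1 Z :=
    (measurable_weight _).mul (measurable_one.indicator hO.measurableSet)
  refine (setLIntegral_pos_iff hm |>.2 ?_).ne'
  refine ((hO.inter isOpen_ball).measure_pos volume hne).trans_le (measure_mono ?_)
  rintro Z ⟨hZ, hZ'⟩
  refine ⟨?_, hZ'⟩
  rw [Function.mem_support, Set.indicator_of_mem hZ, Pi.one_apply, mul_one]
  have h : StrictContraction (Matrix.of Z) := hZ'
  exact (ENNReal.ofReal_pos.2 (pow_pos h.det_pos _)).ne'

theorem exists_peakState (n : ℕ) {u : Mat2} (hu : u ∈ U2) (j : ℕ) : ∃ v : State n,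
    ∀ᵐ Z ∂(weightedMeasure n), incl n v Z = conj (peak u j Z) := by
  have hc : Continuous fun Z => conj (peak u j Z) :=
    Complex.continuous_conj.comp (differentiable_peak u j).continuous
  have hmem : MemLp (fun Z => conj (peak u j Z)) 2 (weightedMeasure n) := by
    refine MemLp.of_bound hc.aestronglyMeasurable 1 ?_
    filter_upwards [ae_mem_closure_ball n] with Z hZ
    rw [RCLike.norm_conj, ← sq_le_one_iff₀ (norm_nonneg _), norm_peak_sq, Real.exp_le_one_iff,
      Left.neg_nonpos_iff]
    exact mul_nonneg (Nat.cast_nonneg j) (gap_nonneg hu hZ)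
  exact ⟨⟨hmem.toLp _, subset_closure ⟨peak u j, (differentiable_peak u j).differentiableOn,
    hmem.coeFn_toLp⟩⟩, hmem.coeFn_toLp⟩

/-- The state with coherent state function `conj (peak u j)`. -/
def peakState (n : ℕ) {u : Mat2} (hu : u ∈ U2) (j : ℕ) : State n :=
  (exists_peakState n hu j).choose

theorem incl_peakState (n : ℕ) {u : Mat2} (hu : u ∈ U2) (j : ℕ) :
    ∀ᵐ Z ∂(weightedMeasure n), incl n (peakState n hu j) Z = conj (peak u j Z) :=
  (exists_peakState n hu j).choose_spec

theorem ofReal_norm_mulOp_peakState_sq {u : Mat2} (hu : u ∈ U2) (j : ℕ) (f : C(closure ball, ℂ)) :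
    ENNReal.ofReal (‖mulOp n f (incl n (peakState n hu j))‖ ^ 2) =
      ∫⁻ Z, ENNReal.ofReal (‖extendZero f Z‖ ^ 2 * Real.exp (-(j * gap u Z)))
        ∂(weightedMeasure n) := by
  rw [ofReal_norm_sq_eq_lintegral]
  refine lintegral_congr_ae ?_
  filter_upwards [mulOp_ae n f (incl n (peakState n hu j)), incl_peakState n hu j] with Z h1 h2
  rw [h1, h2, norm_mul, RCLike.norm_conj, mul_pow, norm_peak_sq]

theorem ofReal_norm_peakState_sq {u : Mat2} (hu : u ∈ U2) (j : ℕ) :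
    ENNReal.ofReal (‖peakState n hu j‖ ^ 2) =
      ∫⁻ Z, ENNReal.ofReal (Real.exp (-(j * gap u Z))) ∂(weightedMeasure n) := by
  rw [← (incl n).norm_map, ofReal_norm_sq_eq_lintegral]
  refine lintegral_congr_ae ?_
  filter_upwards [incl_peakState n hu j] with Z h2
  rw [h2, RCLike.norm_conj, norm_peak_sq]

/-- The points with `gap < δ` form an open neighbourhood of `u`, which lies in the closure of the
ball; `m` is its positive measure. -/
theorem exists_mul_exp_le_norm_peakState_sq (hn : 3 < n) {u : Mat2} (hu : u ∈ U2) {δ : ℝ}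
    (hδ : 0 < δ) : ∃ m > 0, ∀ j : ℕ, m * Real.exp (-(j * δ)) ≤ ‖peakState n hu j‖ ^ 2 := by
  have hO : IsOpen {Z | gap u Z < δ} := isOpen_lt (continuous_gap u) continuous_const
  have hne : ({Z | gap u Z < δ} ∩ ball).Nonempty :=
    mem_closure_iff.1 (U2_subset_closure_ball hu) _ hO
      (by rw [Set.mem_ofPred_eq, gap_self hu]; exact hδ)
  have hpos := weightedMeasure_pos hn hO hne
  refine ⟨(weightedMeasure n {Z | gap u Z < δ}).toReal,
    ENNReal.toReal_pos hpos.ne' (measure_ne_top _ _), fun j => ?_⟩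
  rw [← ENNReal.ofReal_le_ofReal_iff (by positivity), ofReal_norm_peakState_sq,
    ENNReal.ofReal_mul ENNReal.toReal_nonneg, ENNReal.ofReal_toReal (measure_ne_top _ _), mul_comm]
  refine le_trans ?_ (setLIntegral_le_lintegral {Z | gap u Z < δ} _)
  rw [← setLIntegral_const]
  refine setLIntegral_mono' hO.measurableSet fun Z hZ => ?_
  have hZ' : gap u Z < δ := hZ
  refine ENNReal.ofReal_le_ofReal (Real.exp_le_exp.2 (neg_le_neg ?_))
  exact mul_le_mul_of_nonneg_left hZ'.le (Nat.cast_nonneg j)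

theorem peakState_ne_zero (hn : 3 < n) {u : Mat2} (hu : u ∈ U2) (j : ℕ) :
    peakState n hu j ≠ 0 := by
  obtain ⟨m, hm, h⟩ := exists_mul_exp_le_norm_peakState_sq hn hu one_pos
  intro h0
  have := h j
  rw [h0, norm_zero] at this
  have h1 := mul_pos hm (Real.exp_pos (-(j * 1)))
  linarith

/-- Where the gap is below `2δ`, `f` is small. Elsewhere the squared peak function is at most `exp
(-2jδ)`, negligible against the lower bound `m exp (-jδ)` for the squared norm of the state. -/
theorem mulOp_peakState_isLittleO (hn : 3 < n) {u : Mat2} (hu : u ∈ U2) {f : C(closure ball, ℂ)}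
    (hf : f ⟨u, U2_subset_closure_ball hu⟩ = 0) :
    (fun j => mulOp n f (incl n (peakState n hu j))) =o[Filter.atTop] peakState n hu := by
  rw [Asymptotics.isLittleO_iff]
  intro ε hε
  obtain ⟨δ, hδ, hδ'⟩ : ∃ δ > 0, ∀ Z : closure ball, gap u Z < 2 * δ → ‖f Z‖ ^ 2 < ε ^ 2 / 2 := by
    by_contra! hcon
    have hK : IsCompact {Z : closure ball | ε ^ 2 / 2 ≤ ‖f Z‖ ^ 2} :=
      (isClosed_le continuous_const (f.continuous.norm.pow 2)).isCompact
    have hne : {Z : closure ball | ε ^ 2 / 2 ≤ ‖f Z‖ ^ 2}.Nonempty := by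
      obtain ⟨Z, -, hZ⟩ := hcon 1 one_pos
      exact ⟨Z, hZ⟩
    obtain ⟨Z₀, hZ₀, hmin⟩ := hK.exists_isMinOn hne (f := fun Z : closure ball => gap u Z)
      ((continuous_gap u).comp continuous_subtype_val).continuousOn
    rcases le_or_gt (gap u Z₀) 0 with h0 | h0
    · have h1 : Z₀ = ⟨u, U2_subset_closure_ball hu⟩ :=
        Subtype.ext (eq_of_gap_le_zero hu Z₀.2 h0)
      have h2 : ε ^ 2 / 2 ≤ ‖f Z₀‖ ^ 2 := hZ₀
      rw [h1, hf, norm_zero] at h2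
      have : 0 < ε ^ 2 := by positivity
      linarith
    · obtain ⟨Z, h1, h2⟩ := hcon (gap u Z₀ / 2) (by positivity)
      have h3 : gap u Z₀ ≤ gap u Z := hmin h2
      linarith
  obtain ⟨m, hm, hm'⟩ := exists_mul_exp_le_norm_peakState_sq hn hu hδ
  set M : ℝ := (weightedMeasure n Set.univ).toReal with hM
  have hM0 : 0 ≤ M := ENNReal.toReal_nonneg
  have h1 : ∀ j : ℕ, ‖mulOp n f (incl n (peakState n hu j))‖ ^ 2 ≤
      ε ^ 2 / 2 * ‖peakState n hu j‖ ^ 2 + ‖f‖ ^ 2 * Real.exp (-(j * (2 * δ))) * M := by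
    intro j
    rw [← ENNReal.ofReal_le_ofReal_iff (by positivity), ofReal_norm_mulOp_peakState_sq,
      ENNReal.ofReal_add (by positivity) (by positivity), ENNReal.ofReal_mul (by positivity),
      ofReal_norm_peakState_sq, ENNReal.ofReal_mul (by positivity), hM,
      ENNReal.ofReal_toReal (measure_ne_top _ _), ← lintegral_const_mul' _ _ ENNReal.ofReal_ne_top,
      ← lintegral_const, ← lintegral_add_right _ measurable_const]
    refine lintegral_mono_ae ?_
    filter_upwards [ae_mem_closure_ball n] with Z hZ
    rw [extendZero_apply f ⟨Z, hZ⟩, ← ENNReal.ofReal_mul (by positivity),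
      ← ENNReal.ofReal_add (by positivity) (by positivity)]
    refine ENNReal.ofReal_le_ofReal ?_
    rcases lt_or_ge (gap u Z) (2 * δ) with h | h
    · exact le_add_of_le_of_nonneg
        (mul_le_mul_of_nonneg_right (hδ' ⟨Z, hZ⟩ h).le (Real.exp_nonneg _)) (by positivity)
    · refine le_add_of_nonneg_of_le (by positivity) ?_
      have h3 := f.norm_coe_le_norm ⟨Z, hZ⟩
      have h4 : Real.exp (-(j * gap u Z)) ≤ Real.exp (-(j * (2 * δ))) :=
        Real.exp_le_exp.2 (neg_le_neg (mul_le_mul_of_nonneg_left h (Nat.cast_nonneg j)))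
      exact mul_le_mul (pow_le_pow_left₀ (norm_nonneg _) h3 2) h4 (Real.exp_nonneg _)
        (by positivity)
  have hlim : Filter.Tendsto (fun j : ℕ => ‖f‖ ^ 2 * M / m * Real.exp (-(j * δ)))
      Filter.atTop (nhds 0) := by
    have h2 : Filter.Tendsto (fun j : ℕ => Real.exp (-(j * δ))) Filter.atTop (nhds 0) :=
      Real.tendsto_exp_neg_atTop_nhds_zero.comp
        (tendsto_natCast_atTop_atTop.atTop_mul_const hδ)
    simpa using h2.const_mul (‖f‖ ^ 2 * M / m)
  filter_upwards [hlim.eventually_le_const (by positivity : (0 : ℝ) < ε ^ 2 / 2)] with j hj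
  rw [← pow_le_pow_iff_left₀ (norm_nonneg _) (by positivity) two_ne_zero, mul_pow]
  refine (h1 j).trans ?_
  have h5 : ‖f‖ ^ 2 * Real.exp (-(j * (2 * δ))) * M =
      ‖f‖ ^ 2 * M / m * Real.exp (-(j * δ)) * (m * Real.exp (-(j * δ))) := by
    have : Real.exp (-(j * (2 * δ))) = Real.exp (-(j * δ)) * Real.exp (-(j * δ)) := by
      rw [← Real.exp_add]
      congr 1
      ring
    rw [this]
    field_simp
  rw [h5]
  have h6 := mul_le_mul hj (hm' j) (by positivity) (by positivity)
  linarith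

/-! ## Joint approximate eigenvalues -/

section ApproximateEigenvalue

variable {H : Type*} [NormedAddCommGroup H] [InnerProductSpace ℂ H]
  {v : ℕ → H} {x y : H →L[ℂ] H} {c d : ℂ}

theorem isLittleO_mul_apply (hx : (fun j => x (v j) - c • v j) =o[Filter.atTop] v)
    (hy : (fun j => y (v j) - d • v j) =o[Filter.atTop] v) :
    (fun j => (x * y) (v j) - (c * d) • v j) =o[Filter.atTop] v := by
  have h1 := (x.isBigO_comp (fun j => y (v j) - d • v j) Filter.atTop).trans_isLittleO hy
  refine (h1.add (hx.const_smul_left d)).congr_left fun j => ?_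
  change x (y (v j) - d • v j) + d • (x (v j) - c • v j) = x (y (v j)) - (c * d) • v j
  rw [map_sub, map_smul, smul_sub, smul_smul, mul_comm d]
  abel

theorem isLittleO_of_approx (h : ∀ ε > 0, ∃ (y : H →L[ℂ] H) (d : ℂ),
      (fun j => y (v j) - d • v j) =o[Filter.atTop] v ∧ ‖x - y‖ ≤ ε ∧ ‖c - d‖ ≤ ε) :
    (fun j => x (v j) - c • v j) =o[Filter.atTop] v := by
  rw [Asymptotics.isLittleO_iff]
  intro ε hε
  obtain ⟨y, d, h1, h2, h3⟩ := h (ε / 3) (by positivity)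
  filter_upwards [h1.def (by positivity : 0 < ε / 3)] with j hj
  have e : x (v j) - c • v j = (x - y) (v j) + (y (v j) - d • v j) - (c - d) • v j := by
    rw [_root_.sub_apply, sub_smul]
    abel
  have h4 := (x - y).le_of_opNorm_le h2 (v j)
  have h5 : ‖(c - d) • v j‖ ≤ ε / 3 * ‖v j‖ := by
    rw [norm_smul]
    exact mul_le_mul_of_nonneg_right h3 (norm_nonneg _)
  rw [e]
  refine (norm_sub_le _ _).trans ?_
  have h6 := norm_add_le ((x - y) (v j)) (y (v j) - d • v j)
  linarith

variable [CompleteSpace H]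

/-- `c` is an approximate eigenvalue of `x`, and `conj c` one of the adjoint of `x`, along the
sequence `v`. -/
def IsApproxEigenvalue (v : ℕ → H) (x : H →L[ℂ] H) (c : ℂ) : Prop :=
  (fun j => x (v j) - c • v j) =o[Filter.atTop] v ∧
    (fun j => star x (v j) - conj c • v j) =o[Filter.atTop] v

theorem IsApproxEigenvalue.star (hx : IsApproxEigenvalue v x c) :
    IsApproxEigenvalue v (star x) (conj c) := by
  refine ⟨hx.2, ?_⟩
  rw [star_star, Complex.conj_conj]
  exact hx.1

theorem IsApproxEigenvalue.add (hx : IsApproxEigenvalue v x c) (hy : IsApproxEigenvalue v y d) :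
    IsApproxEigenvalue v (x + y) (c + d) := by
  constructor
  · refine (hx.1.add hy.1).congr_left fun j => ?_
    rw [_root_.add_apply, add_smul]
    abel
  · refine (hx.2.add hy.2).congr_left fun j => ?_
    rw [star_add, map_add, _root_.add_apply, add_smul]
    abel

theorem IsApproxEigenvalue.sub (hx : IsApproxEigenvalue v x c) (hy : IsApproxEigenvalue v y d) :
    IsApproxEigenvalue v (x - y) (c - d) := by
  constructor
  · refine (hx.1.sub hy.1).congr_left fun j => ?_
    rw [_root_.sub_apply, sub_smul]
    abel
  · refine (hx.2.sub hy.2).congr_left fun j => ?_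
    rw [star_sub, map_sub, _root_.sub_apply, sub_smul]
    abel

theorem IsApproxEigenvalue.mul (hx : IsApproxEigenvalue v x c) (hy : IsApproxEigenvalue v y d) :
    IsApproxEigenvalue v (x * y) (c * d) := by
  refine ⟨isLittleO_mul_apply hx.1 hy.1, ?_⟩
  rw [star_mul, map_mul, mul_comm (conj c)]
  exact isLittleO_mul_apply hy.2 hx.2

theorem isApproxEigenvalue_algebraMap (v : ℕ → H) (r : ℂ) :
    IsApproxEigenvalue v (algebraMap ℂ (H →L[ℂ] H) r) r := by
  constructor
  · refine (Asymptotics.isLittleO_zero v Filter.atTop).congr_left fun j => ?_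
    exact (sub_self (r • v j)).symm
  · refine (Asymptotics.isLittleO_zero v Filter.atTop).congr_left fun j => ?_
    rw [← algebraMap_star_comm]
    exact (sub_self (conj r • v j)).symm

theorem IsApproxEigenvalue.norm_le (hv : ∀ j, v j ≠ 0) (hx : IsApproxEigenvalue v x c) :
    ‖c‖ ≤ ‖x‖ := by
  refine le_of_forall_pos_le_add fun ε hε => ?_
  obtain ⟨j, hj⟩ := (hx.1.def hε).exists
  have h0 : 0 < ‖v j‖ := norm_pos_iff.2 (hv j)
  refine le_of_mul_le_mul_right ?_ h0
  have h1 := norm_sub_le (x (v j)) (x (v j) - c • v j)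
  rw [sub_sub_cancel, norm_smul] at h1
  have h2 := x.le_opNorm (v j)
  linarith

theorem IsApproxEigenvalue.unique (hv : ∀ j, v j ≠ 0) (hx : IsApproxEigenvalue v x c)
    (hx' : IsApproxEigenvalue v x d) : c = d := by
  have h := (hx.sub hx').norm_le hv
  rw [sub_self, norm_zero] at h
  exact sub_eq_zero.1 (norm_le_zero_iff.1 h)

theorem isApproxEigenvalue_of_approx (h : ∀ ε > 0, ∃ (y : H →L[ℂ] H) (d : ℂ),
    IsApproxEigenvalue v y d ∧ ‖x - y‖ ≤ ε ∧ ‖c - d‖ ≤ ε) : IsApproxEigenvalue v x c := by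
  constructor
  · refine isLittleO_of_approx fun ε hε => ?_
    obtain ⟨y, d, h1, h2, h3⟩ := h ε hε
    exact ⟨y, d, h1.1, h2, h3⟩
  · refine isLittleO_of_approx fun ε hε => ?_
    obtain ⟨y, d, h1, h2, h3⟩ := h ε hε
    refine ⟨Star.star y, conj d, h1.2, ?_, ?_⟩
    · rwa [← star_sub, norm_star]
    · rwa [← map_sub, RCLike.norm_conj]

/-- Suppose that for every point `u` of a compact space there is a sequence `v u` of nonzero
vectors. The operators that have a continuous function of joint approximate eigenvalues along
these sequences form a C*-algebra. -/
def approxEigenvalueAlgebra {K : Type*} [TopologicalSpace K] (v : K → ℕ → H) :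
    StarSubalgebra ℂ (H →L[ℂ] H) where
  carrier := {x | ∃ φ : C(K, ℂ), ∀ u, IsApproxEigenvalue (v u) x (φ u)}
  mul_mem' := by
    rintro x y ⟨φ, hφ⟩ ⟨χ, hχ⟩
    exact ⟨φ * χ, fun u => (hφ u).mul (hχ u)⟩
  add_mem' := by
    rintro x y ⟨φ, hφ⟩ ⟨χ, hχ⟩
    exact ⟨φ + χ, fun u => (hφ u).add (hχ u)⟩
  algebraMap_mem' r := ⟨algebraMap ℂ C(K, ℂ) r, fun u => isApproxEigenvalue_algebraMap (v u) r⟩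
  star_mem' := by
    rintro x ⟨φ, hφ⟩
    exact ⟨Star.star φ, fun u => (hφ u).star⟩

/-- An approximate eigenvalue is bounded by the operator norm, so along a convergent sequence of
operators the eigenvalue functions are uniformly Cauchy, and their limit is the eigenvalue function
of the limit. -/
theorem isClosed_approxEigenvalueAlgebra {K : Type*} [TopologicalSpace K] [CompactSpace K]
    {v : K → ℕ → H} (hv : ∀ u j, v u j ≠ 0) :
    IsClosed (approxEigenvalueAlgebra v : Set (H →L[ℂ] H)) := by
  refine isClosed_of_closure_subset fun x hx => ?_
  obtain ⟨X, hX, hlim⟩ := mem_closure_iff_seq_limit.1 hx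
  choose φ hφ using hX
  have hle : ∀ i j, ‖φ i - φ j‖ ≤ ‖X i - X j‖ := fun i j =>
    (ContinuousMap.norm_le _ (norm_nonneg _)).2 fun u => ((hφ i u).sub (hφ j u)).norm_le (hv u)
  have hcau : CauchySeq φ := by
    rw [Metric.cauchySeq_iff]
    intro ε hε
    obtain ⟨N, hN⟩ := Metric.cauchySeq_iff.1 hlim.cauchySeq ε hε
    refine ⟨N, fun i hi j hj => ?_⟩
    have := hN i hi j hj
    rw [dist_eq_norm] at this ⊢
    exact (hle i j).trans_lt this
  obtain ⟨χ, hχ⟩ := cauchySeq_tendsto_of_complete hcau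
  refine ⟨χ, fun u => isApproxEigenvalue_of_approx fun ε hε => ?_⟩
  obtain ⟨i, h1, h2⟩ := ((Metric.tendsto_nhds.1 hlim ε hε).and (Metric.tendsto_nhds.1 hχ ε hε)).exists
  refine ⟨X i, φ i u, hφ i u, ?_, ?_⟩
  · rw [dist_comm, dist_eq_norm] at h1
    exact h1.le
  · rw [dist_comm, dist_eq_norm] at h2
    exact ((χ - φ i).norm_coe_le_norm u).trans h2.le

end ApproximateEigenvalue

/-! ## The symbol of an operator -/

variable {n : ℕ}

theorem isClosed_U2 : IsClosed U2 := by
  have h : U2 = {Z ∈ closure ball | deficit Z = 0} := by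
    ext Z
    refine ⟨fun hZ => ⟨U2_subset_closure_ball hZ, ?_⟩, fun hZ => mem_U2_of_deficit_eq_zero hZ.1 hZ.2⟩
    rw [deficit, mem_U2_iff.1 hZ, Matrix.trace_zero, Complex.zero_re]
  rw [h]
  exact isClosed_closure.inter (isClosed_eq continuous_deficit continuous_const)

instance compactSpace_U2 : CompactSpace U2 :=
  isCompact_iff_compactSpace.1 ((isCompact_iff_compactSpace.2
    compactSpace_closure_ball).of_isClosed_subset isClosed_U2 U2_subset_closure_ball)

/-- The inclusion of `U(2)` in the closed ball. -/
def boundaryIncl : C(U2, closure ball) where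
  toFun Z := ⟨Z, U2_subset_closure_ball Z.2⟩
  continuous_toFun := by fun_prop

theorem toeplitz_peakState_isLittleO (hn : 3 < n) (u : U2) (f : C(closure ball, ℂ)) :
    (fun j => toeplitz n f (peakState n u.2 j) - f (boundaryIncl u) • peakState n u.2 j)
      =o[Filter.atTop] peakState n u.2 := by
  have h := mulOp_peakState_isLittleO hn u.2 (f := f - f (boundaryIncl u) • 1)
    (by simp [boundaryIncl])
  refine Asymptotics.IsBigO.trans_isLittleO (Asymptotics.isBigO_of_le _ fun j => ?_) h
  have e : toeplitz n f (peakState n u.2 j) - f (boundaryIncl u) • peakState n u.2 j =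
      toeplitz n (f - f (boundaryIncl u) • 1) (peakState n u.2 j) := by
    rw [← toeplitzL_apply, ← toeplitzL_apply, map_sub, map_smul, toeplitzL_apply 1, toeplitz_one]
    rfl
  rw [e, toeplitz_apply]
  exact norm_proj_le n _

theorem isApproxEigenvalue_toeplitz (hn : 3 < n) (f : C(closure ball, ℂ)) (u : U2) :
    IsApproxEigenvalue (peakState n u.2) (toeplitz n f) (f (boundaryIncl u)) := by
  refine ⟨toeplitz_peakState_isLittleO hn u f, ?_⟩
  rw [star_toeplitz]
  exact toeplitz_peakState_isLittleO hn u (star f)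

/-- The operators with a continuous eigenvalue function form a closed *-subalgebra containing the
generators, hence contain the algebra generated. -/
theorem exists_symbol (hn : 3 < n) (x : phaseAlgebra n) : ∃ φ : C(U2, ℂ),
    ∀ u : U2, IsApproxEigenvalue (peakState n u.2) (x : State n →L[ℂ] State n) (φ u) := by
  have h : phaseAlgebra n ≤ approxEigenvalueAlgebra fun u : U2 => peakState n u.2 := by
    refine StarSubalgebra.topologicalClosure_minimal (StarAlgebra.adjoin_le ?_)
      (isClosed_approxEigenvalueAlgebra fun u j => peakState_ne_zero hn u.2 j)
    rintro _ ⟨p, rfl⟩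
    exact ⟨(coord p.1 p.2).comp boundaryIncl, isApproxEigenvalue_toeplitz hn (coord p.1 p.2)⟩
  exact h x.2

/-- The symbol of an operator, a function on `U(2)`. -/
def symbolFun (hn : 3 < n) (x : phaseAlgebra n) : C(U2, ℂ) := (exists_symbol hn x).choose

theorem symbolFun_spec (hn : 3 < n) (x : phaseAlgebra n) (u : U2) :
    IsApproxEigenvalue (peakState n u.2) (x : State n →L[ℂ] State n) (symbolFun hn x u) :=
  (exists_symbol hn x).choose_spec u

theorem symbolFun_eq (hn : 3 < n) {x : phaseAlgebra n} {φ : C(U2, ℂ)}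
    (h : ∀ u : U2, IsApproxEigenvalue (peakState n u.2) (x : State n →L[ℂ] State n) (φ u)) :
    symbolFun hn x = φ := by
  ext u
  exact (symbolFun_spec hn x u).unique (peakState_ne_zero hn u.2) (h u)

/-- The symbol homomorphism. -/
def symbolHom (hn : 3 < n) : phaseAlgebra n →⋆ₐ[ℂ] C(U2, ℂ) where
  toFun := symbolFun hn
  map_one' := symbolFun_eq hn fun u => by
    simpa using isApproxEigenvalue_algebraMap (peakState n u.2) 1
  map_mul' x y := symbolFun_eq hn fun u => (symbolFun_spec hn x u).mul (symbolFun_spec hn y u)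
  map_zero' := symbolFun_eq hn fun u => by
    simpa using isApproxEigenvalue_algebraMap (peakState n u.2) 0
  map_add' x y := symbolFun_eq hn fun u => (symbolFun_spec hn x u).add (symbolFun_spec hn y u)
  commutes' r := symbolFun_eq hn fun u => isApproxEigenvalue_algebraMap (peakState n u.2) r
  map_star' x := symbolFun_eq hn fun u => (symbolFun_spec hn x u).star

theorem norm_symbolHom_le (hn : 3 < n) (x : phaseAlgebra n) : ‖symbolHom hn x‖ ≤ ‖x‖ :=
  (ContinuousMap.norm_le _ (norm_nonneg _)).2 fun u =>
    (symbolFun_spec hn x u).norm_le (peakState_ne_zero hn u.2)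

theorem symbolHom_phaseToeplitz (hn : 3 < n) (f : C(closure ball, ℂ)) :
    symbolHom hn (phaseToeplitz n f) = f.comp boundaryIncl :=
  symbolFun_eq hn (isApproxEigenvalue_toeplitz hn f)

theorem symbolHom_surjective (hn : 3 < n) : Function.Surjective (symbolHom hn) := by
  intro φ
  have hemb : Topology.IsClosedEmbedding boundaryIncl :=
    boundaryIncl.continuous.isClosedEmbedding fun Z W h =>
      Subtype.ext (congrArg (fun Y : closure ball => (Y : Mat2)) h)
  obtain ⟨f, hf⟩ := φ.exists_extension hemb
  exact ⟨phaseToeplitz n f, (symbolHom_phaseToeplitz hn f).trans hf⟩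

/-! ## The kernel of the symbol homomorphism -/

variable {n : ℕ}

theorem exists_toeplitz_mod {I : TwoSidedIdeal (phaseAlgebra n)}
    (hI : IsClosed (I : Set (phaseAlgebra n))) (hc : ∀ a b : phaseAlgebra n, a * b - b * a ∈ I)
    {y : State n →L[ℂ] State n}
    (hy : y ∈ StarAlgebra.adjoin ℂ (Set.range fun p : Fin 2 × Fin 2 => annihilation n p.1 p.2)) :
    ∃ (f : C(closure ball, ℂ)) (hy' : y ∈ phaseAlgebra n), ⟨y, hy'⟩ - phaseToeplitz n f ∈ I := by
  have hy' : y ∈ Algebra.adjoin ℂ ((Set.range fun p : Fin 2 × Fin 2 => annihilation n p.1 p.2) ∪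
      star (Set.range fun p : Fin 2 × Fin 2 => annihilation n p.1 p.2)) := by
    rwa [← StarAlgebra.adjoin_toSubalgebra, StarSubalgebra.mem_toSubalgebra]
  clear hy
  induction hy' using Algebra.adjoin_induction with
  | mem x hx =>
    rcases hx with ⟨p, rfl⟩ | ⟨p, hp⟩
    · refine ⟨coord p.1 p.2, annihilation_mem n p.1 p.2, ?_⟩
      convert I.zero_mem using 1
      exact sub_self _
    · have hp' : x = toeplitz n (conjCoord p.1 p.2) := by
        rw [toeplitz_conjCoord, ← star_star x]
        exact congrArg star hp.symm
      subst hp'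
      refine ⟨conjCoord p.1 p.2, toeplitz_mem n _, ?_⟩
      convert I.zero_mem using 1
      exact sub_self _
  | algebraMap r =>
    refine ⟨r • 1, (phaseAlgebra n).algebraMap_mem r, ?_⟩
    convert I.zero_mem using 1
    rw [phaseToeplitz_smul, phaseToeplitz_one, ← Algebra.algebraMap_eq_smul_one]
    exact sub_self _
  | add x y _ _ hx hy =>
    obtain ⟨f, hx', hf⟩ := hx
    obtain ⟨g, hy', hg⟩ := hy
    refine ⟨f + g, add_mem hx' hy', ?_⟩
    convert I.add_mem hf hg using 1
    rw [phaseToeplitz_add, ← add_sub_add_comm]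
    rfl
  | mul x y _ _ hx hy =>
    obtain ⟨f, hx', hf⟩ := hx
    obtain ⟨g, hy', hg⟩ := hy
    refine ⟨f * g, mul_mem hx' hy', ?_⟩
    convert I.add_mem (I.add_mem (I.mul_mem_right _ ⟨y, hy'⟩ hf)
      (I.mul_mem_left (phaseToeplitz n f) _ hg)) (phaseToeplitz_mul_sub_mem hI hc f g) using 1
    rw [sub_mul, mul_sub, sub_add_sub_cancel, sub_add_sub_cancel]
    rfl

/-- A continuous function can be modified where it exceeds `ε` in modulus so that it is bounded by
`ε`. -/
theorem exists_norm_le_eq_of_norm_le {K : Type*} [TopologicalSpace K] [CompactSpace K]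
    (f : C(K, ℂ)) {ε : ℝ} (hε : 0 < ε) :
    ∃ g : C(K, ℂ), ‖g‖ ≤ ε ∧ ∀ Z, ‖f Z‖ ≤ ε → g Z = f Z := by
  have hpos : ∀ Z, 0 < max ε ‖f Z‖ := fun Z => hε.trans_le (le_max_left _ _)
  refine ⟨⟨fun Z => ((ε / max ε ‖f Z‖ : ℝ) : ℂ) * f Z, ?_⟩, ?_, fun Z hZ => ?_⟩
  · have h : Continuous fun Z => ε / max ε ‖f Z‖ :=
      continuous_const.div (continuous_const.max f.continuous.norm) fun Z => (hpos Z).ne'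
    exact (Complex.continuous_ofReal.comp h).mul f.continuous
  · refine (ContinuousMap.norm_le _ hε.le).2 fun Z => ?_
    rw [ContinuousMap.coe_mk, norm_mul, Complex.norm_real, Real.norm_of_nonneg
      (div_nonneg hε.le (hpos Z).le), div_mul_eq_mul_div, div_le_iff₀ (hpos Z)]
    exact mul_le_mul_of_nonneg_left (le_max_right _ _) hε.le
  · rw [ContinuousMap.coe_mk, max_eq_left hZ, div_self hε.ne', Complex.ofReal_one, one_mul]

/-- Approximate `x` by a polynomial in the generators and their adjoints, congruent to some `T_f`
modulo `I`. Contractivity of the symbol makes `f` small on `U(2)`, and cutting `f` off there changes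
`T_f` only by an element of `I`, leaving an operator of small norm. -/
theorem mem_of_symbolHom_eq_zero (hn : 3 < n) {I : TwoSidedIdeal (phaseAlgebra n)}
    (hI : IsClosed (I : Set (phaseAlgebra n))) (hc : ∀ a b : phaseAlgebra n, a * b - b * a ∈ I)
    (hker : ∀ x ∈ I, symbolHom hn x = 0) {x : phaseAlgebra n} (hx : symbolHom hn x = 0) : x ∈ I := by
  change x ∈ (I : Set (phaseAlgebra n))
  rw [← hI.closure_eq, Metric.mem_closure_iff]
  intro ε hε
  have hx' : (x : State n →L[ℂ] State n) ∈ closure ((StarAlgebra.adjoin ℂ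
      (Set.range fun p : Fin 2 × Fin 2 => annihilation n p.1 p.2) : Set _)) := x.2
  obtain ⟨y, hy, hxy⟩ := Metric.mem_closure_iff.1 hx' (ε / 2) (by positivity)
  obtain ⟨f, hy', hf⟩ := exists_toeplitz_mod hI hc hy
  obtain ⟨z, hz⟩ : ∃ z : phaseAlgebra n, z = ⟨y, hy'⟩ := ⟨_, rfl⟩
  rw [← hz] at hf
  have hxz : ‖x - z‖ < ε / 2 := by
    rw [dist_eq_norm] at hxy
    rw [hz]
    exact hxy
  have hsym : symbolHom hn (x - z) = -f.comp boundaryIncl := by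
    rw [map_sub, hx, zero_sub, neg_inj, ← symbolHom_phaseToeplitz hn, ← sub_eq_zero, ← map_sub]
    exact hker _ hf
  have hfU : ∀ u : U2, ‖f (boundaryIncl u)‖ ≤ ε / 2 := by
    intro u
    have h1 := (norm_symbolHom_le hn (x - z)).trans hxz.le
    rw [hsym, norm_neg] at h1
    exact ((f.comp boundaryIncl).norm_coe_le_norm u).trans h1
  obtain ⟨g, hg, hgf⟩ := exists_norm_le_eq_of_norm_le f (half_pos hε)
  have h2 : phaseToeplitz n (f - g) ∈ I := phaseToeplitz_mem_of_vanish hI hc fun Z hZ => by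
    rw [ContinuousMap.sub_apply, hgf Z (hfU ⟨Z, hZ⟩), sub_self]
  refine ⟨z - phaseToeplitz n g, ?_, ?_⟩
  · have := I.add_mem hf h2
    rwa [phaseToeplitz_sub, sub_add_sub_cancel] at this
  · rw [dist_eq_norm, ← sub_add]
    have h3 : ‖phaseToeplitz n g‖ ≤ ε / 2 := (norm_toeplitz_le g).trans hg
    have h4 := norm_add_le (x - z) (phaseToeplitz n g)
    linarith

theorem mem_commutatorIdeal_iff (hn : 3 < n) (x : phaseAlgebra n) :
    x ∈ commutatorIdeal (phaseAlgebra n) ↔ symbolHom hn x = 0 := by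
  have hmem : ∀ y, y ∈ TwoSidedIdeal.ker (symbolHom hn) ↔ symbolHom hn y = 0 := fun y =>
    TwoSidedIdeal.mem_ker _
  have hcont : Continuous (symbolHom hn) :=
    AddMonoidHomClass.continuous_of_bound (symbolHom hn) 1 fun y => by
      rw [one_mul]
      exact norm_symbolHom_le hn y
  have hclosed : IsClosed (TwoSidedIdeal.ker (symbolHom hn) : Set (phaseAlgebra n)) := by
    have e : (TwoSidedIdeal.ker (symbolHom hn) : Set (phaseAlgebra n)) =
        {y | symbolHom hn y = 0} := Set.ext hmem
    rw [e]
    exact isClosed_eq hcont continuous_const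
  have hcomm : ∀ a b : phaseAlgebra n, a * b - b * a ∈ TwoSidedIdeal.ker (symbolHom hn) :=
    fun a b => by rw [hmem, map_sub, map_mul, map_mul, mul_comm, sub_self]
  refine ⟨fun hx => (hmem x).1 (hx _ hclosed hcomm), fun hx I hI hc => ?_⟩
  -- The approximation argument needs an ideal on which the symbol vanishes; intersecting `I` with
  -- the kernel gives one that is still closed and contains all commutators.
  have hinf : ∀ y, y ∈ I ⊓ TwoSidedIdeal.ker (symbolHom hn) ↔
      y ∈ I ∧ y ∈ TwoSidedIdeal.ker (symbolHom hn) := fun y => TwoSidedIdeal.mem_inf _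
  refine ((hinf x).1 (mem_of_symbolHom_eq_zero hn ?_ (fun a b => ?_) (fun y hy => ?_) hx)).1
  · have e : ((I ⊓ TwoSidedIdeal.ker (symbolHom hn) : TwoSidedIdeal _) : Set (phaseAlgebra n)) =
        (I : Set (phaseAlgebra n)) ∩ (TwoSidedIdeal.ker (symbolHom hn) : Set (phaseAlgebra n)) :=
      Set.ext hinf
    rw [e]
    exact hI.inter hclosed
  · exact (hinf _).2 ⟨hc a b, hcomm a b⟩
  · exact (hmem y).1 ((hinf y).1 hy).2

/-! ## The unitary group and compactified Minkowski space -/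

theorem twistor_inner (u v : Twistor) :
    inner ℂ u v = star (fun i => u (Sum.inl i)) ⬝ᵥ (fun i => v (Sum.inl i)) +
      star (fun i => u (Sum.inr i)) ⬝ᵥ (fun i => v (Sum.inr i)) := by
  rw [PiLp.inner_apply, Fintype.sum_sum_type]
  exact congrArg₂ (· + ·) (Finset.sum_congr rfl fun i _ => mul_comm _ _)
    (Finset.sum_congr rfl fun i _ => mul_comm _ _)

/-- The coordinate of the orthogonal projection onto the graph of `Z`. -/
def graphCoord (Z : Mat2) (v : Twistor) : Fin 2 → ℂ :=
  (1 / 2 : ℂ) • ((Matrix.of Z)ᴴ *ᵥ (fun i => v (Sum.inl i)) + fun i => v (Sum.inr i))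

/-- For unitary `Z` the vector `(a, b)` projects to the graph point over `(Z†a + b)/2`. The formula
is continuous in `Z`, as the Grassmannian topology requires. -/
theorem starProjection_range_graphMap {Z : Mat2} (hZ : Z ∈ U2) (v : Twistor) :
    (LinearMap.range (graphMap Z)).starProjection v = graphMap Z (graphCoord Z v) := by
  refine Submodule.eq_starProjection_of_mem_of_inner_eq_zero ⟨_, rfl⟩ ?_
  rintro _ ⟨ξ, rfl⟩
  have hU : (Matrix.of Z)ᴴ * Matrix.of Z = 1 := hZ
  set a : Fin 2 → ℂ := fun i => v (Sum.inl i) with ha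
  set b : Fin 2 → ℂ := fun i => v (Sum.inr i) with hb
  rw [← inner_conj_symm, twistor_inner]
  change conj (star (Matrix.of Z *ᵥ ξ) ⬝ᵥ (a - Matrix.of Z *ᵥ graphCoord Z v) +
    star ξ ⬝ᵥ (b - graphCoord Z v)) = 0
  rw [Matrix.star_mulVec, ← Matrix.dotProduct_mulVec, Matrix.mulVec_sub, Matrix.mulVec_mulVec, hU,
    Matrix.one_mulVec, ← dotProduct_add]
  have h : (Matrix.of Z)ᴴ *ᵥ a - graphCoord Z v + (b - graphCoord Z v) = 0 := by
    rw [graphCoord, ← ha, ← hb]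
    module
  rw [h, dotProduct_zero, map_zero]

theorem minkowski_injective : Function.Injective
    fun w : Minkowski => (w.1.starProjection : Twistor →L[ℂ] Twistor) := by
  intro w w' h
  exact Subtype.ext (Submodule.starProjection_inj.1 h)

instance t2Space_minkowski : T2Space Minkowski :=
  T2Space.of_injective_continuous minkowski_injective continuous_induced_dom

theorem continuous_minkowskiPoint : Continuous minkowskiPoint := by
  refine continuous_induced_rng.2 (continuous_clm_apply.2 fun v => ?_)
  have e : (fun Z : U2 => (minkowskiPoint Z).1.starProjection v) =
      fun Z : U2 => graphMap Z (graphCoord Z v) :=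
    funext fun Z => starProjection_range_graphMap Z.2 v
  change Continuous fun Z : U2 => (minkowskiPoint Z).1.starProjection v
  rw [e]
  have hc : Continuous fun Z : U2 => Matrix.of Z.1 := continuous_subtype_val
  have h1 : Continuous fun Z : U2 => graphCoord Z v :=
    Continuous.fun_const_smul
      ((hc.matrix_conjTranspose.matrix_mulVec continuous_const).add continuous_const) _
  refine (PiLp.continuous_toLp 2 _).comp (continuous_pi fun i => ?_)
  cases i with
  | inl i => exact (continuous_apply i).comp (hc.matrix_mulVec h1)
  | inr i => exact (continuous_apply i).comp h1

theorem minkowskiPoint_injective : Function.Injective minkowskiPoint := by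
  intro Z W h
  have h' : LinearMap.range (graphMap Z) = LinearMap.range (graphMap W) := congrArg Subtype.val h
  have key : ∀ ζ, Matrix.of Z.1 *ᵥ ζ = Matrix.of W.1 *ᵥ ζ := by
    intro ζ
    have h1 : graphMap Z ζ ∈ LinearMap.range (graphMap W) := h' ▸ ⟨ζ, rfl⟩
    obtain ⟨ξ, hξ⟩ := h1
    have h2 : ξ = ζ := funext fun i => congrArg (fun u : Twistor => u (Sum.inr i)) hξ
    subst h2
    exact funext fun i => congrArg (fun u : Twistor => u (Sum.inl i)) hξ.symm
  exact Subtype.ext (Matrix.of.injective (Matrix.mulVec_injective (funext key)))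

/-- An isotropic vector with zero second component has zero first component by definiteness, so the
second projection is injective on the plane, hence bijective by dimension, and the plane is a graph.
-/
theorem exists_graphMap_range (w : Minkowski) : ∃ Z : Mat2, LinearMap.range (graphMap Z) = w.1 := by
  let p : w.1 →ₗ[ℂ] Fin 2 → ℂ :=
    { toFun := fun u i => u.1 (Sum.inr i)
      map_add' := fun u v => rfl
      map_smul' := fun c u => rfl }
  let q : w.1 →ₗ[ℂ] Fin 2 → ℂ :=
    { toFun := fun u i => u.1 (Sum.inl i)
      map_add' := fun u v => rfl
      map_smul' := fun c u => rfl }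
  have hp : Function.Injective p := by
    rw [← LinearMap.ker_eq_bot, LinearMap.ker_eq_bot']
    intro u hu
    have h2 : ∀ i, u.1 (Sum.inr i) = 0 := fun i => congrFun hu i
    have h1 := w.2.2 u.1 u.2 u.1 u.2
    simp only [twistorForm, h2, map_zero, mul_zero, Finset.sum_const_zero, sub_zero] at h1
    have h3 : star (fun i => u.1 (Sum.inl i)) ⬝ᵥ (fun i => u.1 (Sum.inl i)) = 0 := h1
    rw [dotProduct_star_self_eq_zero] at h3
    refine Subtype.ext (PiLp.ext fun i => ?_)
    cases i with
    | inl i => exact congrFun h3 i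
    | inr i => exact h2 i
  let e := LinearEquiv.ofInjectiveOfFinrankEq p hp (by rw [w.2.1]; simp)
  have he : ∀ u, e u = p u := fun u => rfl
  have hpe : ∀ ζ, p (e.symm ζ) = ζ := fun ζ => by rw [← he, e.apply_symm_apply]
  refine ⟨LinearMap.toMatrix' (q ∘ₗ e.symm.toLinearMap), ?_⟩
  have hg : ∀ ζ, graphMap (LinearMap.toMatrix' (q ∘ₗ e.symm.toLinearMap)) ζ = (e.symm ζ).1 := by
    intro ζ
    refine PiLp.ext fun i => ?_
    cases i with
    | inl i => exact congrFun (LinearMap.toMatrix'_mulVec (q ∘ₗ e.symm.toLinearMap) ζ) i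
    | inr i => exact (congrFun (hpe ζ) i).symm
  ext u
  constructor
  · rintro ⟨ζ, rfl⟩
    rw [hg]
    exact (e.symm ζ).2
  · intro hu
    exact ⟨e ⟨u, hu⟩, by rw [hg, e.symm_apply_apply]⟩

theorem mem_U2_of_isotropic {Z : Mat2}
    (h : ∀ ζ ξ, twistorForm (graphMap Z ζ) (graphMap Z ξ) = 0) : Z ∈ U2 := by
  change (Matrix.of Z)ᴴ * Matrix.of Z = 1
  ext i j
  have h1 := sub_eq_zero.1 (h (Pi.single i 1) (Pi.single j 1))
  have h2 : star (Matrix.of Z *ᵥ Pi.single i 1) ⬝ᵥ (Matrix.of Z *ᵥ Pi.single j 1) =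
      star (Pi.single i 1 : Fin 2 → ℂ) ⬝ᵥ Pi.single j 1 := h1
  rw [Matrix.star_mulVec, ← Matrix.dotProduct_mulVec, Matrix.mulVec_mulVec] at h2
  simpa [Matrix.one_apply, Pi.single_apply, eq_comm] using h2

theorem minkowskiPoint_surjective : Function.Surjective minkowskiPoint := by
  intro w
  obtain ⟨Z, hZ⟩ := exists_graphMap_range w
  have hU : Z ∈ U2 := mem_U2_of_isotropic fun ζ ξ =>
    w.2.2 _ (hZ ▸ ⟨ζ, rfl⟩) _ (hZ ▸ ⟨ξ, rfl⟩)
  exact ⟨⟨Z, hU⟩, Subtype.ext hZ⟩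

theorem isHomeomorph_minkowskiPoint : IsHomeomorph minkowskiPoint :=
  isHomeomorph_iff_continuous_bijective.2
    ⟨continuous_minkowskiPoint, minkowskiPoint_injective, minkowskiPoint_surjective⟩

/-! ## The Shilov boundary -/

/-- A kernel vector `x` would satisfy `x = -ζ Z†x`, hence `‖x‖ ≤ ‖Z†x‖`, against positivity of `1 -
ZZ†`. -/
theorem StrictContraction.isUnit_one_add_smul {Z : M2} (hZ : StrictContraction Z) {ζ : ℂ}
    (hζ : ‖ζ‖ ≤ 1) : IsUnit (1 + ζ • Zᴴ) := by
  rw [Matrix.isUnit_iff_isUnit_det, isUnit_iff_ne_zero]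
  intro h0
  obtain ⟨x, hx, h⟩ := Matrix.exists_mulVec_eq_zero_iff.2 h0
  have hx' : x = -ζ • (Zᴴ *ᵥ x) := by
    rw [Matrix.add_mulVec, Matrix.one_mulVec, Matrix.smul_mulVec] at h
    rw [neg_smul]
    exact eq_neg_of_add_eq_zero_left h
  have hpos := (Matrix.PosDef.dotProduct_mulVec_pos hZ.conjTranspose hx)
  rw [Matrix.conjTranspose_conjTranspose, Matrix.sub_mulVec, Matrix.one_mulVec, dotProduct_sub,
    ← Matrix.mulVec_mulVec, Matrix.dotProduct_mulVec, ← Matrix.conjTranspose_conjTranspose Z,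
    ← Matrix.star_mulVec, Matrix.conjTranspose_conjTranspose] at hpos
  set y := Zᴴ *ᵥ x with hy
  have e : star x ⬝ᵥ x = ((‖ζ‖ ^ 2 : ℝ) : ℂ) * (star y ⬝ᵥ y) := by
    rw [hx', star_smul, smul_dotProduct, dotProduct_smul, smul_smul, smul_eq_mul, star_neg, neg_mul_neg,
      Complex.star_def, ← Complex.normSq_eq_conj_mul_self, Complex.normSq_eq_norm_sq]
  rw [e] at hpos
  have h1 : 0 ≤ (star y ⬝ᵥ y).re := (Complex.nonneg_iff.1 (dotProduct_star_self_nonneg y)).1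
  have h2 := (Complex.pos_iff.1 hpos).1
  rw [Complex.sub_re, Complex.re_ofReal_mul] at h2
  have h3 : ‖ζ‖ ^ 2 ≤ 1 := pow_le_one₀ (norm_nonneg _) hζ
  nlinarith

/-- The analytic disc `ζ ↦ Z + ζ A (1 + ζ Z†)⁻¹ B` through `Z`, with boundary in `U(2)`. -/
def disc (Z : M2) (ζ : ℂ) : M2 := displace Z (ζ • (1 + ζ • Zᴴ)⁻¹)

/-- Write every term as `R† (·) R` with `R = (1 + ζ Z†)⁻¹`; the bracket collapses to `1 - |ζ|²`. So
the disc lies in the ball for `|ζ| < 1` and in `U(2)` for `|ζ| = 1`. -/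
theorem StrictContraction.midFactor_disc {Z : M2} (hZ : StrictContraction Z) {ζ : ℂ}
    (hζ : ‖ζ‖ ≤ 1) : midFactor Z (ζ • (1 + ζ • Zᴴ)⁻¹) =
      (1 - ‖ζ‖ ^ 2 : ℝ) • (((1 + ζ • Zᴴ)⁻¹)ᴴ * (1 + ζ • Zᴴ)⁻¹) := by
  have hu := (Matrix.isUnit_iff_isUnit_det _).1 (hZ.isUnit_one_add_smul hζ)
  set N := 1 + ζ • Zᴴ with hN
  set R := N⁻¹ with hR
  have h1 : N * R = 1 := Matrix.mul_nonsing_inv N hu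
  have h2 : Rᴴ * Nᴴ = 1 := by rw [← Matrix.conjTranspose_mul, h1, Matrix.conjTranspose_one]
  have hN' : Nᴴ = 1 + conj ζ • Z := by
    rw [hN, Matrix.conjTranspose_add, Matrix.conjTranspose_one, Matrix.conjTranspose_smul,
      Matrix.conjTranspose_conjTranspose]
    rfl
  have a1 : (1 : M2) = Rᴴ * (Nᴴ * N) * R := by
    rw [← Matrix.mul_assoc, h2, Matrix.one_mul, h1]
  have a2 : Zᴴ * (ζ • R) = Rᴴ * (Nᴴ * (ζ • Zᴴ)) * R := by
    rw [← Matrix.mul_assoc, h2, Matrix.one_mul, Matrix.mul_smul, Matrix.smul_mul]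
  have a3 : (ζ • R)ᴴ * Z = Rᴴ * ((conj ζ • Z) * N) * R := by
    rw [Matrix.mul_assoc, Matrix.mul_assoc, h1, Matrix.mul_one, Matrix.conjTranspose_smul,
      Matrix.smul_mul, Matrix.mul_smul]
    rfl
  have a4 : (ζ • R)ᴴ * (rdef Zᴴ * rdef Zᴴ) * (ζ • R) = Rᴴ * ((conj ζ * ζ) • (1 - Z * Zᴴ)) * R := by
    rw [hZ.rdef_conjTranspose_mul, Matrix.conjTranspose_smul]
    simp only [Matrix.smul_mul, Matrix.mul_smul, smul_smul]
    rw [mul_comm]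
    rfl
  have key : Nᴴ * N - (Nᴴ * (ζ • Zᴴ) + (conj ζ • Z) * N + (conj ζ * ζ) • (1 - Z * Zᴴ)) =
      (1 - conj ζ * ζ) • (1 : M2) := by
    rw [hN', hN]
    simp only [Matrix.add_mul, Matrix.mul_add, Matrix.one_mul, Matrix.mul_one, Matrix.smul_mul,
      Matrix.mul_smul]
    module
  have hs : ((1 - ‖ζ‖ ^ 2 : ℝ) : ℂ) = 1 - conj ζ * ζ := by
    rw [← Complex.normSq_eq_conj_mul_self, Complex.normSq_eq_norm_sq]
    push_cast
    rfl
  rw [midFactor, a2, a3, a4]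
  nth_rewrite 1 [a1]
  rw [← Matrix.add_mul, ← Matrix.add_mul, ← Matrix.sub_mul, ← Matrix.mul_add, ← Matrix.mul_add,
    ← Matrix.mul_sub, key, Matrix.mul_smul, Matrix.mul_one, Matrix.smul_mul, ← hs]
  rfl

theorem StrictContraction.one_sub_disc {Z : M2} (hZ : StrictContraction Z) {ζ : ℂ}
    (hζ : ‖ζ‖ ≤ 1) : 1 - (disc Z ζ)ᴴ * disc Z ζ =
      (1 - ‖ζ‖ ^ 2 : ℝ) • (((1 + ζ • Zᴴ)⁻¹ * rdef Z)ᴴ * ((1 + ζ • Zᴴ)⁻¹ * rdef Z)) := by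
  have h2 : (rdef Z)ᴴ = rdef Z := rdef_isHermitian _
  rw [disc, hZ.one_sub_displace, hZ.midFactor_disc hζ, Matrix.conjTranspose_mul, h2,
    Matrix.mul_smul, Matrix.smul_mul]
  simp only [Matrix.mul_assoc]

theorem StrictContraction.disc {Z : M2} (hZ : StrictContraction Z) {ζ : ℂ} (hζ : ‖ζ‖ < 1) :
    StrictContraction (disc Z ζ) := by
  rw [StrictContraction, hZ.one_sub_disc hζ.le]
  refine Matrix.PosDef.smul ?_ (sub_pos.2 (pow_lt_one₀ (norm_nonneg _) hζ two_ne_zero))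
  refine Matrix.PosDef.conjTranspose_mul_self _ (Matrix.mulVec_injective_of_isUnit ?_)
  refine IsUnit.mul ?_ hZ.isUnit_rdef
  rw [Matrix.isUnit_nonsing_inv_iff]
  exact hZ.isUnit_one_add_smul hζ.le

theorem StrictContraction.disc_mem_U2 {Z : M2} (hZ : StrictContraction Z) {ζ : ℂ}
    (hζ : ‖ζ‖ = 1) : (QuantumMinkowski.disc Z ζ : Mat2) ∈ U2 := by
  refine mem_U2_iff.2 ((hZ.one_sub_disc hζ.le).trans ?_)
  rw [hζ, one_pow, sub_self, zero_smul]

theorem disc_zero (Z : M2) : disc Z 0 = Z := by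
  simp [disc, displace]

theorem differentiableAt_displace_apply (Z : M2) {W : ℂ → M2} {ζ : ℂ}
    (hW : ∀ i j, DifferentiableAt ℂ (fun ζ => W ζ i j) ζ) (i j : Fin 2) :
    DifferentiableAt ℂ (fun ζ => displace Z (W ζ) i j) ζ := by
  simp only [displace, Matrix.add_apply, Matrix.mul_apply]
  exact (differentiableAt_const _).add (DifferentiableAt.fun_sum fun k _ =>
    (DifferentiableAt.fun_sum fun l _ => (hW l k).const_mul _).mul_const _)

theorem StrictContraction.differentiableAt_disc {Z : M2} (hZ : StrictContraction Z) {ζ : ℂ}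
    (hζ : ‖ζ‖ ≤ 1) : DifferentiableAt ℂ (fun ζ => (QuantumMinkowski.disc Z ζ : Mat2)) ζ := by
  have hN : ∀ i j, Differentiable ℂ fun ζ : ℂ => (1 + ζ • Zᴴ) i j := fun i j => by
    simp only [Matrix.add_apply, Matrix.smul_apply, smul_eq_mul]
    fun_prop
  have hd : Differentiable ℂ fun ζ : ℂ => (1 + ζ • Zᴴ).det := by
    simp only [Matrix.det_fin_two]
    exact ((hN 0 0).mul (hN 1 1)).sub ((hN 0 1).mul (hN 1 0))
  have ha : ∀ i j, Differentiable ℂ fun ζ : ℂ => (1 + ζ • Zᴴ).adjugate i j := fun i j => by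
    simp only [Matrix.adjugate_fin_two]
    fin_cases i <;> fin_cases j
    exacts [hN 1 1, (hN 0 1).neg, (hN 1 0).neg, hN 0 0]
  have h0 : (1 + ζ • Zᴴ).det ≠ 0 :=
    isUnit_iff_ne_zero.1 ((Matrix.isUnit_iff_isUnit_det _).1 (hZ.isUnit_one_add_smul hζ))
  have hW : ∀ i j, DifferentiableAt ℂ (fun ζ : ℂ => (ζ • (1 + ζ • Zᴴ)⁻¹) i j) ζ := fun i j => by
    simp only [Matrix.smul_apply, Matrix.inv_def, Ring.inverse_eq_inv', smul_eq_mul]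
    exact differentiableAt_id.mul ((hd.differentiableAt.inv h0).mul (ha i j).differentiableAt)
  refine differentiableAt_pi.2 fun i => differentiableAt_pi.2 fun j => ?_
  exact differentiableAt_displace_apply Z hW i j

/-- The one-variable maximum principle along the disc centred at `Z` handles the open ball;
continuity extends the bound to the closure. -/
theorem norm_le_of_forall_mem_U2 {f : Mat2 → ℂ} (hf : ContinuousOn f (closure ball))
    (hf' : DifferentiableOn ℂ f ball) {C : ℝ} (hC : ∀ W ∈ U2, ‖f W‖ ≤ C) {Z : Mat2}
    (hZ : Z ∈ closure ball) : ‖f Z‖ ≤ C := by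
  have hball : ball ⊆ closure ball ∩ f ⁻¹' Metric.closedBall 0 C := by
    intro Z hZ
    refine ⟨subset_closure hZ, mem_closedBall_zero_iff.2 ?_⟩
    have hZ' : StrictContraction (Matrix.of Z) := hZ
    have hmaps : ∀ ζ : ℂ, ‖ζ‖ ≤ 1 → (disc (Matrix.of Z) ζ : Mat2) ∈ closure ball := fun ζ hζ => by
      rcases hζ.lt_or_eq with h | h
      · exact subset_closure (hZ'.disc h)
      · exact U2_subset_closure_ball (hZ'.disc_mem_U2 h)
    have hd : DiffContOnCl ℂ (fun ζ => f (disc (Matrix.of Z) ζ)) (Metric.ball 0 1) := by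
      constructor
      · refine hf'.comp (fun ζ hζ => (hZ'.differentiableAt_disc
          (mem_ball_zero_iff.1 hζ).le).differentiableWithinAt) fun ζ hζ => ?_
        exact hZ'.disc (mem_ball_zero_iff.1 hζ)
      · rw [closure_ball (0 : ℂ) one_ne_zero]
        exact hf.comp (fun ζ hζ => (hZ'.differentiableAt_disc
          (mem_closedBall_zero_iff.1 hζ)).continuousAt.continuousWithinAt) fun ζ hζ =>
            hmaps ζ (mem_closedBall_zero_iff.1 hζ)
    have h := Complex.norm_le_of_forall_mem_frontier_norm_le Metric.isBounded_ball hd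
      (C := C) (fun ζ hζ => ?_) (subset_closure (Metric.mem_ball_self one_pos))
    · rw [disc_zero] at h
      exact h
    · rw [frontier_ball (0 : ℂ) one_ne_zero, mem_sphere_zero_iff_norm] at hζ
      exact hC _ (hZ'.disc_mem_U2 hζ)
  have h := closure_minimal hball
    (hf.preimage_isClosed_of_isClosed isClosed_closure Metric.isClosed_closedBall) hZ
  exact mem_closedBall_zero_iff.1 h.2

theorem isShilovBoundary_U2 : IsShilovBoundary U2 := by
  refine ⟨⟨isClosed_U2, U2_subset_closure_ball, fun f hf hf' Z hZ => ?_⟩, ?_⟩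
  · have hne : U2.Nonempty := ⟨fun i j => (1 : M2) i j, by
      change (1 : M2)ᴴ * 1 = 1
      rw [Matrix.conjTranspose_one, Matrix.one_mul]⟩
    obtain ⟨W, hW, hmax⟩ := (isCompact_iff_compactSpace.2 compactSpace_U2).exists_isMaxOn hne
      (hf.mono U2_subset_closure_ball).norm
    exact ⟨W, hW, norm_le_of_forall_mem_U2 hf hf' (fun V hV => hmax hV) hZ⟩
  · rintro S ⟨-, hS, h⟩ u hu
    -- A competing set must contain a point where the peak function at `u` is at least as large as
    -- at `u`, and the only such point is `u`.
    obtain ⟨W, hW, hle⟩ := h (peak u 1) (differentiable_peak u 1).continuous.continuousOn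
      (differentiable_peak u 1).differentiableOn u (U2_subset_closure_ball hu)
    have h1 := pow_le_pow_left₀ (norm_nonneg _) hle 2
    rw [norm_peak_sq, norm_peak_sq, gap_self hu, Real.exp_le_exp, Nat.cast_one, one_mul,
      one_mul, neg_le_neg_iff] at h1
    exact eq_of_gap_le_zero hu (hS hW) h1 ▸ hW

end QuantumMinkowski

end

/-! ### Assembly of the exact sequence. -/

theorem mainTheorem1 (n : ℕ) (hn : 3 < n) :
    QuantumMinkowski.IsShilovBoundary QuantumMinkowski.U2 ∧
    IsHomeomorph QuantumMinkowski.minkowskiPoint ∧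
    ∃ (ι : QuantumMinkowski.commutatorIdeal (QuantumMinkowski.phaseAlgebra n) →⋆ₙₐ[ℂ]
          QuantumMinkowski.phaseAlgebra n)
      (π : QuantumMinkowski.phaseAlgebra n →⋆ₐ[ℂ] C(QuantumMinkowski.Minkowski, ℂ)),
      (∀ x, ι x = (x : QuantumMinkowski.phaseAlgebra n)) ∧
      Function.Injective ι ∧
      Function.Exact ι π ∧
      Function.Surjective π ∧
      ∀ f : C(closure QuantumMinkowski.ball, ℂ),
        ∃ hf : QuantumMinkowski.toeplitz n f ∈ QuantumMinkowski.phaseAlgebra n,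
          ∀ Z : QuantumMinkowski.U2,
            π ⟨QuantumMinkowski.toeplitz n f, hf⟩ (QuantumMinkowski.minkowskiPoint Z) =
              f ⟨Z, QuantumMinkowski.U2_subset_closure_ball Z.2⟩ := by
  have hh := QuantumMinkowski.isHomeomorph_minkowskiPoint
  have hinv : ∀ Z, hh.homeomorph.symm (QuantumMinkowski.minkowskiPoint Z) = Z :=
    hh.homeomorph.symm_apply_apply
  -- Transporting symbols from `U(2)` to Minkowski space is injective, so the kernel is unchanged.
  have hπ : Function.Injective (ContinuousMap.compStarAlgHom' ℂ ℂ
      (hh.homeomorph.symm : C(QuantumMinkowski.Minkowski, QuantumMinkowski.U2))) := by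
    intro φ χ h
    ext Z
    have h1 := DFunLike.congr_fun h (QuantumMinkowski.minkowskiPoint Z)
    change φ (hh.homeomorph.symm _) = χ (hh.homeomorph.symm _) at h1
    rwa [hinv] at h1
  refine ⟨QuantumMinkowski.isShilovBoundary_U2, hh,
    NonUnitalStarSubalgebraClass.subtype _,
    (ContinuousMap.compStarAlgHom' ℂ ℂ
      (hh.homeomorph.symm : C(QuantumMinkowski.Minkowski, QuantumMinkowski.U2))).comp
      (QuantumMinkowski.symbolHom hn), fun x => rfl, Subtype.val_injective, fun x => ?_, ?_,
    fun f => ⟨QuantumMinkowski.toeplitz_mem n f, fun Z => ?_⟩⟩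
  · have h1 : x ∈ Set.range (NonUnitalStarSubalgebraClass.subtype
        (QuantumMinkowski.commutatorIdeal (QuantumMinkowski.phaseAlgebra n))) ↔
        x ∈ QuantumMinkowski.commutatorIdeal (QuantumMinkowski.phaseAlgebra n) :=
      ⟨fun ⟨y, hy⟩ => hy ▸ y.2, fun hx => ⟨⟨x, hx⟩, rfl⟩⟩
    rw [h1, QuantumMinkowski.mem_commutatorIdeal_iff hn, StarAlgHom.comp_apply,
      map_eq_zero_iff _ hπ]
  · intro φ
    obtain ⟨x, hx⟩ := QuantumMinkowski.symbolHom_surjective hn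
      (φ.comp ⟨QuantumMinkowski.minkowskiPoint, hh.continuous⟩)
    refine ⟨x, ?_⟩
    rw [StarAlgHom.comp_apply, hx]
    ext w
    exact congrArg φ (hh.homeomorph.apply_symm_apply w)
  · have h := DFunLike.congr_fun (QuantumMinkowski.symbolHom_phaseToeplitz hn f)
      (hh.homeomorph.symm (QuantumMinkowski.minkowskiPoint Z))
    rw [hinv] at h
    refine (congrArg (QuantumMinkowski.symbolHom hn (QuantumMinkowski.phaseToeplitz n f))
      (hinv Z)).trans h
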